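/- Let $\Delta$ be a reduced crystallographic root system of type $B_p$ or $C_p$ ($p\ge 2$) or $F_4$ (with $p=4$), spanning a Euclidean space $V$ of dimension $p$ whose inner product $(\cdot,\cdot)$ is invariant under the Weyl group $W$. Let $\Pi=\{\alpha_1,\dots,\alpha_p\}$ be a set of simple roots, $\Delta^+$ the positive roots, $\Delta^+_s$ and $\Delta^+_l$ the short and the long positive roots, and order $\Delta^+$ by $\mu\preccurlyeq\gamma$ iff $\gamma-\mu$ is a nonnegative integral combination of simple roots. Let $e_1,\dots,e_p$ be the exponents of $W$, that is, the eigenvalues of a Coxeter element of order $h$ are $e^{2\pi i e_j/h}$ with $0\le e_j<h$. Let $\theta=\sum_i c_i\alpha_i$ be the highest root and $g=\sum_{\alpha_i\text{ short}}c_i$. For $m\ge 0$ let $\mathrm{Cat}_s^m(\Delta)$ be the arrangement in $V$ of the hyperplanes $\{x : (x,\mu)=k\}$ for $\mu\in\Delta_s^+$, $k\in\{-m,\dots,m\}$, and $\{x : (x,\nu)=0\}$ for $\nu\in\Delta_l^+$, and put $\mathrm{Cat}_s(\Delta)=\mathrm{Cat}_s^1(\Delta)$. For a finite arrangement $\mathcal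 A$ let $\chi(\mathcal A,t)=\sum_X \mu(V,X)\,t^{\dim X}$ be its characteristic polynomial, where $X$ runs over the nonempty intersections of hyperplanes of $\mathcal A$ (including $V$), ordered by reverse inclusion, and $\mu$ is the Möbius function of this poset. Let $\mathfrak{AN}_s$ be the set of antichains of $(\Delta^+,\preccurlyeq)$ that consist of short roots, and $\mathfrak{AN}_{s,0}$ the set of those which contain no simple root of the root system $\Delta_s$ of short roots (with positive roots $\Delta_s^+$). Then, as polynomials in $t$, for every $m\ge 0$, $$\chi(\mathrm{Cat}_s^m(\Delta),t)=\chi(\mathrm{Cat}_s^0(\Delta),t-mg)=\prod_{i=1}^p(t-mg-e_i);$$ in particular $\chi(\mathrm{Cat}_s(\Delta),t)=\prod_{i=1}^p(t-g-e_i)$. Moreover $$\#\mathfrak{AN}_s=\frac{|\chi(\mathrm{Cat}_s(\Delta),-1)|}{\#W}=\prod_{i=1}^p\frac{g+e_i+1}{e_i+1},\qquad \#\mathfrak{AN}_{s,0}=\frac{|\chi(\mathrm{Cat}_s(\Delta),1)|}{\#W}=\prod_{i=1}^p\frac{g+e_i-1}{e_i+1}.$$ -/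

import Mathlib

open Polynomial

section Arrangements

variable {V : Type*} [NormedAddCommGroup V] [InnerProductSpace ℝ V]

/-- The hyperplane `{x | (x, μ) = k}` (for `μ ≠ 0`). -/
def rootHyperplane (μ : V) (k : ℤ) : AffineSubspace ℝ V where
  carrier := {x | inner ℝ x μ = (k : ℝ)}
  smul_vsub_vadd_mem' := by
    intro c x y z hx hy hz
    simp only [Set.mem_ofPred_eq, vsub_eq_sub, vadd_eq_add, inner_add_left, inner_sub_left,
      real_inner_smul_left] at *
    rw [hx, hy, hz]; ring

/-- The intersection poset of a finite arrangement `A`: all nonempty intersections of members of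
`A` (the whole space, as the empty intersection, included), ordered by reverse inclusion. -/
@[ext] structure IntersectionPoset (A : Finset (AffineSubspace ℝ V)) where
  /-- The underlying affine subspace. -/
  flat : AffineSubspace ℝ V
  nonempty : (flat : Set V).Nonempty
  isInter : ∃ S : Finset (AffineSubspace ℝ V), S ⊆ A ∧ flat = S.inf id

namespace IntersectionPoset

variable {A : Finset (AffineSubspace ℝ V)}

instance : PartialOrder (IntersectionPoset A) :=
  PartialOrder.lift (fun X => OrderDual.toDual X.flat) fun _ _ h => IntersectionPoset.ext h

theorem le_iff (X Y : IntersectionPoset A) : X ≤ Y ↔ Y.flat ≤ X.flat := Iff.rfl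

/-- The minimum of the intersection poset is the ambient space. -/
instance : OrderBot (IntersectionPoset A) where
  bot := ⟨⊤, ⟨0, trivial⟩, ∅, Finset.empty_subset _, rfl⟩
  bot_le X := (le_top : X.flat ≤ ⊤)

theorem bot_flat : (⊥ : IntersectionPoset A).flat = ⊤ := rfl

instance : Finite (IntersectionPoset A) := by
  choose S hS hX using fun X : IntersectionPoset A => X.isInter
  refine Finite.of_injective
    (fun X => (⟨S X, Finset.mem_powerset.2 (hS X)⟩ : A.powerset)) fun X Y h => ?_
  have h' : S X = S Y := congrArg Subtype.val h
  exact IntersectionPoset.ext (by rw [hX X, hX Y, h'])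

noncomputable instance : Fintype (IntersectionPoset A) := Fintype.ofFinite _

open Classical in
noncomputable instance : LocallyFiniteOrder (IntersectionPoset A) :=
  Fintype.toLocallyFiniteOrder

end IntersectionPoset

open Classical in
/-- The characteristic polynomial `χ(A, t) = ∑ μ(0̂, X) t ^ dim X` of a finite hyperplane
arrangement, the sum being over the intersection poset and `μ` being its Möbius function. -/
noncomputable def arrangementCharpoly (A : Finset (AffineSubspace ℝ V)) : ℤ[X] :=
  ∑ X : IntersectionPoset A,
    C (IncidenceAlgebra.mu ℤ (⊥ : IntersectionPoset A) X) *
      (Polynomial.X : ℤ[X]) ^ Module.finrank ℝ X.flat.direction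

end Arrangements

section Roots

variable {ι V N : Type*} [NormedAddCommGroup V] [InnerProductSpace ℝ V]
  [AddCommGroup N] [Module ℝ N] {P : RootPairing ι ℝ V N}

/-- The inner product of `V` is invariant under the Weyl group. -/
def IsWeylInvariantInner (P : RootPairing ι ℝ V N) : Prop :=
  ∀ (i : ι) (x y : V), inner ℝ (P.reflection i x) (P.reflection i y) = inner ℝ x y

/-- Roots of minimal length. -/
def IsShortRoot (P : RootPairing ι ℝ V N) (i : ι) : Prop :=
  ∀ j, ‖P.root i‖ ≤ ‖P.root j‖

/-- Roots of maximal length. -/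
def IsLongRoot (P : RootPairing ι ℝ V N) (i : ι) : Prop :=
  ∀ j, ‖P.root j‖ ≤ ‖P.root i‖

/-- The root order: `i ≼ j` when `root j - root i` is a sum of simple roots. -/
def RootLE (b : P.Base) (i j : ι) : Prop :=
  P.root j - P.root i ∈ AddSubmonoid.closure (P.root '' (b.support : Set ι))

/-- The highest root. -/
def IsHighestRoot (b : P.Base) (θ : ι) : Prop := ∀ i, RootLE b i θ

/-- Short positive roots. -/
def IsShortPos (b : P.Base) (i : ι) : Prop := b.IsPos i ∧ IsShortRoot P i

/-- The simple roots of the root system of short roots, with respect to its positive system of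
short positive roots: the short positive roots that are not a sum of two short positive roots. -/
def IsShortSimple (b : P.Base) (i : ι) : Prop :=
  IsShortPos b i ∧
    ¬ ∃ j k, IsShortPos b j ∧ IsShortPos b k ∧ P.root i = P.root j + P.root k

/-- The set of short antichains: antichains of the poset of positive roots that consist of
short roots. -/
def shortAntichains (b : P.Base) : Set (Set ι) :=
  {Γ | (∀ i ∈ Γ, IsShortPos b i) ∧ IsAntichain (RootLE b) Γ}

/-- The set of strictly `s`-positive antichains: short antichains that contain no simple root of
the root system of short roots. -/
def strictlyPosShortAntichains (b : P.Base) : Set (Set ι) :=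
  {Γ | Γ ∈ shortAntichains b ∧ ∀ i ∈ Γ, ¬ IsShortSimple b i}

open Classical in
/-- The `m`-semi-Catalan arrangement: the hyperplanes `(x, μ) = k` for `μ` a short positive root
and `-m ≤ k ≤ m`, and `(x, ν) = 0` for `ν` a long positive root. -/
noncomputable def semiCatalan [Fintype ι] (b : P.Base) (m : ℕ) :
    Finset (AffineSubspace ℝ V) :=
  ((Finset.univ.filter fun i => IsShortPos b i) ×ˢ Finset.Icc (-(m : ℤ)) m).image
      (fun q => rootHyperplane (P.root q.1) q.2) ∪
    (Finset.univ.filter fun i => b.IsPos i ∧ IsLongRoot P i).image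
      (fun i => rootHyperplane (P.root i) 0)

/-- The Cartan matrix of the base `b` whose simple roots are numbered by `e`. -/
noncomputable def numberedCartanMatrix {p : ℕ} [P.IsCrystallographic] (b : P.Base) (e : Fin p ≃ b.support) :
    Matrix (Fin p) (Fin p) ℤ :=
  b.cartanMatrix.submatrix e e

/-- Cartan matrices of the types `B_p`, `C_p` (`p ≥ 2`) and `F₄`, in the standard numbering. -/
def IsCartanBCF {p : ℕ} (A : Matrix (Fin p) (Fin p) ℤ) : Prop :=
  (2 ≤ p ∧ A = CartanMatrix.B p) ∨ (2 ≤ p ∧ A = CartanMatrix.C p) ∨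
    ∃ h : p = 4, A = CartanMatrix.F₄.submatrix (Fin.cast h) (Fin.cast h)

/-- The Coxeter element `s₁ s₂ ⋯ s_p`. -/
noncomputable def coxeterElement {p : ℕ} (b : P.Base) (e : Fin p ≃ b.support) : V ≃ₗ[ℝ] V :=
  (List.ofFn fun i : Fin p => P.reflection (e i : ι)).prod

/-- The exponents of the Weyl group: with `h` the order of a Coxeter element `c`, the multiset of
the integers `0 ≤ k < h`, each with the multiplicity of `exp (2πik / h)` as a root of the
characteristic polynomial of `c`. -/
noncomputable def weylExponents {p : ℕ} [FiniteDimensional ℝ V] (b : P.Base)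
    (e : Fin p ≃ b.support) : Multiset ℕ :=
  ∑ k ∈ Finset.range (orderOf (coxeterElement b e)),
    Multiset.replicate
      (((coxeterElement b e : V →ₗ[ℝ] V).charpoly.map (algebraMap ℝ ℂ)).rootMultiplicity
        (Complex.exp (2 * Real.pi * Complex.I * k / orderOf (coxeterElement b e)))) k

open Classical in
/-- The sum of the short coordinates of a vector `∑ cᵢ αᵢ`, the sum of the `cᵢ` with `αᵢ` short. -/
noncomputable def shortCoordSum {p : ℕ} (b : P.Base) (e : Fin p ≃ b.support)
    (c : Fin p → ℕ) : ℕ :=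
  ∑ i with IsShortRoot P (e i : ι), c i

end Roots

/-!
# Semi-Catalan arrangements and short antichains in types `B`, `C` and `F₄`

All three families of identities follow from the values of the characteristic polynomials, the
exponents, the order of the Weyl group and the two numbers of short antichains
(`HasExponentProducts`); the passage from these data to the identities is
`semiCatalan_conclusions_of_exponents`.

*Characteristic polynomials by counting points.* Whitney's theorem
(`arrangementCharpoly_eq_sum_subfamilies`) writes the characteristic polynomial as an alternating
sum over the subfamilies of hyperplanes with nonempty intersection. A subfamily with integral
equations has, modulo any `q` prime to some fixed number, as many solutions as a power of `q` with
the dimension of its intersection as exponent, and none if it has no real point. By inclusion and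
exclusion the value at such a `q` is the number of points of `(ℤ/q)^p` off the arrangement
(`exists_coprime_eval_arrangementCharpoly`), and a monic polynomial that is proportional to the
count for infinitely many such `q` is the characteristic polynomial
(`charpoly_semiCatalan_eq_of_count`).

*Types `B` and `C`.* There is an orthogonal basis `ε` for which the positive roots are `κ ε_a` and
`ε_a ± ε_c` with `a < c`, where `κ` is `1` in type `B` and `2` in type `C` (`IsSignedBasis`). The
Weyl group consists of the signed permutations of `ε`, and the Coxeter element satisfies
`c ^ p = -1`, so the exponents are `1, 3, …, 2 p - 1`. A point modulo `q = 2 M + 1` off the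
arrangement is a choice of signs together with distinct absolute values, in `{m + 1, …, M}` in type
`B`, or in `{1, …, M}` and more than `m` apart in type `C`; both placements are counted by falling
factorials (`card_injective_placements`, `card_spaced_placements`). The short positive roots form a
chain in type `B`. In type `C` they are the cells of a shifted staircase, whose antichains are
counted by removing a corner cell together with its row or its column
(`cellAntichainCount_corner`), which leads to binomial coefficients.

*Type `F₄`.* The roots are explicit integral vectors in simple coordinates. The points modulo `q`
off the arrangement are the translates under the Weyl group of the integral points of a dilated
alcove. Each orbit meets the alcove, in the point closest to its centre (`exists_inAlcove`), and the
translates are distinct, because every coefficient of the highest root is at least `2` and the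
diagram has no symmetry (`eq_one_of_inAlcove`). So the count is the order of the Weyl group times
a number of lattice points, which is a polynomial for `q` congruent to `1` modulo `6`; comparing
leading coefficients gives the order `1152` as well. The Coxeter element has the characteristic
polynomial `X ^ 4 - X ^ 2 + 1`, the twelfth cyclotomic polynomial, hence the exponents are
`1, 5, 7, 11`.
-/

/-! ### Characteristic polynomials of arrangements -/

section Whitney

variable {V J : Type*} [NormedAddCommGroup V] [InnerProductSpace ℝ V]

open Classical in
/-- Möbius inversion on the intersection poset: the Möbius function counts, with signs, the
subfamilies that cut out a given flat. -/
theorem mu_bot_eq_sum_subfamilies (s : Finset J) (H : J → AffineSubspace ℝ V)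
    (hH : ∀ j ∈ s, H j ≠ ⊤) (A : Finset (AffineSubspace ℝ V)) (hA : A = s.image H)
    (Y : IntersectionPoset A) :
    IncidenceAlgebra.mu ℤ (⊥ : IntersectionPoset A) Y =
      ∑ T ∈ s.powerset with T.inf H = Y.flat, (-1 : ℤ) ^ T.card := by
  subst hA
  have key : ∀ X : IntersectionPoset (s.image H), (if X = ⊥ then (1 : ℤ) else 0) =
      ∑ Y ∈ Finset.Iic X, ∑ T ∈ s.powerset with T.inf H = Y.flat, (-1 : ℤ) ^ T.card := by
    intro X
    have h1 : ∑ Y ∈ Finset.Iic X, ∑ T ∈ s.powerset with T.inf H = Y.flat, (-1 : ℤ) ^ T.card =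
        ∑ T ∈ s.powerset with X.flat ≤ T.inf H, (-1 : ℤ) ^ T.card := by
      rw [← Finset.sum_biUnion]
      · refine Finset.sum_congr ?_ fun _ _ => rfl
        ext T
        simp only [Finset.mem_biUnion, Finset.mem_Iic, Finset.mem_filter, Finset.mem_powerset]
        constructor
        · rintro ⟨Y, hY, hT, hTY⟩
          exact ⟨hT, hTY ▸ (IntersectionPoset.le_iff _ _).1 hY⟩
        · rintro ⟨hT, hX⟩
          refine ⟨⟨T.inf H, X.nonempty.mono hX, T.image H, Finset.image_subset_image hT, ?_⟩,
            hX, hT, rfl⟩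
          rw [Finset.inf_image]; rfl
      · intro Y _ Z _ hYZ
        rw [Function.onFun, Finset.disjoint_left]
        intro T hT hT'
        simp only [Finset.mem_filter] at hT hT'
        exact hYZ (IntersectionPoset.ext (hT.2.symm.trans hT'.2))
    have h2 : (s.powerset.filter fun T => X.flat ≤ T.inf H) =
        (s.filter fun j => X.flat ≤ H j).powerset := by
      ext T
      simp only [Finset.mem_filter, Finset.mem_powerset, Finset.le_inf_iff, Finset.subset_iff]
      grind
    rw [h1, h2, Finset.sum_powerset_neg_one_pow_card]
    refine if_congr ?_ rfl rfl
    rw [Finset.filter_eq_empty_iff]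
    constructor
    · rintro rfl j hj h
      exact hH j hj (top_le_iff.1 (by simpa [IntersectionPoset.bot_flat] using h))
    · intro h
      obtain ⟨S, hS, hX⟩ := X.isInter
      refine IntersectionPoset.ext ?_
      rw [hX, IntersectionPoset.bot_flat]
      suffices S = ∅ by simp [this]
      by_contra hne
      obtain ⟨K, hK⟩ := Finset.nonempty_iff_ne_empty.2 hne
      obtain ⟨j, hj, rfl⟩ := Finset.mem_image.1 (hS hK)
      refine h hj ?_
      rw [hX]
      exact Finset.inf_le (f := id) hK
  have := IncidenceAlgebra.moebius_inversion_bot (𝕜 := ℤ) _ _ key Y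
  rw [this, Finset.sum_eq_single ⊥]
  · simp
  · intro b _ hb; simp [hb]
  · intro h; exact absurd (Finset.mem_Iic.2 bot_le) h

open Classical in
/-- Whitney's theorem. -/
theorem arrangementCharpoly_eq_sum_subfamilies (s : Finset J) (H : J → AffineSubspace ℝ V)
    (hH : ∀ j ∈ s, H j ≠ ⊤) (A : Finset (AffineSubspace ℝ V)) (hA : A = s.image H) :
    arrangementCharpoly A = ∑ T ∈ s.powerset,
      if ((T.inf H : AffineSubspace ℝ V) : Set V).Nonempty then
        C ((-1 : ℤ) ^ T.card) * (X : ℤ[X]) ^ Module.finrank ℝ (T.inf H).direction else 0 := by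
  unfold arrangementCharpoly
  simp_rw [mu_bot_eq_sum_subfamilies s H hH A hA, map_sum, Finset.sum_mul]
  rw [← Finset.sum_filter]
  have h : ∀ Y : IntersectionPoset A, ∀ T ∈ s.powerset.filter (fun T => T.inf H = Y.flat),
      C ((-1 : ℤ) ^ T.card) * (X : ℤ[X]) ^ Module.finrank ℝ Y.flat.direction =
      C ((-1 : ℤ) ^ T.card) * (X : ℤ[X]) ^ Module.finrank ℝ (T.inf H).direction := by
    intro Y T hT
    rw [(Finset.mem_filter.1 hT).2]
  rw [Finset.sum_congr rfl fun Y _ => Finset.sum_congr rfl (h Y), ← Finset.sum_biUnion]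
  · refine Finset.sum_congr ?_ fun _ _ => rfl
    ext T
    simp only [Finset.mem_biUnion, Finset.mem_univ, true_and, Finset.mem_filter,
      Finset.mem_powerset]
    constructor
    · rintro ⟨Y, hT, hTY⟩
      exact ⟨hT, hTY ▸ Y.nonempty⟩
    · rintro ⟨hT, hne⟩
      refine ⟨⟨T.inf H, hne, T.image H, hA ▸ Finset.image_subset_image hT, ?_⟩, hT, rfl⟩
      rw [Finset.inf_image]; rfl
  · intro Y _ Z _ hYZ
    rw [Function.onFun, Finset.disjoint_left]
    intro T hT hT'
    simp only [Finset.mem_filter] at hT hT'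
    exact hYZ (IntersectionPoset.ext (hT.2.symm.trans hT'.2))

theorem arrangementCharpoly_monic [FiniteDimensional ℝ V] (A : Finset (AffineSubspace ℝ V)) :
    (arrangementCharpoly A).Monic := by
  classical
  unfold arrangementCharpoly
  rw [← Finset.add_sum_erase _ _ (Finset.mem_univ (⊥ : IntersectionPoset A))]
  have h0 : Module.finrank ℝ (⊥ : IntersectionPoset A).flat.direction = Module.finrank ℝ V := by
    rw [IntersectionPoset.bot_flat, AffineSubspace.direction_top, finrank_top]
  rw [IncidenceAlgebra.mu_self, h0]
  simp only [map_one, one_mul]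
  refine monic_X_pow_add ?_
  refine lt_of_le_of_lt (degree_sum_le _ _) ?_
  rw [Finset.sup_lt_iff (WithBot.bot_lt_coe _)]
  intro Y hY
  refine lt_of_le_of_lt (degree_C_mul_X_pow_le _ _) ?_
  rw [Nat.cast_lt]
  have hne : Y ≠ ⊥ := (Finset.mem_erase.1 hY).1
  refine Submodule.finrank_lt fun h => hne (IntersectionPoset.ext ?_)
  rw [IntersectionPoset.bot_flat]
  exact (AffineSubspace.direction_eq_top_iff_of_nonempty Y.nonempty).1 h

end Whitney

/-! ### Counting points modulo `q` -/

/-- The equations `v j = k j` either are consistent, the right-hand sides being the values of an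
integral linear form on the lattice spanned by the left-hand sides, or some integral relation among
the left-hand sides is violated by the right-hand sides. -/
theorem exists_lift_or_relation {n J : Type*} (T : Finset J) (v : J → n → ℤ) (k : J → ℤ) :
    (∃ κ : Submodule.span ℤ (v '' T) →ₗ[ℤ] ℤ, ∀ j (hj : j ∈ T),
      κ ⟨v j, Submodule.subset_span ⟨j, hj, rfl⟩⟩ = k j) ∨
    ∃ c : J → ℤ, ∑ j ∈ T, c j • v j = 0 ∧ ∑ j ∈ T, c j * k j ≠ 0 := by
  classical
  by_contra! hcon
  obtain ⟨h1, h2⟩ := hcon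
  let g : T → Submodule.span ℤ (v '' T) := fun j => ⟨v j, Submodule.subset_span ⟨j, j.2, rfl⟩⟩
  let ψ : (T → ℤ) →ₗ[ℤ] Submodule.span ℤ (v '' T) := Fintype.linearCombination ℤ g
  let kk : (T → ℤ) →ₗ[ℤ] ℤ := Fintype.linearCombination ℤ (fun j : T => k j)
  have hψ : Function.Surjective ψ := by
    rw [← LinearMap.range_eq_top, Fintype.range_linearCombination]
    have hs : Set.range g = ((↑) : Submodule.span ℤ (v '' T) → n → ℤ) ⁻¹' (v '' T) := by
      ext ⟨x, hx⟩
      simp [g, Subtype.ext_iff]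
    rw [hs]
    exact Submodule.span_span_coe_preimage
  have hker : LinearMap.ker ψ ≤ LinearMap.ker kk := by
    intro c hc
    have := h2 (fun j => if hj : j ∈ T then c ⟨j, hj⟩ else 0) ?_
    · rw [← Finset.sum_attach] at this
      simpa [kk, Fintype.linearCombination_apply] using this
    · rw [← Finset.sum_attach]
      have hc' := congrArg Subtype.val (LinearMap.mem_ker.1 hc)
      simpa [ψ, Fintype.linearCombination_apply, g] using hc'
  let κ : Submodule.span ℤ (v '' T) →ₗ[ℤ] ℤ :=
    (LinearMap.ker ψ).liftQ kk hker ∘ₗ (ψ.quotKerEquivOfSurjective hψ).symm.toLinearMap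
  obtain ⟨j, hj, hjk⟩ := h1 κ
  refine hjk ?_
  have hval : g ⟨j, hj⟩ = ψ (Pi.single ⟨j, hj⟩ 1) := by
    simp [ψ, Fintype.linearCombination_apply_single]
  change κ (g ⟨j, hj⟩) = k j
  rw [hval]
  have h3 : (ψ.quotKerEquivOfSurjective hψ).symm (ψ (Pi.single ⟨j, hj⟩ 1)) =
      Submodule.Quotient.mk (Pi.single ⟨j, hj⟩ 1) := by
    rw [LinearEquiv.symm_apply_eq]; rfl
  simp only [κ, LinearMap.comp_apply, LinearEquiv.coe_coe, h3]
  change kk _ = _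
  simp [kk, Fintype.linearCombination_apply_single]

section Counting

variable {n J : Type*} [Fintype n]

/-- The real vector with integral coordinates `v` in the basis `β`. -/
noncomputable def intComb {V : Type*} [AddCommGroup V] [Module ℝ V] (β : n → V) (v : n → ℤ) : V :=
  ∑ i, (v i : ℝ) • β i

/-- The integral linear form with coefficients `v`, evaluated at a point with coordinates in a
commutative ring. -/
def evalForm {K : Type*} [CommRing K] (v : n → ℤ) (y : n → K) : K := ∑ i, (v i : K) * y i

variable {K : Type*} [CommRing K]

theorem evalForm_eq_constr (v : n → ℤ) (y : n → K) :
    evalForm v y = (Pi.basisFun ℤ n).constr K y v := by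
  rw [Module.Basis.constr_apply_fintype]
  simp [evalForm, Pi.basisFun]

/-- The change of coordinates attached to a new basis of the lattice of integral forms. -/
noncomputable def coordChange [DecidableEq n] (K : Type*) [CommRing K]
    (B : Module.Basis n ℤ (n → ℤ)) : (n → K) ≃ₗ[K] (n → K) :=
  ((Pi.basisFun ℤ n).constr K).trans (B.constr K).symm

theorem coordChange_apply [DecidableEq n] (B : Module.Basis n ℤ (n → ℤ)) (y : n → K) (i : n) :
    coordChange K B y i = evalForm (B i) y := by
  rw [evalForm_eq_constr]; rfl

theorem card_fiber_of_embedding {n K : Type*} [Fintype n] [DecidableEq n]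
    [Fintype K] [DecidableEq K] {r : ℕ}
    (f : Fin r ↪ n) (u : Fin r → K) :
    (Finset.univ.filter fun z : n → K => ∀ l, z (f l) = u l).card =
      Fintype.card K ^ (Fintype.card n - r) := by
  have h : (Finset.univ.filter fun z : n → K => ∀ l, z (f l) = u l) =
      Fintype.piFinset fun i => if h : ∃ l, f l = i then {u h.choose} else Finset.univ := by
    ext z
    simp only [Finset.mem_filter, Finset.mem_univ, true_and, Fintype.mem_piFinset]
    constructor
    · intro hz i
      split_ifs with h
      · rw [Finset.mem_singleton, ← hz, h.choose_spec]
      · exact Finset.mem_univ _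
    · intro hz l
      have h : ∃ l', f l' = f l := ⟨l, rfl⟩
      have := hz (f l)
      rw [dif_pos h, Finset.mem_singleton, f.injective h.choose_spec] at this
      exact this
  rw [h, Fintype.card_piFinset]
  have : ∀ i, (if h : ∃ l, f l = i then {u h.choose} else Finset.univ : Finset K).card =
      if i ∈ Finset.univ.map f then 1 else Fintype.card K := by
    intro i
    by_cases h : ∃ l, f l = i
    · rw [dif_pos h, if_pos (by simpa using h)]; simp
    · rw [dif_neg h, if_neg (by simpa using h)]; rfl
  simp_rw [this, Finset.prod_ite, Finset.prod_const_one, one_mul, Finset.prod_const]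
  congr 1
  rw [Finset.filter_not, Finset.card_sdiff]
  simp [Finset.card_univ, Finset.card_image_of_injective _ f.injective]

theorem evalForm_sum_smul (T : Finset J) (v : J → n → ℤ) (c : J → ℤ) (y : n → K) :
    evalForm (∑ j ∈ T, c j • v j) y = ∑ j ∈ T, (c j : K) * evalForm (v j) y := by
  simp only [evalForm_eq_constr, map_sum]
  refine Finset.sum_congr rfl fun j _ => ?_
  rw [map_zsmul, zsmul_eq_mul]

/-- Over any coefficient ring, the equations `v j = k j` are equivalent to the diagonal equations
given by a Smith normal form of the lattice spanned by the `v j`. -/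
theorem forall_evalForm_eq_iff_of_smith [DecidableEq n] (T : Finset J) (v : J → n → ℤ) (k : J → ℤ)
    {r : ℕ} (snf : Module.Basis.SmithNormalForm (Submodule.span ℤ (v '' T)) n r)
    (κ : Submodule.span ℤ (v '' T) →ₗ[ℤ] ℤ)
    (hκ : ∀ j (hj : j ∈ T), κ ⟨v j, Submodule.subset_span ⟨j, hj, rfl⟩⟩ = k j) (y : n → K) :
    (∀ j ∈ T, evalForm (v j) y = k j) ↔
      ∀ l, (snf.a l : K) * coordChange K snf.bM y (snf.f l) = κ (snf.bN l) := by
  let φ : Submodule.span ℤ (v '' T) →ₗ[ℤ] K :=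
    (Pi.basisFun ℤ n).constr K y ∘ₗ (Submodule.span ℤ (v '' T)).subtype
  let κK : Submodule.span ℤ (v '' T) →ₗ[ℤ] K := (Int.castAddHom K).toIntLinearMap ∘ₗ κ
  have hA : (∀ j ∈ T, evalForm (v j) y = k j) ↔ φ = κK := by
    constructor
    · intro h
      refine LinearMap.ext_on_range (v := fun j : T =>
        (⟨v j, Submodule.subset_span ⟨j, j.2, rfl⟩⟩ : Submodule.span ℤ (v '' T))) ?_ ?_
      · have hs : Set.range (fun j : T =>
            (⟨v j, Submodule.subset_span ⟨j, j.2, rfl⟩⟩ : Submodule.span ℤ (v '' T))) =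
            ((↑) : Submodule.span ℤ (v '' T) → n → ℤ) ⁻¹' (v '' T) := by
          ext ⟨x, hx⟩
          simp [Subtype.ext_iff]
        rw [hs]
        exact Submodule.span_span_coe_preimage
      · intro j
        have := h j j.2
        rw [evalForm_eq_constr] at this
        simp only [φ, κK, LinearMap.comp_apply, Submodule.subtype_apply, this, hκ j j.2]
        rfl
    · intro h j hj
      have := LinearMap.congr_fun h ⟨v j, Submodule.subset_span ⟨j, hj, rfl⟩⟩
      simp only [φ, κK, LinearMap.comp_apply, Submodule.subtype_apply, hκ j hj] at this
      rw [evalForm_eq_constr, this]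
      rfl
  rw [hA]
  have hval : ∀ l, φ (snf.bN l) = (snf.a l : K) * coordChange K snf.bM y (snf.f l) := by
    intro l
    simp only [φ, LinearMap.comp_apply, Submodule.subtype_apply, snf.snf,
      coordChange_apply, evalForm_eq_constr]
    rw [map_zsmul, zsmul_eq_mul]
  constructor
  · intro h l
    rw [← hval, h]; rfl
  · intro h
    refine snf.bN.ext fun l => ?_
    rw [hval, h]; rfl

theorem exists_solutions_card_of_lift [DecidableEq n] (T : Finset J) (v : J → n → ℤ) (k : J → ℤ)
    (κ : Submodule.span ℤ (v '' T) →ₗ[ℤ] ℤ)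
    (hκ : ∀ j (hj : j ∈ T), κ ⟨v j, Submodule.subset_span ⟨j, hj, rfl⟩⟩ = k j) :
    ∃ (r : ℕ) (f : Fin r ↪ n) (B : Module.Basis n ℤ (n → ℤ)) (a : Fin r → ℤ) (u : Fin r → ℤ),
      (∀ l, a l ≠ 0) ∧ (∀ (K : Type) [CommRing K] (y : n → K),
        ((∀ j ∈ T, evalForm (v j) y = k j) ↔
          ∀ l, (a l : K) * coordChange K B y (f l) = u l)) ∧
      (∀ (K : Type) [CommRing K] (y : n → K),
        ((∀ j ∈ T, evalForm (v j) y = 0) ↔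
          ∀ l, (a l : K) * coordChange K B y (f l) = 0)) := by
  obtain ⟨r, snf⟩ := Submodule.smithNormalForm (Pi.basisFun ℤ n) (Submodule.span ℤ (v '' T))
  refine ⟨r, snf.f, snf.bM, snf.a, fun l => κ (snf.bN l), ?_, ?_, ?_⟩
  · intro l h
    have := snf.snf l
    rw [h, zero_smul] at this
    exact snf.bN.ne_zero l (Subtype.ext this)
  · intro K _ y
    exact forall_evalForm_eq_iff_of_smith T v k snf κ hκ y
  · intro K _ y
    have := forall_evalForm_eq_iff_of_smith T v 0 snf 0 (by simp) y
    simpa using this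

variable {V : Type*} [NormedAddCommGroup V] [InnerProductSpace ℝ V]

theorem inner_intComb (β : n → V) (v : n → ℤ) (x : V) :
    inner ℝ x (intComb β v) = evalForm v (fun i => inner ℝ x (β i)) := by
  simp [intComb, evalForm, inner_sum, real_inner_smul_right]

/-- A vector is determined by its inner products with a basis, and these can be prescribed. -/
noncomputable def innerCoords [FiniteDimensional ℝ V] (β : Module.Basis n ℝ V) :
    V ≃ₗ[ℝ] (n → ℝ) :=
  LinearEquiv.ofInjectiveOfFinrankEq
    (LinearMap.pi fun i => (innerₗ V).flip (β i))
    (by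
      rw [injective_iff_map_eq_zero]
      intro x hx
      refine InnerProductSpace.ext_inner_right_basis β fun i => ?_
      rw [inner_zero_left]
      exact congrFun hx i)
    (by rw [Module.finrank_eq_card_basis β, Module.finrank_fintype_fun_eq_card])

theorem innerCoords_apply [FiniteDimensional ℝ V] (β : Module.Basis n ℝ V) (x : V) (i : n) :
    innerCoords β x i = inner ℝ x (β i) := rfl

theorem mem_inf_rootHyperplane (T : Finset J) (w : J → V) (k : J → ℤ) (x : V) :
    x ∈ T.inf (fun j => rootHyperplane (w j) (k j)) ↔ ∀ j ∈ T, inner ℝ x (w j) = (k j : ℝ) := by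
  classical
  induction T using Finset.induction_on with
  | empty => simp
  | insert j T _ ih =>
    rw [Finset.inf_insert, AffineSubspace.mem_inf_iff, ih]
    simp only [Finset.mem_insert, forall_eq_or_imp]
    rfl

theorem mem_direction_inf_rootHyperplane (T : Finset J) (w : J → V) (k : J → ℤ)
    (hne : ((T.inf fun j => rootHyperplane (w j) (k j) : AffineSubspace ℝ V) : Set V).Nonempty)
    (x : V) :
    x ∈ (T.inf fun j => rootHyperplane (w j) (k j)).direction ↔ ∀ j ∈ T, inner ℝ x (w j) = 0 := by
  obtain ⟨x₀, hx₀⟩ := hne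
  rw [← AffineSubspace.vadd_mem_iff_mem_direction x hx₀, mem_inf_rootHyperplane]
  have hx₀' := (mem_inf_rootHyperplane T w k x₀).1 hx₀
  refine forall₂_congr fun j hj => ?_
  rw [vadd_eq_add, inner_add_left, hx₀' j hj]
  simp

theorem finrank_of_mem_iff_embedding [DecidableEq n] {r : ℕ} (f : Fin r ↪ n)
    (g : V ≃ₗ[ℝ] (n → ℝ)) (W : Submodule ℝ V) (hW : ∀ x, x ∈ W ↔ ∀ l, g x (f l) = 0) :
    Module.finrank ℝ W = Fintype.card n - r := by
  have : FiniteDimensional ℝ V := Module.Finite.equiv g.symm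
  let q : V →ₗ[ℝ] (Fin r → ℝ) := LinearMap.funLeft ℝ ℝ f ∘ₗ g.toLinearMap
  have hq : Function.Surjective q :=
    (LinearMap.funLeft_surjective_of_injective ℝ ℝ f f.injective).comp g.surjective
  have hker : W = LinearMap.ker q := by
    ext x
    rw [hW, LinearMap.mem_ker, funext_iff]
    rfl
  have h := q.finrank_range_add_finrank_ker
  rw [LinearMap.range_eq_top.2 hq, finrank_top, g.finrank_eq, Module.finrank_fintype_fun_eq_card,
    Module.finrank_fintype_fun_eq_card, Fintype.card_fin] at h
  rw [hker]
  omega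

open Classical in
/-- For all moduli prime to some fixed integer, a system of integral equations has as many
solutions modulo `q` as the dimension of its real solution space predicts. -/
theorem exists_coprime_card_solutions [DecidableEq n] [FiniteDimensional ℝ V]
    (β : Module.Basis n ℝ V)
    (T : Finset J) (v : J → n → ℤ) (k : J → ℤ) :
    ∃ M : ℕ, M ≠ 0 ∧ ∀ (q : ℕ) [NeZero q], q.Coprime M →  1 < q →
      (((Finset.univ.filter fun y : n → ZMod q => ∀ j ∈ T, evalForm (v j) y = k j).card : ℕ) : ℤ) =
      if ((T.inf fun j => rootHyperplane (intComb β (v j)) (k j) :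
            AffineSubspace ℝ V) : Set V).Nonempty
        then (q : ℤ) ^ Module.finrank ℝ
          (T.inf fun j => rootHyperplane (intComb β (v j)) (k j)).direction
        else 0 := by
  rcases exists_lift_or_relation T v k with ⟨κ, hκ⟩ | ⟨c, hc0, hck⟩
  · obtain ⟨r, f, B, a, u, ha, h1, h2⟩ := exists_solutions_card_of_lift T v k κ hκ
    refine ⟨∏ l, (a l).natAbs, Finset.prod_ne_zero_iff.2 fun l _ => Int.natAbs_ne_zero.2 (ha l),
      fun q _ hq _ => ?_⟩
    have hne : ((T.inf fun j => rootHyperplane (intComb β (v j)) (k j) :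
            AffineSubspace ℝ V) : Set V).Nonempty := by
      let z : n → ℝ := fun i => if h : ∃ l, f l = i then (u h.choose : ℝ) / a h.choose else 0
      refine ⟨(innerCoords β).symm ((coordChange ℝ B).symm z), ?_⟩
      rw [SetLike.mem_coe, mem_inf_rootHyperplane]
      simp_rw [inner_intComb, ← innerCoords_apply]
      have := (h1 ℝ ((coordChange ℝ B).symm z)).2 (fun l => ?_)
      · intro j hj
        rw [← this j hj]
        congr 1
        ext i
        simp
      · rw [LinearEquiv.apply_symm_apply]
        have h : ∃ l', f l' = f l := ⟨l, rfl⟩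
        simp only [z]
        rw [dif_pos h, f.injective h.choose_spec]
        have := ha l
        field_simp
    rw [if_pos hne]
    have hfin := finrank_of_mem_iff_embedding f ((innerCoords β).trans (coordChange ℝ B))
      (T.inf fun j => rootHyperplane (intComb β (v j)) (k j)).direction (fun x => by
        rw [mem_direction_inf_rootHyperplane _ _ _ hne]
        simp_rw [inner_intComb]
        rw [h2 ℝ]
        refine forall_congr' fun l => ?_
        rw [mul_eq_zero, or_iff_right (by exact_mod_cast ha l)]
        rfl)
    rw [hfin]
    -- The elementary divisors are units modulo `q`, so in the new coordinates the system fixes the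
    -- coordinates in the range of `f`, over `ZMod q` as over `ℝ`.
    have hunit : ∀ l, IsUnit ((a l : ℤ) : ZMod q) := by
      intro l
      have h3 : (a l).natAbs.Coprime q :=
        (hq.symm).coprime_dvd_left (Finset.dvd_prod_of_mem (fun l => (a l).natAbs) (Finset.mem_univ l))
      rw [← ZMod.isUnit_iff_coprime] at h3
      rcases Int.natAbs_eq (a l) with h | h
      · rw [h]; simpa using h3
      · rw [h]; simpa using h3
    choose w hw using hunit
    have hcard : (Finset.univ.filter fun y : n → ZMod q => ∀ j ∈ T, evalForm (v j) y = k j).card =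
        (Finset.univ.filter fun z : n → ZMod q =>
          ∀ l, z (f l) = ((w l)⁻¹ : (ZMod q)ˣ) * (u l : ZMod q)).card := by
      refine Finset.card_equiv (coordChange (ZMod q) B).toEquiv fun y => ?_
      simp only [Finset.mem_filter, Finset.mem_univ, true_and]
      rw [h1 (ZMod q)]
      refine forall_congr' fun l => ?_
      rw [← hw, Units.eq_inv_mul_iff_mul_eq]
      rfl
    rw [hcard, card_fiber_of_embedding, ZMod.card]
    push_cast
    rfl
  -- A violated relation excludes real solutions, and solutions modulo `q` as soon as `q` is prime to
  -- the nonzero amount by which it is violated.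
  · refine ⟨(∑ j ∈ T, c j * k j).natAbs, Int.natAbs_ne_zero.2 hck, fun q _ hq hq1 => ?_⟩
    have hrel : ∀ (K : Type) [CommRing K] (y : n → K), (∀ j ∈ T, evalForm (v j) y = k j) →
        ((∑ j ∈ T, c j * k j : ℤ) : K) = 0 := by
      intro K _ y hy
      have := evalForm_sum_smul T v c y
      rw [hc0] at this
      push_cast
      rw [Finset.sum_congr rfl fun j hj => by rw [hy j hj]] at this
      rw [← this]
      simp [evalForm]
    rw [if_neg]
    · rw [Finset.filter_eq_empty_iff.2]
      · simp
      · intro y _ hy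
        have h0 := hrel (ZMod q) y hy
        rw [ZMod.intCast_zmod_eq_zero_iff_dvd] at h0
        have := Nat.Coprime.eq_one_of_dvd hq (Int.natCast_dvd.1 h0)
        omega
    · rintro ⟨x, hx⟩
      rw [SetLike.mem_coe, mem_inf_rootHyperplane] at hx
      simp_rw [inner_intComb] at hx
      exact hck (by exact_mod_cast hrel ℝ _ hx)

open Classical in
/-- The finite field method: for all moduli `q` prime to some fixed integer, the characteristic
polynomial of an integral arrangement at `q` counts the points modulo `q` off the arrangement. -/
theorem exists_coprime_eval_arrangementCharpoly [FiniteDimensional ℝ V]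
    (β : Module.Basis n ℝ V) (s : Finset J) (v : J → n → ℤ) (k : J → ℤ)
    (hv : ∀ j ∈ s, v j ≠ 0) (A : Finset (AffineSubspace ℝ V))
    (hA : A = s.image fun j => rootHyperplane (intComb β (v j)) (k j)) :
    ∃ M : ℕ, M ≠ 0 ∧ ∀ (q : ℕ) [NeZero q], q.Coprime M → 1 < q →
      (arrangementCharpoly A).eval (q : ℤ) =
      ((Finset.univ.filter fun y : n → ZMod q => ∀ j ∈ s, evalForm (v j) y ≠ k j).card : ℤ) := by
  have hH : ∀ j ∈ s, rootHyperplane (intComb β (v j)) (k j) ≠ ⊤ := by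
    intro j hj h
    have h0 : intComb β (v j) ≠ 0 := by
      intro h0
      refine hv j hj (funext fun i => ?_)
      have := Fintype.linearIndependent_iff.1 β.linearIndependent (fun i => (v j i : ℝ)) h0 i
      exact_mod_cast this
    have h1 : (0 : V) ∈ rootHyperplane (intComb β (v j)) (k j) := h ▸ AffineSubspace.mem_top ℝ V 0
    have h2 : intComb β (v j) ∈ rootHyperplane (intComb β (v j)) (k j) :=
      h ▸ AffineSubspace.mem_top ℝ V _
    have h1' : inner ℝ (0 : V) (intComb β (v j)) = (k j : ℝ) := h1
    have h2' : inner ℝ (intComb β (v j)) (intComb β (v j)) = (k j : ℝ) := h2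
    rw [← h1', inner_zero_left, inner_self_eq_zero] at h2'
    exact h0 h2'
  choose M hM0 hM using fun T : Finset J => exists_coprime_card_solutions β T v k
  refine ⟨∏ T ∈ s.powerset, M T, Finset.prod_ne_zero_iff.2 fun T _ => hM0 T, fun q _ hq hq1 => ?_⟩
  rw [arrangementCharpoly_eq_sum_subfamilies s _ hH A hA, eval_finsetSum]
  have h3 := Finset.inclusion_exclusion_card_inf_compl s
    (fun j => Finset.univ.filter fun y : n → ZMod q => evalForm (v j) y = k j)
  have h4 : (s.inf fun j => (Finset.univ.filter fun y : n → ZMod q => evalForm (v j) y = k j)ᶜ) =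
      Finset.univ.filter fun y : n → ZMod q => ∀ j ∈ s, evalForm (v j) y ≠ k j := by
    ext y
    simp [Finset.mem_inf]
  rw [h4] at h3
  rw [h3]
  refine Finset.sum_congr rfl fun T hT => ?_
  have h5 : (T.inf fun j => (Finset.univ.filter fun y : n → ZMod q => evalForm (v j) y = k j)) =
      Finset.univ.filter fun y : n → ZMod q => ∀ j ∈ T, evalForm (v j) y = k j := by
    ext y
    simp [Finset.mem_inf]
  rw [h5, hM T q (hq.coprime_dvd_right (Finset.dvd_prod_of_mem _ hT)) hq1]
  split_ifs <;> simp

end Counting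

/-! ### Roots in simple coordinates -/

section SimpleCoordinates

variable {ι V N : Type*} [NormedAddCommGroup V] [InnerProductSpace ℝ V]
  [AddCommGroup N] [Module ℝ N] {P : RootPairing ι ℝ V N} {p : ℕ}

/-- The basis of simple roots, numbered by `e`. -/
noncomputable def simpleBasis [P.IsRootSystem] (b : P.Base) (e : Fin p ≃ b.support) :
    Module.Basis (Fin p) ℝ V :=
  b.toWeightBasis.reindex e.symm

theorem simpleBasis_apply [P.IsRootSystem] (b : P.Base) (e : Fin p ≃ b.support) (k : Fin p) :
    simpleBasis b e k = P.root (e k) := by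
  simp [simpleBasis]

theorem exists_int_coords [P.IsRootSystem] (b : P.Base) (e : Fin p ≃ b.support) (i : ι) :
    ∃ f : Fin p → ℤ, P.root i = intComb (simpleBasis b e) f ∧
      ((∀ k, 0 ≤ f k) ∨ ∀ k, f k ≤ 0) ∧ b.height i = ∑ k, f k := by
  obtain ⟨f, -, hf, hi⟩ := b.exists_root_eq_sum_int i
  refine ⟨fun k => f (e k), ?_, ?_, ?_⟩
  · rw [hi, intComb, ← Finset.sum_coe_sort, ← e.sum_comp]
    simp [simpleBasis_apply, Int.cast_smul_eq_zsmul]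
  · rcases hf with hf | hf
    · exact Or.inl fun k => hf.le _
    · exact Or.inr fun k => hf.le _
  · rw [RootPairing.Base.height_eq_sum hi, ← Finset.sum_coe_sort, ← e.sum_comp]

theorem basis_repr_intComb (β : Module.Basis (Fin p) ℝ V) (f : Fin p → ℤ) (k : Fin p) :
    β.repr (intComb β f) k = f k := by
  rw [intComb, Module.Basis.repr_sum_self]

theorem intComb_injective (β : Module.Basis (Fin p) ℝ V) :
    Function.Injective (intComb β : (Fin p → ℤ) → V) := by
  intro f g h
  ext k
  have := congrArg (fun x => β.repr x k) h
  simpa [basis_repr_intComb] using this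

theorem isPos_iff_repr_nonneg [P.IsRootSystem] (b : P.Base) (e : Fin p ≃ b.support) (i : ι) :
    b.IsPos i ↔ ∀ k, 0 ≤ (simpleBasis b e).repr (P.root i) k := by
  obtain ⟨f, hi, hf, hh⟩ := exists_int_coords b e i
  have hne := b.height_ne_zero i
  simp_rw [hi, basis_repr_intComb]
  rw [RootPairing.Base.IsPos, hh]
  rw [hh] at hne
  constructor
  · intro h
    rcases hf with hf | hf
    · exact fun k => by exact_mod_cast hf k
    · exact absurd (Finset.sum_nonpos fun k _ => hf k) (not_le.2 h)
  · intro h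
    have : 0 ≤ ∑ k, f k := Finset.sum_nonneg fun k _ => by exact_mod_cast h k
    omega

theorem mem_closure_simple_iff [P.IsRootSystem] (b : P.Base) (e : Fin p ≃ b.support)
    (f : Fin p → ℤ) :
    intComb (simpleBasis b e) f ∈ AddSubmonoid.closure (P.root '' (b.support : Set ι)) ↔
      ∀ k, 0 ≤ f k := by
  constructor
  · intro h
    have key : ∀ x ∈ AddSubmonoid.closure (P.root '' (b.support : Set ι)),
        ∀ k, 0 ≤ (simpleBasis b e).repr x k := by
      intro x hx
      induction hx using AddSubmonoid.closure_induction with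
      | mem x hx =>
        obtain ⟨i, hi, rfl⟩ := hx
        intro k
        have : P.root i = simpleBasis b e (e.symm ⟨i, hi⟩) := by simp [simpleBasis_apply]
        rw [this, Module.Basis.repr_self, Finsupp.single_apply]
        split_ifs <;> norm_num
      | zero => simp
      | add x y _ _ hx hy =>
        intro k
        rw [map_add, Finsupp.add_apply]
        exact add_nonneg (hx k) (hy k)
    intro k
    have := key _ h k
    rw [basis_repr_intComb] at this
    exact_mod_cast this
  · intro h
    refine sum_mem fun k _ => ?_
    obtain ⟨c, hc⟩ := Int.eq_ofNat_of_zero_le (h k)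
    rw [hc, simpleBasis_apply]
    have : ((c : ℤ) : ℝ) • P.root (e k) = c • P.root (e k) := by
      rw [Int.cast_natCast, Nat.cast_smul_eq_nsmul]
    rw [this]
    exact nsmul_mem (AddSubmonoid.subset_closure (Set.mem_image_of_mem P.root (e k).2)) c

theorem rootLE_iff_repr_le [P.IsRootSystem] (b : P.Base) (e : Fin p ≃ b.support) (i j : ι) :
    RootLE b i j ↔ ∀ k, (simpleBasis b e).repr (P.root i) k ≤
      (simpleBasis b e).repr (P.root j) k := by
  obtain ⟨f, hi, -, -⟩ := exists_int_coords b e i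
  obtain ⟨g, hj, -, -⟩ := exists_int_coords b e j
  have : P.root j - P.root i = intComb (simpleBasis b e) (g - f) := by
    rw [hi, hj]
    simp [intComb, sub_smul, Finset.sum_sub_distrib]
  rw [RootLE, this, mem_closure_simple_iff, hi, hj]
  simp_rw [basis_repr_intComb]
  refine forall_congr' fun k => ?_
  rw [Pi.sub_apply, sub_nonneg, Int.cast_le]

theorem highestRoot_unique [P.IsRootSystem] (b : P.Base) (e : Fin p ≃ b.support) {θ θ' : ι}
    (h : IsHighestRoot b θ) (h' : IsHighestRoot b θ') : θ = θ' := by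
  refine P.root.injective ((simpleBasis b e).repr.injective (Finsupp.ext fun k => ?_))
  exact le_antisymm ((rootLE_iff_repr_le b e _ _).1 (h' θ) k)
    ((rootLE_iff_repr_le b e _ _).1 (h θ') k)

end SimpleCoordinates

/-! ### Invariant inner products and the Weyl group -/

section Invariant

variable {ι V N : Type*} [NormedAddCommGroup V] [InnerProductSpace ℝ V]
  [AddCommGroup N] [Module ℝ N] {P : RootPairing ι ℝ V N} {p : ℕ}

theorem inner_root_self_pos (i : ι) : 0 < inner ℝ (P.root i) (P.root i) :=
  real_inner_self_pos.2 (P.ne_zero i)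

theorem coroot'_mul_inner_self (hinv : IsWeylInvariantInner P) (i : ι) (x : V) :
    P.coroot' i x * inner ℝ (P.root i) (P.root i) = 2 * inner ℝ x (P.root i) := by
  have h := hinv i x (P.root i)
  rw [P.reflection_apply_self, P.reflection_apply, inner_neg_right, inner_sub_left,
    real_inner_smul_left] at h
  linarith

theorem reflection_eq_of_inner (hinv : IsWeylInvariantInner P) (i : ι) (x : V) :
    P.reflection i x =
      x - (2 * inner ℝ x (P.root i) / inner ℝ (P.root i) (P.root i)) • P.root i := by
  rw [P.reflection_apply, ← coroot'_mul_inner_self hinv,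
    mul_div_cancel_right₀ _ (inner_root_self_pos i).ne']

theorem pairing_mul_inner_self (hinv : IsWeylInvariantInner P) (i j : ι) :
    P.pairing i j * inner ℝ (P.root j) (P.root j) = 2 * inner ℝ (P.root i) (P.root j) :=
  coroot'_mul_inner_self hinv j (P.root i)

theorem cartan_mul_inner_self [P.IsCrystallographic] (hinv : IsWeylInvariantInner P)
    (b : P.Base) (e : Fin p ≃ b.support) (j k : Fin p) :
    (numberedCartanMatrix b e j k : ℝ) * inner ℝ (P.root (e k)) (P.root (e k)) =
      2 * inner ℝ (P.root (e j)) (P.root (e k)) := by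
  rw [← pairing_mul_inner_self hinv]
  congr 1
  exact b.algebraMap_cartanMatrixIn_apply ℤ (e j) (e k)

theorem inner_weylGroup_smul (hinv : IsWeylInvariantInner P) (w : P.weylGroup) (x y : V) :
    inner ℝ (w • x) (w • y) = inner ℝ x y := by
  revert x y
  obtain ⟨g, hg⟩ := w
  induction hg using RootPairing.weylGroup.induction with
  | mem i => exact hinv i
  | one => intro x y; rfl
  | mul g₁ g₂ hg₁ hg₂ h₁ h₂ =>
    intro x y
    rw [← Submonoid.mk_mul_mk _ _ _ hg₁ hg₂, mul_smul, mul_smul, h₁, h₂]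

theorem weylGroup_eq_of_smul_basis [P.IsRootSystem] {n : Type*} (β : Module.Basis n ℝ V)
    {w w' : P.weylGroup} (h : ∀ i, w • β i = w' • β i) : w = w' := by
  refine Subtype.ext (RootPairing.Equiv.weightHom_injective P ?_)
  refine LinearEquiv.toLinearMap_injective (β.ext fun i => ?_)
  exact h i

theorem weylGroup_smul_smul (w : P.weylGroup) (c : ℝ) (x : V) : w • c • x = c • w • x :=
  smul_comm (w : P.Aut) c x

end Invariant

/-! ### Reduction to counts -/

section Reduction

variable {ι V N : Type*} [NormedAddCommGroup V] [InnerProductSpace ℝ V]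
  [AddCommGroup N] [Module ℝ N] {P : RootPairing ι ℝ V N} {p : ℕ}

/-- `S` and `L` are the integral coordinate vectors, in the basis `β` of `V`, of the short and of
the long positive roots. -/
structure IsRootModel (b : P.Base) (β : Module.Basis (Fin p) ℝ V)
    (S L : Finset (Fin p → ℤ)) : Prop where
  short : ∀ x, (∃ i, IsShortPos b i ∧ P.root i = x) ↔ ∃ v ∈ S, intComb β v = x
  long : ∀ x, (∃ i, (b.IsPos i ∧ IsLongRoot P i) ∧ P.root i = x) ↔ ∃ v ∈ L, intComb β v = x

open Classical in
/-- The number of points modulo `q` off the `m`-semi-Catalan arrangement with short and long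
positive roots `S` and `L`. -/
noncomputable def avoidCount (S L : Finset (Fin p → ℤ)) (m q : ℕ) [NeZero q] : ℕ :=
  (Finset.univ.filter fun y : Fin p → ZMod q =>
    (∀ v ∈ S, ∀ k ∈ Finset.Icc (-(m : ℤ)) m, evalForm v y ≠ k) ∧ ∀ v ∈ L, evalForm v y ≠ 0).card

theorem exists_coprime_eval_semiCatalan [Fintype ι] [FiniteDimensional ℝ V] {b : P.Base}
    {β : Module.Basis (Fin p) ℝ V} {S L : Finset (Fin p → ℤ)} (h : IsRootModel b β S L) (m : ℕ) :
    ∃ M : ℕ, M ≠ 0 ∧ ∀ (q : ℕ) [NeZero q], q.Coprime M → 1 < q →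
      (arrangementCharpoly (semiCatalan b m)).eval (q : ℤ) = avoidCount S L m q := by
  classical
  have hne : ∀ j ∈ (S ×ˢ Finset.Icc (-(m : ℤ)) m ∪ L ×ˢ {0} : Finset ((Fin p → ℤ) × ℤ)),
      j.1 ≠ 0 := by
    rintro ⟨v, k⟩ hvk hv0
    obtain rfl : v = 0 := hv0
    have h0 : intComb β (0 : Fin p → ℤ) = 0 := by simp [intComb]
    rcases Finset.mem_union.1 hvk with hvk | hvk
    · obtain ⟨i, -, hi⟩ := (h.short _).2 ⟨_, (Finset.mem_product.1 hvk).1, rfl⟩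
      exact P.ne_zero i (hi.trans h0)
    · obtain ⟨i, -, hi⟩ := (h.long _).2 ⟨_, (Finset.mem_product.1 hvk).1, rfl⟩
      exact P.ne_zero i (hi.trans h0)
  have himage : semiCatalan b m = (S ×ˢ Finset.Icc (-(m : ℤ)) m ∪ L ×ˢ {0} : Finset ((Fin p → ℤ) × ℤ)).image
      fun j => rootHyperplane (intComb β j.1) j.2 := by
    ext H
    simp only [semiCatalan, Finset.mem_union, Finset.mem_image, Finset.mem_product,
      Finset.mem_filter, Finset.mem_univ, true_and, Prod.exists, Finset.mem_singleton]
    constructor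
    · rintro (⟨i, k, ⟨hi, hk⟩, rfl⟩ | ⟨i, hi, rfl⟩)
      · obtain ⟨v, hv, hvi⟩ := (h.short _).1 ⟨i, hi, rfl⟩
        exact ⟨v, k, Or.inl ⟨hv, hk⟩, by rw [hvi]⟩
      · obtain ⟨v, hv, hvi⟩ := (h.long _).1 ⟨i, hi, rfl⟩
        exact ⟨v, 0, Or.inr ⟨hv, rfl⟩, by rw [hvi]⟩
    · rintro ⟨v, k, ⟨hv, hk⟩ | ⟨hv, rfl⟩, rfl⟩
      · obtain ⟨i, hi, hvi⟩ := (h.short _).2 ⟨v, hv, rfl⟩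
        exact Or.inl ⟨i, k, ⟨hi, hk⟩, by rw [hvi]⟩
      · obtain ⟨i, hi, hvi⟩ := (h.long _).2 ⟨v, hv, rfl⟩
        exact Or.inr ⟨i, hi, by rw [hvi]⟩
  obtain ⟨M, hM, H⟩ := exists_coprime_eval_arrangementCharpoly β _ Prod.fst Prod.snd hne _ himage
  refine ⟨M, hM, fun q _ hq hq1 => ?_⟩
  rw [H q hq hq1, avoidCount]
  congr 2
  ext y
  simp only [Finset.mem_filter, Finset.mem_univ, true_and, Finset.mem_union, Finset.mem_product,
    Finset.mem_singleton, Prod.forall]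
  constructor
  · intro hy
    exact ⟨fun v hv k hk => hy v k (Or.inl ⟨hv, hk⟩), fun v hv => by
      simpa using hy v 0 (Or.inr ⟨hv, rfl⟩)⟩
  · rintro ⟨h1, h2⟩ v k (⟨hv, hk⟩ | ⟨hv, rfl⟩)
    · exact h1 v hv k hk
    · simpa using h2 v hv

/-- A monic polynomial that is proportional to the point counts modulo infinitely many `q` prime
to any given integer is the characteristic polynomial, and the factor is one. -/
theorem charpoly_semiCatalan_eq_of_count [Fintype ι] [FiniteDimensional ℝ V] {b : P.Base}
    {β : Module.Basis (Fin p) ℝ V} {S L : Finset (Fin p → ℤ)} (h : IsRootModel b β S L) (m : ℕ)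
    (Q : ℤ[X]) (hQ : Q.Monic) (a d : ℤ) (hd : d ≠ 0)
    (hcount : ∀ M : ℕ, M ≠ 0 → ∀ B : ℕ, ∃ q : ℕ, B < q ∧ q.Coprime M ∧
      ∀ [NeZero q], d * (avoidCount S L m q : ℤ) = a * Q.eval (q : ℤ)) :
    arrangementCharpoly (semiCatalan b m) = Q ∧ d = a := by
  obtain ⟨M, hM, H⟩ := exists_coprime_eval_semiCatalan h m
  have hpoly : C d * arrangementCharpoly (semiCatalan b m) = C a * Q := by
    refine eq_of_infinite_eval_eq _ _ ?_
    refine Set.infinite_of_forall_exists_gt fun B => ?_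
    obtain ⟨q, hq, hqM, hc⟩ := hcount M hM (B.toNat + 1)
    have : NeZero q := ⟨by omega⟩
    refine ⟨(q : ℤ), ?_, by omega⟩
    rw [Set.mem_ofPred_eq, eval_mul, eval_mul, eval_C, eval_C, H q hqM (by omega)]
    exact hc
  have hlead := congrArg leadingCoeff hpoly
  rw [leadingCoeff_mul, leadingCoeff_mul, (arrangementCharpoly_monic _).leadingCoeff,
    hQ.leadingCoeff, leadingCoeff_C, leadingCoeff_C, mul_one, mul_one] at hlead
  refine ⟨?_, hlead⟩
  rw [← hlead] at hpoly
  exact mul_left_cancel₀ (C_ne_zero.2 hd) hpoly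

/-- The conclusions in terms of the multiset `E` of exponents, reduced to one polynomial identity
and to the values of three cardinalities. -/
theorem semiCatalan_conclusions_of_exponents [Fintype ι] [FiniteDimensional ℝ V]
    (b : P.Base) (e : Fin p ≃ b.support) (g : ℕ) (hg : 1 ≤ g) (E : Multiset ℕ)
    (hE : weylExponents b e = E)
    (hχ : ∀ m : ℕ, arrangementCharpoly (semiCatalan b m) =
      (E.map fun k : ℕ => X - C ((m * g : ℕ) : ℤ) - C (k : ℤ)).prod)
    (hW : Nat.card P.weylGroup = (E.map fun k => k + 1).prod)
    (hA : (shortAntichains b).ncard * (E.map fun k => k + 1).prod =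
      (E.map fun k => g + k + 1).prod)
    (hA₀ : (strictlyPosShortAntichains b).ncard * (E.map fun k => k + 1).prod =
      (E.map fun k => g + k - 1).prod) :
    (∀ m : ℕ,
      arrangementCharpoly (semiCatalan b m) =
          (arrangementCharpoly (semiCatalan b 0)).comp (X - C ((m * g : ℕ) : ℤ)) ∧
      arrangementCharpoly (semiCatalan b m) =
          ((weylExponents b e).map fun k : ℕ => X - C ((m * g : ℕ) : ℤ) - C (k : ℤ)).prod) ∧
    arrangementCharpoly (semiCatalan b 1) =
        ((weylExponents b e).map fun k : ℕ => X - C (g : ℤ) - C (k : ℤ)).prod ∧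
    (((shortAntichains b).ncard : ℚ) =
        (|(arrangementCharpoly (semiCatalan b 1)).eval (-1)| : ℤ) / (Nat.card P.weylGroup : ℚ) ∧
      ((shortAntichains b).ncard : ℚ) =
        ((weylExponents b e).map fun k : ℕ => ((g : ℚ) + k + 1) / (k + 1)).prod) ∧
    (((strictlyPosShortAntichains b).ncard : ℚ) =
        (|(arrangementCharpoly (semiCatalan b 1)).eval 1| : ℤ) / (Nat.card P.weylGroup : ℚ) ∧
      ((strictlyPosShortAntichains b).ncard : ℚ) =
        ((weylExponents b e).map fun k : ℕ => ((g : ℚ) + k - 1) / (k + 1)).prod) := by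
  have hpos : ((E.map fun k => k + 1).prod : ℕ) ≠ 0 := by
    rw [Ne, Multiset.prod_eq_zero_iff]; simp
  have habs : ∀ (t : ℤ), |(arrangementCharpoly (semiCatalan b 1)).eval t| =
      (E.map fun k : ℕ => |t - g - k|).prod := by
    intro t
    rw [hχ 1, eval_multiset_prod, Multiset.map_map]
    have : ∀ s : Multiset ℤ, |s.prod| = (s.map abs).prod :=
      fun s => map_multiset_prod (absHom : ℤ →*₀ ℤ) s
    rw [this, Multiset.map_map]
    simp
  have h1 : |(arrangementCharpoly (semiCatalan b 1)).eval (-1)| =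
      (((E.map fun k => g + k + 1).prod : ℕ) : ℤ) := by
    rw [habs, Nat.cast_multiset_prod, Multiset.map_map]
    congr 1
    refine Multiset.map_congr rfl fun k _ => ?_
    rw [abs_of_nonpos (by omega)]
    simp; ring
  have h2 : |(arrangementCharpoly (semiCatalan b 1)).eval 1| =
      (((E.map fun k => g + k - 1).prod : ℕ) : ℤ) := by
    rw [habs, Nat.cast_multiset_prod, Multiset.map_map]
    congr 1
    refine Multiset.map_congr rfl fun k _ => ?_
    rw [abs_of_nonpos (by omega)]
    simp only [Function.comp_apply]
    omega
  have h3 : ∀ f : ℕ → ℕ, (((E.map f).prod : ℕ) : ℚ) / ((E.map fun k => k + 1).prod : ℕ) =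
      (E.map fun k => (f k : ℚ) / ((k : ℚ) + 1)).prod := by
    intro f
    rw [Multiset.prod_map_div, Nat.cast_multiset_prod, Nat.cast_multiset_prod, Multiset.map_map,
      Multiset.map_map]
    simp
  have h4 : ((shortAntichains b).ncard : ℚ) =
      (((E.map fun k => g + k + 1).prod : ℕ) : ℚ) / ((E.map fun k => k + 1).prod : ℕ) := by
    rw [← hA, Nat.cast_mul, mul_div_cancel_right₀ _ (by exact_mod_cast hpos)]
  have h5 : ((strictlyPosShortAntichains b).ncard : ℚ) =
      (((E.map fun k => g + k - 1).prod : ℕ) : ℚ) / ((E.map fun k => k + 1).prod : ℕ) := by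
    rw [← hA₀, Nat.cast_mul, mul_div_cancel_right₀ _ (by exact_mod_cast hpos)]
  rw [hE, hW, h1, h2]
  refine ⟨fun m => ⟨?_, hχ m⟩, by simpa using hχ 1, ⟨by rw [h4, Int.cast_natCast], ?_⟩,
    ⟨by rw [h5, Int.cast_natCast], ?_⟩⟩
  · rw [hχ m, hχ 0, ← coe_compRingHom_apply, map_multiset_prod, Multiset.map_map]
    simp
  · rw [h4, h3]
    simp
  · rw [h5, h3]
    congr 1
    refine Multiset.map_congr rfl fun k _ => ?_
    rw [Nat.cast_sub (by omega)]
    push_cast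
    rfl

end Reduction

/-! ### Antichains in a staircase of cells -/

section Staircase

/-- Antichains in the order on cells for which `(i, k) ≤ (i', k')` when `i' ≤ i` and `k ≤ k'`. -/
def IsCellAntichain (Γ : Finset (ℕ × ℕ)) : Prop :=
  ∀ x ∈ Γ, ∀ y ∈ Γ, x ≠ y → ¬ (y.1 ≤ x.1 ∧ x.2 ≤ y.2)

open Classical in
/-- The number of antichains of cells in `T`. -/
noncomputable def cellAntichainCount (T : Finset (ℕ × ℕ)) : ℕ :=
  (T.powerset.filter IsCellAntichain).card

theorem cellAntichainCount_empty : cellAntichainCount ∅ = 1 := by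
  classical
  rw [cellAntichainCount, Finset.powerset_empty, Finset.filter_singleton, if_pos]
  · rfl
  · intro x hx; simp at hx

/-- An antichain avoiding a corner cell misses its row or its column, and the antichains through
the corner correspond to those missing both. -/
theorem cellAntichainCount_corner (T : Finset (ℕ × ℕ)) (r c : ℕ)
    (hT : ∀ x ∈ T, r ≤ x.1 ∧ c ≤ x.2) (hrc : (r, c) ∈ T) :
    cellAntichainCount T = cellAntichainCount (T.filter fun x => r + 1 ≤ x.1) +
      cellAntichainCount (T.filter fun x => c + 1 ≤ x.2) := by
  classical
  set U := (T.filter fun x => r + 1 ≤ x.1).powerset.filter IsCellAntichain with hU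
  set W := (T.filter fun x => c + 1 ≤ x.2).powerset.filter IsCellAntichain with hW
  set A := T.powerset.filter IsCellAntichain with hA
  have hUm : ∀ Γ, Γ ∈ U ↔ Γ ∈ A ∧ ∀ x ∈ Γ, r + 1 ≤ x.1 := by
    intro Γ
    simp only [hU, hA, Finset.mem_filter, Finset.mem_powerset, Finset.subset_iff]
    grind
  have hWm : ∀ Γ, Γ ∈ W ↔ Γ ∈ A ∧ ∀ x ∈ Γ, c + 1 ≤ x.2 := by
    intro Γ
    simp only [hW, hA, Finset.mem_filter, Finset.mem_powerset, Finset.subset_iff]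
    grind
  have hAm : ∀ Γ, Γ ∈ A ↔ (∀ x ∈ Γ, x ∈ T) ∧ IsCellAntichain Γ := by
    intro Γ
    simp only [hA, Finset.mem_filter, Finset.mem_powerset, Finset.subset_iff]
  have h1 : A.filter (fun Γ => (r, c) ∉ Γ) = U ∪ W := by
    ext Γ
    rw [Finset.mem_filter, Finset.mem_union, hUm, hWm]
    constructor
    · rintro ⟨hΓ, hn⟩
      by_contra! hcon
      obtain ⟨x, hx, hx1⟩ := hcon.1 hΓ
      obtain ⟨y, hy, hy2⟩ := hcon.2 hΓ
      have hΓ' := (hAm Γ).1 hΓ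
      have hxT := hT x (hΓ'.1 x hx)
      have hyT := hT y (hΓ'.1 y hy)
      refine hΓ'.2 y hy x hx ?_ ⟨by omega, by omega⟩
      rintro rfl
      exact hn (by convert hx using 1; ext <;> simp <;> omega)
    · rintro (⟨hΓ, h⟩ | ⟨hΓ, h⟩)
      · exact ⟨hΓ, fun hm => by have := h _ hm; simp at this⟩
      · exact ⟨hΓ, fun hm => by have := h _ hm; simp at this⟩
  have h2 : (A.filter (fun Γ => (r, c) ∈ Γ)).card = (U ∩ W).card := by
    refine Finset.card_nbij' (fun Γ => Γ.erase (r, c)) (fun Γ => insert (r, c) Γ) ?_ ?_ ?_ ?_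
    · intro Γ hΓ
      obtain ⟨hΓ, hm⟩ := Finset.mem_filter.1 hΓ
      have hΓ' := (hAm Γ).1 hΓ
      have hA' : Γ.erase (r, c) ∈ A := (hAm _).2
        ⟨fun x hx => hΓ'.1 x (Finset.mem_of_mem_erase hx), fun x hx y hy =>
          hΓ'.2 x (Finset.mem_of_mem_erase hx) y (Finset.mem_of_mem_erase hy)⟩
      have hmain : ∀ x ∈ Γ.erase (r, c), r + 1 ≤ x.1 ∧ c + 1 ≤ x.2 := by
        intro x hx
        have hxΓ := Finset.mem_of_mem_erase hx
        have hne := Finset.ne_of_mem_erase hx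
        have hxT := hT x (hΓ'.1 x hxΓ)
        have h1 := hΓ'.2 x hxΓ _ hm hne
        have h2 := hΓ'.2 _ hm x hxΓ hne.symm
        simp only at h1 h2
        omega
      exact Finset.mem_inter.2 ⟨(hUm _).2 ⟨hA', fun x hx => (hmain x hx).1⟩,
        (hWm _).2 ⟨hA', fun x hx => (hmain x hx).2⟩⟩
    · intro Γ hΓ
      obtain ⟨hΓU, hΓW⟩ := Finset.mem_inter.1 hΓ
      have hu := (hUm Γ).1 hΓU
      have hw := (hWm Γ).1 hΓW
      have hΓ' := (hAm Γ).1 hu.1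
      refine Finset.mem_filter.2 ⟨(hAm _).2 ⟨?_, ?_⟩, Finset.mem_insert_self _ _⟩
      · intro x hx
        rcases Finset.mem_insert.1 hx with rfl | hx
        · exact hrc
        · exact hΓ'.1 x hx
      · intro x hx y hy hxy
        rcases Finset.mem_insert.1 hx with rfl | hx <;>
          rcases Finset.mem_insert.1 hy with rfl | hy
        · exact absurd rfl hxy
        · have := hu.2 y hy; have := hw.2 y hy; simp; omega
        · have := hu.2 x hx; have := hw.2 x hx; simp; omega
        · exact hΓ'.2 x hx y hy hxy
    · intro Γ hΓ
      exact Finset.insert_erase (Finset.mem_filter.1 hΓ).2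
    · intro Γ hΓ
      refine Finset.erase_insert fun hm => ?_
      have := ((hUm Γ).1 (Finset.mem_inter.1 hΓ).1).2 _ hm
      simp at this
  have h3 := Finset.card_filter_add_card_filter_not (s := A) (fun Γ => (r, c) ∈ Γ)
  rw [h1, h2] at h3
  have h4 := Finset.card_union_add_card_inter U W
  change A.card = U.card + W.card
  omega

/-- The staircase of the cells `(i, k)` with `i + t < k` and `i + k ≤ 2 p - 2`; for `t = 1` the
cell `(p - 2, p)` is left out. -/
def staircase (p t : ℕ) : Finset (ℕ × ℕ) :=
  (Finset.range (2 * p) ×ˢ Finset.range (2 * p)).filter fun x =>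
    x.1 + t + 1 ≤ x.2 ∧ x.1 + x.2 + 2 ≤ 2 * p ∧ ¬ (t = 1 ∧ x.1 + 2 = p ∧ x.2 = p)

theorem mem_staircase {p t : ℕ} {x : ℕ × ℕ} : x ∈ staircase p t ↔
    x.1 + t + 1 ≤ x.2 ∧ x.1 + x.2 + 2 ≤ 2 * p ∧ ¬ (t = 1 ∧ x.1 + 2 = p ∧ x.2 = p) := by
  simp only [staircase, Finset.mem_filter, Finset.mem_product, Finset.mem_range]
  constructor
  · exact fun h => h.2
  · exact fun h => ⟨⟨by omega, by omega⟩, h⟩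

/-- Partial sums of a row of Pascal's triangle. -/
def chooseSum (d n : ℕ) : ℤ := ∑ k ∈ Finset.range n, (d.choose k : ℤ)

theorem chooseSum_succ_left (d n : ℕ) :
    chooseSum (d + 1) n = chooseSum d n + chooseSum d (n - 1) := by
  induction n with
  | zero => simp [chooseSum]
  | succ n ih =>
    rw [chooseSum, Finset.sum_range_succ, ← chooseSum, ih, chooseSum, chooseSum,
      Nat.add_sub_cancel, chooseSum, chooseSum, Finset.sum_range_succ _ n]
    rcases n with _ | n
    · simp
    · rw [Nat.add_sub_cancel, Finset.sum_range_succ _ n, Nat.choose_succ_succ]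
      push_cast
      ring

/-- The antichains in a lower right part of the staircase are counted like lattice paths from the
corner `(r, c)` to the antidiagonal that stay above a diagonal barrier. -/
theorem cellAntichainCount_staircase_filter (p t : ℕ) (ht : t ≤ 1) (d : ℕ) :
    ∀ r c : ℕ, r + c + d + 1 = 2 * p → r + t ≤ c → r + t + 1 ≤ p →
      (cellAntichainCount ((staircase p t).filter fun x => r ≤ x.1 ∧ c ≤ x.2) : ℤ) =
        chooseSum d (p - t - r) - chooseSum d (p - 1 - c) := by
  induction d with
  | zero =>
    intro r c h1 h2 h3
    have : ((staircase p t).filter fun x => r ≤ x.1 ∧ c ≤ x.2) = ∅ := by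
      rw [Finset.filter_eq_empty_iff]
      intro x hx
      have := mem_staircase.1 hx
      omega
    rw [this, cellAntichainCount_empty]
    obtain ⟨n, hn⟩ : ∃ n, p - t - r = n + 1 := ⟨p - t - r - 1, by omega⟩
    rw [hn, show p - 1 - c = 0 by omega, chooseSum, chooseSum, Finset.sum_range_succ']
    simp
  | succ d ih =>
    intro r c h1 h2 h3
    rcases h2.eq_or_lt with h2 | h2
    · have : ((staircase p t).filter fun x => r ≤ x.1 ∧ c ≤ x.2) =
          (staircase p t).filter fun x => r ≤ x.1 ∧ c + 1 ≤ x.2 := by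
        refine Finset.filter_congr fun x hx => ?_
        have := mem_staircase.1 hx
        omega
      rw [this, ih r (c + 1) (by omega) (by omega) h3, chooseSum_succ_left, chooseSum_succ_left,
        show p - 1 - c = p - t - r - 1 by omega, show p - 1 - (c + 1) = p - t - r - 1 - 1 by omega]
      ring
    · by_cases hex : t = 1 ∧ d = 0 ∧ c = r + 2
      · obtain ⟨rfl, rfl, rfl⟩ := hex
        have : ((staircase p 1).filter fun x => r ≤ x.1 ∧ r + 2 ≤ x.2) = ∅ := by
          rw [Finset.filter_eq_empty_iff]
          intro x hx
          have := mem_staircase.1 hx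
          omega
        rw [this, cellAntichainCount_empty, show p - 1 - r = 1 by omega,
          show p - 1 - (r + 2) = 0 by omega]
        simp [chooseSum]
      · have hmem : (r, c) ∈ (staircase p t).filter fun x => r ≤ x.1 ∧ c ≤ x.2 := by
          rw [Finset.mem_filter, mem_staircase]
          simp only
          omega
        rw [cellAntichainCount_corner _ r c (fun x hx => (Finset.mem_filter.1 hx).2) hmem,
          Finset.filter_filter, Finset.filter_filter]
        have e1 : ((staircase p t).filter fun x => (r ≤ x.1 ∧ c ≤ x.2) ∧ r + 1 ≤ x.1) =
            (staircase p t).filter fun x => r + 1 ≤ x.1 ∧ c ≤ x.2 :=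
          Finset.filter_congr fun x _ => by omega
        have e2 : ((staircase p t).filter fun x => (r ≤ x.1 ∧ c ≤ x.2) ∧ c + 1 ≤ x.2) =
            (staircase p t).filter fun x => r ≤ x.1 ∧ c + 1 ≤ x.2 :=
          Finset.filter_congr fun x _ => by omega
        rw [e1, e2, Nat.cast_add, ih (r + 1) c (by omega) (by omega) (by omega),
          ih r (c + 1) (by omega) (by omega) h3, chooseSum_succ_left, chooseSum_succ_left,
          show p - t - (r + 1) = p - t - r - 1 by omega,
          show p - 1 - (c + 1) = p - 1 - c - 1 by omega]
        ring

theorem cellAntichainCount_staircase_zero (p : ℕ) (hp : 1 ≤ p) :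
    cellAntichainCount (staircase p 0) = (2 * p - 1).choose (p - 1) := by
  have h := cellAntichainCount_staircase_filter p 0 (by omega) (2 * p - 1) 0 0 (by omega) le_rfl
    (by omega)
  obtain ⟨n, rfl⟩ : ∃ n, p = n + 1 := ⟨p - 1, by omega⟩
  rw [Finset.filter_true_of_mem (by simp)] at h
  simp only [Nat.sub_zero, Nat.add_sub_cancel] at h ⊢
  rw [chooseSum, chooseSum, Finset.sum_range_succ] at h
  have : (cellAntichainCount (staircase (n + 1) 0) : ℤ) = ((2 * (n + 1) - 1).choose n : ℕ) := by
    rw [h]; ring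
  exact_mod_cast this

theorem cellAntichainCount_staircase_one (p : ℕ) (hp : 2 ≤ p) :
    cellAntichainCount (staircase p 1) = (2 * p - 2).choose (p - 2) := by
  have h := cellAntichainCount_staircase_filter p 1 (by omega) (2 * p - 2) 0 1 (by omega) le_rfl
    (by omega)
  obtain ⟨n, rfl⟩ : ∃ n, p = n + 2 := ⟨p - 2, by omega⟩
  rw [Finset.filter_true_of_mem (fun x hx => by have := mem_staircase.1 hx; omega)] at h
  rw [show n + 2 - 1 - 0 = n + 1 by omega, show n + 2 - 1 - 1 = n by omega, chooseSum, chooseSum,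
    Finset.sum_range_succ] at h
  rw [Nat.add_sub_cancel]
  have : (cellAntichainCount (staircase (n + 2) 1) : ℤ) = ((2 * (n + 2) - 2).choose n : ℕ) := by
    rw [h]; ring
  exact_mod_cast this

end Staircase

/-! ### Signed and spaced placements -/

section Placements

variable {p : ℕ}

open Classical in
/-- Nonzero residues modulo `2 M + 1` are pairs of a sign and an absolute value in `{1, …, M}`. -/
theorem card_filter_natAbs_valMinAbs (M : ℕ) [NeZero (2 * M + 1)] (Q : (Fin p → ℕ) → Prop) :
    (Finset.univ.filter fun y : Fin p → ZMod (2 * M + 1) =>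
      (∀ i, y i ≠ 0) ∧ Q fun i => (y i).valMinAbs.natAbs).card =
    2 ^ p * ((Fintype.piFinset fun _ : Fin p => Finset.Icc 1 M).filter Q).card := by
  have h2 : (2 : ℕ) ^ p = (Finset.univ : Finset (Fin p → Bool)).card := by
    simp [Finset.card_univ]
  have hcast : ∀ a : ℕ, a ≤ M → ((a : ZMod (2 * M + 1))).valMinAbs = a :=
    fun a ha => ZMod.valMinAbs_natCast_of_le_half (by omega)
  have hneg : ∀ a : ℕ, a ≤ M → (-(a : ZMod (2 * M + 1))).valMinAbs = -(a : ℤ) := by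
    intro a ha
    rw [ZMod.valMinAbs_neg_of_ne_half, hcast a ha]
    rw [ZMod.val_natCast_of_lt (by omega)]
    omega
  rw [h2, ← Finset.card_product]
  refine Finset.card_nbij' (fun y => (fun i => decide (0 ≤ (y i).valMinAbs),
      fun i => (y i).valMinAbs.natAbs))
    (fun x i => if x.1 i then (x.2 i : ZMod (2 * M + 1)) else -(x.2 i : ZMod (2 * M + 1)))
    ?_ ?_ ?_ ?_
  · intro y hy
    obtain ⟨-, hy0, hQ⟩ := Finset.mem_filter.1 hy
    refine Finset.mem_product.2 ⟨Finset.mem_univ _, Finset.mem_filter.2 ⟨?_, hQ⟩⟩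
    refine Fintype.mem_piFinset.2 fun i => Finset.mem_Icc.2 ⟨?_, ?_⟩
    · rw [Nat.one_le_iff_ne_zero, Int.natAbs_ne_zero, Ne, ZMod.valMinAbs_eq_zero]
      exact hy0 i
    · have := ZMod.natAbs_valMinAbs_le (y i)
      dsimp only
      omega
  · rintro ⟨s, a⟩ hx
    obtain ⟨ha, hQ⟩ := Finset.mem_filter.1 (Finset.mem_product.1 hx).2
    have ha' := fun i => Finset.mem_Icc.1 (Fintype.mem_piFinset.1 ha i)
    have habs : ∀ i, (if s i then (a i : ZMod (2 * M + 1)) else -(a i : ZMod (2 * M + 1))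
        ).valMinAbs.natAbs = a i := by
      intro i
      split_ifs
      · rw [hcast _ (ha' i).2]; simp
      · rw [hneg _ (ha' i).2]; simp
    refine Finset.mem_filter.2 ⟨Finset.mem_univ _, fun i h0 => ?_, ?_⟩
    · have h1 := habs i
      simp only at h0
      rw [h0, ZMod.valMinAbs_zero] at h1
      have : 1 ≤ a i := (ha' i).1
      simp at h1
      omega
    · simp only
      simp_rw [habs]
      exact hQ
  · intro y _
    ext i
    simp only [decide_eq_true_eq]
    split_ifs with h
    · rw [← Int.cast_natCast, Int.natAbs_of_nonneg h, ZMod.coe_valMinAbs]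
    · rw [← Int.cast_natCast, Int.ofNat_natAbs_of_nonpos (by omega), Int.cast_neg, neg_neg,
        ZMod.coe_valMinAbs]
  · rintro ⟨s, a⟩ hx
    obtain ⟨ha, hQ⟩ := Finset.mem_filter.1 (Finset.mem_product.1 hx).2
    have ha' := fun i => Finset.mem_Icc.1 (Fintype.mem_piFinset.1 ha i)
    refine Prod.ext (funext fun i => ?_) (funext fun i => ?_)
    · have : 1 ≤ a i := (ha' i).1
      cases hs : s i
      · simp only [hs, Bool.false_eq_true, if_false, hneg _ (ha' i).2]
        simp only [decide_eq_false_iff_not]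
        omega
      · simp only [hs, if_true, hcast _ (ha' i).2]
        simp only [decide_eq_true_eq]
        omega
    · simp only
      split_ifs
      · rw [hcast _ (ha' i).2]; simp
      · rw [hneg _ (ha' i).2]; simp

open Classical in
theorem card_injective_placements (m M : ℕ) :
    ((Fintype.piFinset fun _ : Fin p => Finset.Icc 1 M).filter fun a =>
      (∀ i, m < a i) ∧ ∀ i j, i ≠ j → a i ≠ a j).card = (M - m).descFactorial p := by
  have h := Fintype.card_embedding_eq (α := Fin p) (β := Finset.Icc (m + 1) M)
  rw [Fintype.card_fin, Fintype.card_coe, Nat.card_Icc, Nat.add_sub_add_right] at h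
  rw [← h, ← Finset.card_univ]
  symm
  refine Finset.card_bij (fun f _ i => (f i : ℕ)) ?_ ?_ ?_
  · intro f _
    have hf := fun i => Finset.mem_Icc.1 (f i).2
    refine Finset.mem_filter.2 ⟨Fintype.mem_piFinset.2 fun i => Finset.mem_Icc.2
      ⟨by have := hf i; omega, (hf i).2⟩, fun i => (hf i).1, fun i j hij h => ?_⟩
    exact hij (f.injective (Subtype.ext h))
  · intro f _ f' _ h
    ext i
    exact congrFun h i
  · intro a ha
    obtain ⟨ha, hm, hinj⟩ := Finset.mem_filter.1 ha
    have ha' := fun i => Finset.mem_Icc.1 (Fintype.mem_piFinset.1 ha i)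
    refine ⟨⟨fun i => ⟨a i, Finset.mem_Icc.2 ⟨hm i, (ha' i).2⟩⟩, fun i j h => ?_⟩,
      Finset.mem_univ _, rfl⟩
    by_contra hij
    exact hinj i j hij (congrArg Subtype.val h)

/-- Points that are more than `m` apart from each other and from `y` take up room. -/
theorem card_mul_le_of_spaced (m : ℕ) (a : Fin p → ℕ)
    (ha : ∀ i j, i ≠ j → a i + m < a j ∨ a j + m < a i) (K : Finset (Fin p)) (x y : ℕ)
    (hK : ∀ k ∈ K, x ≤ a k ∧ a k + m + 1 ≤ y) : K.card * (m + 1) ≤ y - x := by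
  have h1 : (K.biUnion fun k => Finset.Ico (a k) (a k + m + 1)) ⊆ Finset.Ico x y := by
    intro z hz
    obtain ⟨k, hk, hz⟩ := Finset.mem_biUnion.1 hz
    have := hK k hk
    rw [Finset.mem_Ico] at hz ⊢
    omega
  have h2 := Finset.card_le_card h1
  rw [Finset.card_biUnion, Nat.card_Ico] at h2
  · simpa [add_assoc] using h2
  · intro i _ j _ hij
    rw [Function.onFun, Finset.disjoint_left]
    intro z hz hz'
    rw [Finset.mem_Ico] at hz hz'
    have := ha i j hij
    omega

/-- The number of values of `a` below `a i`. -/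
def rankBelow (a : Fin p → ℕ) (i : Fin p) : ℕ := (Finset.univ.filter fun j => a j < a i).card

theorem rankBelow_congr {a a' : Fin p → ℕ} (h : ∀ i j, a i < a j ↔ a' i < a' j) (i : Fin p) :
    rankBelow a i = rankBelow a' i := by
  simp only [rankBelow, h]

theorem rankBelow_lt {a : Fin p → ℕ} (i : Fin p) : rankBelow a i + 1 ≤ p := by
  have : rankBelow a i < (Finset.univ : Finset (Fin p)).card :=
    Finset.card_lt_card (Finset.filter_ssubset.2 ⟨i, Finset.mem_univ _, by simp⟩)
  simpa using this

theorem rankBelow_lt_rankBelow {a : Fin p → ℕ} {i j : Fin p} (h : a i < a j) :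
    rankBelow a i < rankBelow a j := by
  refine Finset.card_lt_card (Finset.ssubset_iff_subset_ne.2 ⟨?_, fun he => ?_⟩)
  · intro k hk
    simp only [Finset.mem_filter, Finset.mem_univ, true_and] at hk ⊢
    omega
  · have : i ∈ Finset.univ.filter fun k => a k < a j := by simpa using h
    rw [← he] at this
    simp at this

open Classical in
/-- Placements with gaps larger than `m` become arbitrary injective placements on closing the
gaps. -/
theorem card_spaced_placements (m M : ℕ) (hM : (p - 1) * m ≤ M) :
    ((Fintype.piFinset fun _ : Fin p => Finset.Icc 1 M).filter fun a =>
      ∀ i j, i ≠ j → a i + m < a j ∨ a j + m < a i).card =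
      (M - (p - 1) * m).descFactorial p := by
  have h := card_injective_placements (p := p) 0 (M - (p - 1) * m)
  rw [Nat.sub_zero] at h
  rw [← h]
  -- Lowering each entry by `m` times its rank closes the gaps and preserves the order.
  have hclose : ∀ a : Fin p → ℕ, (∀ i, 1 ≤ a i ∧ a i ≤ M) →
      (∀ i j, i ≠ j → a i + m < a j ∨ a j + m < a i) →
      (∀ i, m * rankBelow a i + 1 ≤ a i ∧ a i - m * rankBelow a i ≤ M - (p - 1) * m) ∧
      ∀ i j, a i < a j ↔ a i - m * rankBelow a i < a j - m * rankBelow a j := by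
    intro a ha hs
    have hlow : ∀ i, rankBelow a i * (m + 1) + 1 ≤ a i := by
      intro i
      have := card_mul_le_of_spaced m a hs (Finset.univ.filter fun j => a j < a i) 1 (a i) (by
        intro k hk
        have hk : a k < a i := by simpa using hk
        have := hs k i (by rintro rfl; omega)
        have := ha k
        omega)
      have h1 := (ha i).1
      change rankBelow a i * (m + 1) ≤ _ at this
      omega
    have hup : ∀ i, (p - rankBelow a i) * (m + 1) ≤ M + m + 1 - a i := by
      intro i
      have := card_mul_le_of_spaced m a hs (Finset.univ.filter fun j => ¬ a j < a i) (a i)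
        (M + m + 1) (by
          intro k hk
          have hk : a i ≤ a k := by simpa using hk
          have := ha k
          omega)
      have hc := Finset.card_filter_add_card_filter_not (s := (Finset.univ : Finset (Fin p)))
        (fun j => a j < a i)
      rw [Finset.card_univ, Fintype.card_fin] at hc
      have hr : (Finset.univ.filter fun j => ¬ a j < a i).card = p - rankBelow a i := by
        rw [rankBelow]; omega
      rwa [hr] at this
    have hord : ∀ i j, a i < a j →
        a i - m * rankBelow a i < a j - m * rankBelow a j := by
      intro i j hij
      have := card_mul_le_of_spaced m a hs
        (Finset.univ.filter fun k => a k < a j ∧ ¬ a k < a i) (a i) (a j) (by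
          intro k hk
          have hk : a k < a j ∧ a i ≤ a k := by simpa using hk
          have := hs k j (by rintro rfl; omega)
          omega)
      have hc := Finset.card_filter_add_card_filter_not
        (s := Finset.univ.filter fun k => a k < a j) (fun k => a k < a i)
      rw [Finset.filter_filter, Finset.filter_filter] at hc
      have e1 : (Finset.univ.filter fun k => a k < a j ∧ a k < a i) =
          Finset.univ.filter fun k => a k < a i := Finset.filter_congr fun k _ => by omega
      rw [e1] at hc
      change rankBelow a i + _ = rankBelow a j at hc
      have hlt := rankBelow_lt_rankBelow hij
      obtain ⟨s, hs'⟩ : ∃ s, rankBelow a j = rankBelow a i + s + 1 :=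
        ⟨rankBelow a j - rankBelow a i - 1, by omega⟩
      have hcard : (Finset.univ.filter fun k => a k < a j ∧ ¬ a k < a i).card = s + 1 := by omega
      rw [hcard] at this
      have h1 := hlow i
      have h2 := hlow j
      rw [hs'] at h2 ⊢
      have e2 : m * (rankBelow a i + s + 1) = m * rankBelow a i + m * s + m := by ring
      have e3 : (s + 1) * (m + 1) = m * s + s + m + 1 := by ring
      have e4 : rankBelow a i * (m + 1) = m * rankBelow a i + rankBelow a i := by ring
      rw [e2]
      rw [e3] at this
      rw [e4] at h1
      omega
    refine ⟨fun i => ?_, fun i j => ⟨hord i j, fun hij => ?_⟩⟩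
    · have h1 := hlow i
      have h2 := hup i
      have h3 := rankBelow_lt (a := a) i
      obtain ⟨s, hs'⟩ : ∃ s, p = rankBelow a i + s + 1 := ⟨p - rankBelow a i - 1, by omega⟩
      have e1 : p - rankBelow a i = s + 1 := by omega
      have e2 : p - 1 = rankBelow a i + s := by omega
      rw [e1] at h2
      rw [e2] at hM ⊢
      have e3 : (s + 1) * (m + 1) = m * s + s + m + 1 := by ring
      have e4 : rankBelow a i * (m + 1) = m * rankBelow a i + rankBelow a i := by ring
      have e5 : (rankBelow a i + s) * m = m * rankBelow a i + m * s := by ring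
      rw [e5] at hM ⊢
      rw [e3] at h2
      rw [e4] at h1
      have := ha i
      omega
    · rcases lt_trichotomy (a i) (a j) with h | h | h
      · exact h
      · have : rankBelow a i = rankBelow a j := by simp [rankBelow, h]
        rw [h, this] at hij
        exact absurd hij (lt_irrefl _)
      · exact absurd (hord j i h) (by omega)
  -- Conversely, opening gaps of size `m` preserves the order, so the ranks are the same before and
  -- after and the two maps are mutually inverse.
  have hopen : ∀ a : Fin p → ℕ, (∀ i j, i ≠ j → a i ≠ a j) →
      ∀ i j, a i < a j ↔ a i + m * rankBelow a i < a j + m * rankBelow a j := by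
    intro a hinj i j
    have hord : ∀ i j, a i < a j → a i + m * rankBelow a i < a j + m * rankBelow a j :=
      fun i j h => add_lt_add_of_lt_of_le h (Nat.mul_le_mul_left m (rankBelow_lt_rankBelow h).le)
    refine ⟨hord i j, fun hij => ?_⟩
    rcases lt_trichotomy (a i) (a j) with h | h | h
    · exact h
    · have : rankBelow a i = rankBelow a j := by simp [rankBelow, h]
      rw [h, this] at hij
      exact absurd hij (lt_irrefl _)
    · exact absurd (hord j i h) (by omega)
  refine Finset.card_nbij' (fun a i => a i - m * rankBelow a i)
    (fun a i => a i + m * rankBelow a i) ?_ ?_ ?_ ?_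
  · intro a ha
    obtain ⟨ha, hs⟩ := Finset.mem_filter.1 ha
    have ha' := fun i => Finset.mem_Icc.1 (Fintype.mem_piFinset.1 ha i)
    obtain ⟨h1, h2⟩ := hclose a ha' hs
    refine Finset.mem_filter.2 ⟨Fintype.mem_piFinset.2 fun i => Finset.mem_Icc.2
      ⟨by have := h1 i; dsimp only; omega, (h1 i).2⟩,
      fun i => by have := h1 i; dsimp only; omega, fun i j hij he => ?_⟩
    dsimp only at he
    have h3 := h2 i j
    have h4 := h2 j i
    have := hs i j hij
    omega
  · intro a ha
    obtain ⟨ha, -, hinj⟩ := Finset.mem_filter.1 ha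
    have ha' := fun i => Finset.mem_Icc.1 (Fintype.mem_piFinset.1 ha i)
    refine Finset.mem_filter.2 ⟨Fintype.mem_piFinset.2 fun i => Finset.mem_Icc.2 ⟨?_, ?_⟩, ?_⟩
    · have := ha' i; dsimp only; omega
    · have h1 := ha' i
      have h2 : rankBelow a i ≤ p - 1 := by have := rankBelow_lt (a := a) i; omega
      have h3 := Nat.mul_le_mul_left m h2
      rw [mul_comm m (p - 1)] at h3
      dsimp only
      omega
    · have hsp : ∀ i j, a i < a j → a i + m * rankBelow a i + m < a j + m * rankBelow a j := by
        intro i j h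
        have h1 : m * (rankBelow a i + 1) ≤ m * rankBelow a j :=
          Nat.mul_le_mul_left m (rankBelow_lt_rankBelow h)
        rw [mul_add, mul_one] at h1
        omega
      intro i j hij
      rcases (hinj i j hij).lt_or_gt with h | h
      · exact Or.inl (hsp i j h)
      · exact Or.inr (hsp j i h)
  · intro a ha
    obtain ⟨ha, hs⟩ := Finset.mem_filter.1 ha
    have ha' := fun i => Finset.mem_Icc.1 (Fintype.mem_piFinset.1 ha i)
    obtain ⟨h1, h2⟩ := hclose a ha' hs
    ext i
    simp only
    rw [← rankBelow_congr h2 i]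
    have := h1 i
    omega
  · intro a ha
    obtain ⟨ha, -, hinj⟩ := Finset.mem_filter.1 ha
    ext i
    simp only
    rw [← rankBelow_congr (hopen a hinj) i]
    omega

end Placements

/-! ### Orthogonal coordinates in types `B` and `C` -/

section SignedBasis

variable {ι V N : Type*} [NormedAddCommGroup V] [InnerProductSpace ℝ V]
  [AddCommGroup N] [Module ℝ N] {P : RootPairing ι ℝ V N} {p : ℕ}

/-- An orthogonal basis `ε` of vectors of equal length in which the simple roots are
`ε₁ - ε₂, …, ε_{p-1} - ε_p, κ ε_p`; the type is `B` for `κ = 1` and `C` for `κ = 2`. -/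
structure IsSignedBasis (b : P.Base) (e : Fin p ≃ b.support) (κ : ℕ)
    (ε : Module.Basis (Fin p) ℝ V) (s : ℝ) : Prop where
  two_le : 2 ≤ p
  kappa : κ = 1 ∨ κ = 2
  pos : 0 < s
  inner_eq : ∀ i j, inner ℝ (ε i) (ε j) = if i = j then s else 0
  simple_sub : ∀ i j : Fin p, (i : ℕ) + 1 = j → P.root (e i) = ε i - ε j
  simple_last : ∀ i : Fin p, (i : ℕ) + 1 = p → P.root (e i) = (κ : ℝ) • ε i

/-- The Cartan matrix determines the Gram matrix of the simple roots up to a scalar, and hence that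
of their partial sums. -/
theorem exists_isSignedBasis [P.IsRootSystem] [P.IsCrystallographic]
    (hinv : IsWeylInvariantInner P) (b : P.Base) (e : Fin p ≃ b.support) (hp : 2 ≤ p) (κ : ℕ)
    (hA : (κ = 1 ∧ numberedCartanMatrix b e = CartanMatrix.B p) ∨
      (κ = 2 ∧ numberedCartanMatrix b e = CartanMatrix.C p)) :
    ∃ (ε : Module.Basis (Fin p) ℝ V) (s : ℝ), IsSignedBasis b e κ ε s := by
  have hκ : (κ : ℝ) ≠ 0 := by rcases hA with ⟨rfl, -⟩ | ⟨rfl, -⟩ <;> norm_num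
  set α : Fin p → V := fun i => P.root (e i) with hα
  set G : Fin p → Fin p → ℝ := fun i j => inner ℝ (α i) (α j) with hG
  have hsymm : ∀ i j, G i j = G j i := fun i j => real_inner_comm _ _
  have hAG : ∀ i j, (numberedCartanMatrix b e i j : ℝ) * G j j = 2 * G i j :=
    fun i j => cartan_mul_inner_self hinv b e i j
  have hpos : ∀ i, 0 < G i i := fun i => inner_root_self_pos _
  have f2 : ∀ i j : Fin p, (i : ℕ) + 1 = j → (j : ℕ) + 1 < p →
      numberedCartanMatrix b e i j = -1 ∧ numberedCartanMatrix b e j i = -1 := by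
    intro i j h h'
    have h1 : i ≠ j := by rintro rfl; omega
    rcases hA with ⟨-, hA⟩ | ⟨-, hA⟩ <;> rw [hA] <;>
      simp only [CartanMatrix.B, CartanMatrix.C, Matrix.of_apply, h1, h1.symm, if_false, h, if_true]
        <;> constructor <;> (try split_ifs) <;> first | trivial | rfl | omega
  have f3 : ∀ i j : Fin p, (i : ℕ) + 1 = j → (j : ℕ) + 1 = p →
      (κ : ℤ) * numberedCartanMatrix b e i j = -2 ∧ numberedCartanMatrix b e j i = -κ := by
    intro i j h h'
    have h1 : i ≠ j := by rintro rfl; omega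
    rcases hA with ⟨rfl, hA⟩ | ⟨rfl, hA⟩ <;> rw [hA] <;>
      simp only [CartanMatrix.B, CartanMatrix.C, Matrix.of_apply, h1, h1.symm, if_false, h, if_true]
        <;> constructor <;> (try split_ifs) <;> first | trivial | rfl | omega
  have f4 : ∀ i j : Fin p, i ≠ j → (i : ℕ) + 1 ≠ j → (j : ℕ) + 1 ≠ i →
      numberedCartanMatrix b e i j = 0 := by
    intro i j h h' h''
    rcases hA with ⟨rfl, hA⟩ | ⟨rfl, hA⟩ <;> rw [hA] <;>
      simp [CartanMatrix.B, CartanMatrix.C, h, h', h'']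
  set s : ℝ := G ⟨0, by omega⟩ ⟨0, by omega⟩ / 2 with hs
  have g1 : ∀ (k : ℕ) (hk : k + 1 < p), G ⟨k, by omega⟩ ⟨k, by omega⟩ = 2 * s := by
    intro k
    induction k with
    | zero => intro _; rw [hs]; ring
    | succ k ih =>
      intro hk
      obtain ⟨h1, h2⟩ := f2 ⟨k, by omega⟩ ⟨k + 1, by omega⟩ rfl (by simpa using hk)
      have h3 := hAG ⟨k, by omega⟩ ⟨k + 1, by omega⟩
      have h4 := hAG ⟨k + 1, by omega⟩ ⟨k, by omega⟩
      rw [h1] at h3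
      rw [h2, ih (by omega)] at h4
      rw [hsymm ⟨k, by omega⟩ ⟨k + 1, by omega⟩] at h3
      push_cast at h3 h4
      linarith
  have g2 : ∀ j : Fin p, (j : ℕ) + 1 < p → G j j = 2 * s := fun j hj => g1 j hj
  have g3 : ∀ j : Fin p, (j : ℕ) + 1 = p → G j j = κ ^ 2 * s := by
    intro j hj
    have hi : (j : ℕ) - 1 < p := by omega
    obtain ⟨h1, h2⟩ := f3 ⟨j - 1, hi⟩ j (by simp; omega) hj
    have h3 := hAG ⟨j - 1, hi⟩ j
    have h4 := hAG j ⟨j - 1, hi⟩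
    rw [h2, g2 ⟨j - 1, hi⟩ (by simp; omega)] at h4
    rw [hsymm ⟨j - 1, hi⟩ j] at h3
    have h1' : (κ : ℝ) * (numberedCartanMatrix b e ⟨j - 1, hi⟩ j : ℝ) = -2 := by exact_mod_cast h1
    push_cast at h4
    have h5 : (numberedCartanMatrix b e ⟨j - 1, hi⟩ j : ℝ) * G j j = -κ * (2 * s) := by
      rw [h3, h4]
    have h6 := congrArg (fun x => (κ : ℝ) * x) h5
    simp only [← mul_assoc, h1'] at h6
    linarith
  have hs0 : 0 < s := by
    have := hpos ⟨0, by omega⟩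
    rw [hs]; linarith
  have g4 : ∀ i j : Fin p, (i : ℕ) + 1 = j → G i j = if (j : ℕ) + 1 = p then -κ * s else -s := by
    intro i j hij
    have h4 := hAG j i
    rw [g2 i (by omega)] at h4
    rw [hsymm]
    split_ifs with h
    · rw [(f3 i j hij h).2] at h4
      push_cast at h4
      linarith
    · rw [(f2 i j hij (by omega)).2] at h4
      push_cast at h4
      linarith
  have g5 : ∀ i j : Fin p, i ≠ j → (i : ℕ) + 1 ≠ j → (j : ℕ) + 1 ≠ i → G i j = 0 := by
    intro i j h h' h''
    have := hAG i j
    rw [f4 i j h h' h''] at this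
    simp at this
    linarith
  -- The equations `α i = ε i - ε (i + 1)` and `α (p - 1) = κ ε (p - 1)` determine `ε`.
  set ε : Fin p → V := fun i => ∑ k : Fin p,
    if i ≤ k then (if (k : ℕ) + 1 = p then (κ : ℝ)⁻¹ else 1) • α k else 0 with hε
  have e1 : ∀ i : Fin p, (i : ℕ) + 1 = p → ε i = (κ : ℝ)⁻¹ • α i := by
    intro i hi
    simp only [hε]
    rw [Finset.sum_eq_single i]
    · simp [hi]
    · intro k _ hk
      rw [if_neg]
      intro h
      have := k.2
      exact hk (Fin.ext (by have : (i : ℕ) ≤ k := h; omega))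
    · simp
  have e2 : ∀ i j : Fin p, (i : ℕ) + 1 = j → ε i = α i + ε j := by
    intro i j hij
    have : α i = ∑ k, if k = i then α k else 0 := by simp
    rw [this]
    simp only [hε]
    rw [← Finset.sum_add_distrib]
    refine Finset.sum_congr rfl fun k _ => ?_
    by_cases hk : k = i
    · subst hk
      have h1 : ¬ j ≤ k := by rw [Fin.le_def]; omega
      have h2 : ¬ ((k : ℕ) + 1 = p) := by have := j.2; omega
      simp [h1, h2]
    · have h1 : i ≤ k ↔ j ≤ k := by
        rw [Fin.le_def, Fin.le_def]
        have : (k : ℕ) ≠ i := fun h => hk (Fin.ext h)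
        omega
      simp [hk, h1]
  have e3 : ∀ (d : ℕ) (i : Fin p), (i : ℕ) + d + 1 = p → ∀ j : Fin p, inner ℝ (ε i) (α j) =
      if (j : ℕ) + 1 = p then (if i = j then κ * s else 0) else
        if i = j then s else if (j : ℕ) + 1 = i then -s else 0 := by
    intro d
    induction d with
    | zero =>
      intro i hi j
      rw [e1 i (by omega), real_inner_smul_left]
      change (κ : ℝ)⁻¹ * G i j = _
      by_cases hij : i = j
      · subst hij
        rw [g3 i (by omega), if_pos (by omega), if_pos rfl]
        field_simp
      · have hne : (i : ℕ) ≠ j := fun h => hij (Fin.ext h)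
        have := j.2
        rw [if_neg (by omega), if_neg hij]
        split_ifs with h
        · rw [hsymm, g4 j i h, if_pos (by omega)]
          field_simp
        · rw [g5 i j hij (by omega) h, mul_zero]
    | succ d ih =>
      intro i hi j
      have hi' : (i : ℕ) + 1 < p := by omega
      rw [e2 i ⟨i + 1, hi'⟩ rfl, inner_add_left, ih ⟨i + 1, hi'⟩ (by simp; omega) j]
      change G i j + _ = _
      by_cases hij : i = j
      · subst hij
        have h1 : ¬ ((⟨i + 1, hi'⟩ : Fin p) = i) := by simp [Fin.ext_iff]
        rw [g2 i hi', if_neg (by omega), if_neg h1, if_pos rfl, if_neg (by omega), if_pos rfl]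
        ring
      · have hne : (i : ℕ) ≠ j := fun h => hij (Fin.ext h)
        by_cases h1 : (i : ℕ) + 1 = j
        · have h2 : (⟨i + 1, hi'⟩ : Fin p) = j := Fin.ext h1
          rw [g4 i j h1, h2]
          simp only [hij, if_true, if_false]
          split_ifs <;> first | omega | ring
        · have h2 : ¬ ((⟨i + 1, hi'⟩ : Fin p) = j) := fun h => h1 (by rw [← h])
          simp only [hij, h2, if_false]
          by_cases h3 : (j : ℕ) + 1 = i
          · rw [hsymm, g4 j i h3]
            split_ifs <;> first | omega | ring
          · rw [g5 i j hij h1 h3]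
            split_ifs <;> first | omega | ring
  have e4 : ∀ i j : Fin p, inner ℝ (ε i) (α j) =
      if (j : ℕ) + 1 = p then (if i = j then κ * s else 0) else
        if i = j then s else if (j : ℕ) + 1 = i then -s else 0 :=
    fun i j => e3 (p - 1 - i) i (by omega) j
  have e5 : ∀ (d : ℕ) (j : Fin p), (j : ℕ) + d + 1 = p → ∀ i : Fin p,
      inner ℝ (ε i) (ε j) = if i = j then s else 0 := by
    intro d
    induction d with
    | zero =>
      intro j hj i
      rw [e1 j (by omega), real_inner_smul_right, e4, if_pos (by omega)]
      split_ifs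
      · field_simp
      · simp
    | succ d ih =>
      intro j hj i
      have hj' : (j : ℕ) + 1 < p := by omega
      rw [e2 j ⟨j + 1, hj'⟩ rfl, inner_add_right, e4, ih ⟨j + 1, hj'⟩ (by simp; omega) i,
        if_neg (by omega)]
      have hij' : i = (⟨j + 1, hj'⟩ : Fin p) ↔ (j : ℕ) + 1 = i := by
        rw [Fin.ext_iff]; exact eq_comm
      simp only [hij']
      by_cases hij : i = j
      · subst hij; simp
      · simp only [hij, if_false]
        split_ifs <;> ring
  have e6 : ∀ i j : Fin p, inner ℝ (ε i) (ε j) = if i = j then s else 0 :=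
    fun i j => e5 (p - 1 - j) j (by omega) i
  have hli : LinearIndependent ℝ ε := by
    refine linearIndependent_of_ne_zero_of_inner_eq_zero (fun i h => ?_) fun i j hij => ?_
    · have := e6 i i
      rw [h, inner_zero_left, if_pos rfl] at this
      exact hs0.ne this
    · have := e6 i j
      rwa [if_neg hij] at this
  have : Nonempty (Fin p) := ⟨⟨0, by omega⟩⟩
  have hcard : Fintype.card (Fin p) = Module.finrank ℝ V :=
    (Module.finrank_eq_card_basis (simpleBasis b e)).symm
  refine ⟨basisOfLinearIndependentOfCardEqFinrank hli hcard, s, hp, ?_, hs0, ?_, ?_, ?_⟩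
  · rcases hA with ⟨h, -⟩ | ⟨h, -⟩ <;> simp [h]
  · intro i j
    rw [coe_basisOfLinearIndependentOfCardEqFinrank]
    exact e6 i j
  · intro i j hij
    rw [coe_basisOfLinearIndependentOfCardEqFinrank, e2 i j hij]
    simp [hα]
  · intro i hi
    rw [coe_basisOfLinearIndependentOfCardEqFinrank, e1 i hi, smul_smul, mul_inv_cancel₀ hκ,
      one_smul]

theorem norm_le_norm_iff_inner (x y : V) : ‖x‖ ≤ ‖y‖ ↔ inner ℝ x x ≤ inner ℝ y y := by
  rw [real_inner_self_eq_norm_sq, real_inner_self_eq_norm_sq]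
  exact (sq_le_sq₀ (norm_nonneg _) (norm_nonneg _)).symm

namespace IsSignedBasis

variable {b : P.Base} {e : Fin p ≃ b.support} {κ : ℕ} {ε : Module.Basis (Fin p) ℝ V} {s : ℝ}

theorem kappa_ne_zero (H : IsSignedBasis b e κ ε s) : (κ : ℝ) ≠ 0 := by
  rcases H.kappa with h | h <;> simp [h]

theorem simple_cases (H : IsSignedBasis b e κ ε s) (i : Fin p) :
    (∃ j : Fin p, (i : ℕ) + 1 = j ∧ P.root (e i) = ε i - ε j) ∨
      (i : ℕ) + 1 = p ∧ P.root (e i) = (κ : ℝ) • ε i := by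
  rcases Nat.lt_or_ge (i + 1) p with h | h
  · exact Or.inl ⟨⟨i + 1, h⟩, rfl, H.simple_sub i _ rfl⟩
  · have := i.2
    exact Or.inr ⟨by omega, H.simple_last i (by omega)⟩

/-- The simple coordinates of a vector are, up to the factor `κ` in the last one, the partial sums
of its orthogonal coordinates. -/
theorem simpleBasis_repr [P.IsRootSystem] (H : IsSignedBasis b e κ ε s) (x : V) (k : Fin p) :
    (simpleBasis b e).repr x k =
      (if (k : ℕ) + 1 = p then (κ : ℝ)⁻¹ else 1) * ∑ i with i ≤ k, ε.repr x i := by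
  let F : V →ₗ[ℝ] ℝ :=
    (if (k : ℕ) + 1 = p then (κ : ℝ)⁻¹ else 1) • ∑ i with i ≤ k, ε.coord i
  have hF : (simpleBasis b e).coord k = F := by
    refine (simpleBasis b e).ext fun j => ?_
    have hsum : ∀ a : Fin p, ∑ i with i ≤ k, ε.coord i (ε a) = if a ≤ k then (1 : ℝ) else 0 := by
      intro a
      simp [Finsupp.single_apply, Finset.sum_ite_eq]
    rw [Module.Basis.coord_apply, Module.Basis.repr_self, Finsupp.single_apply]
    simp only [F, LinearMap.smul_apply, LinearMap.sum_apply, smul_eq_mul]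
    rw [simpleBasis_apply]
    rcases H.simple_cases j with ⟨j', hj, hr⟩ | ⟨hj, hr⟩
    · rw [hr]
      simp only [map_sub, Finset.sum_sub_distrib, hsum]
      have := j'.2
      by_cases hjk : j = k
      · subst hjk
        have h1 : ¬ j' ≤ j := by rw [Fin.le_def]; omega
        have h2 : ¬ ((j : ℕ) + 1 = p) := by omega
        simp [h1, h2]
      · have h1 : j ≤ k ↔ j' ≤ k := by
          have : (j : ℕ) ≠ k := fun h => hjk (Fin.ext h)
          rw [Fin.le_def, Fin.le_def]; omega
        simp [h1, hjk]
    · rw [hr]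
      simp only [map_smul, smul_eq_mul, ← Finset.mul_sum, hsum]
      have := k.2
      by_cases hjk : j = k
      · subst hjk
        simp [hj, H.kappa_ne_zero]
      · have h1 : ¬ j ≤ k := by
          have : (j : ℕ) ≠ k := fun h => hjk (Fin.ext h)
          rw [Fin.le_def]; omega
        simp [h1, hjk]
  have := LinearMap.congr_fun hF x
  rw [Module.Basis.coord_apply] at this
  rw [this]
  simp only [F, LinearMap.smul_apply, LinearMap.sum_apply, smul_eq_mul, Module.Basis.coord_apply]

theorem rootLE_iff [P.IsRootSystem] (H : IsSignedBasis b e κ ε s) (i j : ι) :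
    RootLE b i j ↔ ∀ k, ∑ l with l ≤ k, ε.repr (P.root i) l ≤
      ∑ l with l ≤ k, ε.repr (P.root j) l := by
  rw [rootLE_iff_repr_le b e]
  refine forall_congr' fun k => ?_
  rw [H.simpleBasis_repr, H.simpleBasis_repr, mul_le_mul_iff_right₀]
  have := H.kappa_ne_zero
  split_ifs <;> positivity

theorem isPos_iff [P.IsRootSystem] (H : IsSignedBasis b e κ ε s) (i : ι) :
    b.IsPos i ↔ ∀ k, 0 ≤ ∑ l with l ≤ k, ε.repr (P.root i) l := by
  rw [isPos_iff_repr_nonneg b e]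
  refine forall_congr' fun k => ?_
  rw [H.simpleBasis_repr, mul_nonneg_iff_of_pos_left]
  have := H.kappa_ne_zero
  split_ifs <;> positivity

theorem reflection_of_sub (H : IsSignedBasis b e κ ε s) (hinv : IsWeylInvariantInner P) {i : ι}
    {a c : Fin p} (hac : a ≠ c) (hi : P.root i = ε a - ε c) (d : Fin p) :
    P.reflection i (ε d) = ε (Equiv.swap a c d) := by
  have hs := H.pos.ne'
  rw [reflection_eq_of_inner hinv, hi]
  simp only [inner_sub_left, inner_sub_right, H.inner_eq, if_true, hac, hac.symm, if_false]
  by_cases hda : d = a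
  · subst hda
    rw [Equiv.swap_apply_left, if_pos rfl, if_neg hac,
      show 2 * (s - 0) / (s - 0 - (0 - s)) = 1 by
        rw [div_eq_one_iff_eq (by simpa using hs)]; ring]
    module
  · by_cases hdc : d = c
    · subst hdc
      rw [Equiv.swap_apply_right, if_pos rfl, if_neg hda,
        show 2 * (0 - s) / (s - 0 - (0 - s)) = -1 by
          rw [div_eq_iff (by simpa using hs)]; ring]
      module
    · rw [Equiv.swap_apply_of_ne_of_ne hda hdc, if_neg hda, if_neg hdc]
      simp

theorem reflection_of_smul (H : IsSignedBasis b e κ ε s) (hinv : IsWeylInvariantInner P) {i : ι}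
    {a : Fin p} (hi : P.root i = (κ : ℝ) • ε a) (d : Fin p) :
    P.reflection i (ε d) = if d = a then -ε d else ε d := by
  have hs := H.pos.ne'
  have hκ := H.kappa_ne_zero
  rw [reflection_eq_of_inner hinv, hi]
  simp only [real_inner_smul_left, real_inner_smul_right, H.inner_eq, if_true]
  split_ifs with h
  · subst h
    rw [smul_smul, show 2 * (κ * s) / (κ * (κ * s)) * (κ : ℝ) = 2 by field_simp]
    module
  · simp

/-- The vectors `±κ ε_a` and `±ε_a ± ε_c`. -/
def IsSignedVector (κ : ℕ) (ε : Module.Basis (Fin p) ℝ V) (x : V) : Prop :=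
  (∃ (a : Fin p) (u : ℤˣ), x = ((u : ℤ) : ℝ) • (κ : ℝ) • ε a) ∨
    ∃ (a c : Fin p) (u v : ℤˣ), a ≠ c ∧ x = ((u : ℤ) : ℝ) • ε a + ((v : ℤ) : ℝ) • ε c

theorem isSignedVector_map {g : V ≃ₗ[ℝ] V} {σ : Equiv.Perm (Fin p)} {t : Fin p → ℤˣ}
    (hg : ∀ d, g (ε d) = ((t d : ℤ) : ℝ) • ε (σ d)) {x : V} (hx : IsSignedVector κ ε x) :
    IsSignedVector κ ε (g x) := by
  rcases hx with ⟨a, u, rfl⟩ | ⟨a, c, u, v, hac, rfl⟩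
  · refine Or.inl ⟨σ a, u * t a, ?_⟩
    rw [map_smul, map_smul, hg]
    push_cast
    module
  · refine Or.inr ⟨σ a, σ c, u * t a, v * t c, σ.injective.ne hac, ?_⟩
    rw [map_add, map_smul, map_smul, hg, hg]
    push_cast
    module

theorem isSignedVector_reflection_simple (H : IsSignedBasis b e κ ε s)
    (hinv : IsWeylInvariantInner P) (i : Fin p) {x : V} (hx : IsSignedVector κ ε x) :
    IsSignedVector κ ε (P.reflection (e i) x) := by
  rcases H.simple_cases i with ⟨j, hij, hr⟩ | ⟨-, hr⟩
  · have hne : i ≠ j := by rintro rfl; omega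
    refine isSignedVector_map (σ := Equiv.swap i j) (t := 1) (fun d => ?_) hx
    rw [H.reflection_of_sub hinv hne hr]
    simp
  · refine isSignedVector_map (σ := 1) (t := fun d => if d = i then -1 else 1) (fun d => ?_) hx
    rw [H.reflection_of_smul hinv hr]
    split_ifs <;> simp

theorem isSignedVector_root [Finite ι] [P.IsRootSystem] [P.IsCrystallographic] [P.IsReduced]
    (H : IsSignedBasis b e κ ε s)
    (hinv : IsWeylInvariantInner P) (i : ι) : IsSignedVector κ ε (P.root i) := by
  refine b.induction_reflect i ?_ ?_ ?_ (p := fun i => IsSignedVector κ ε (P.root i))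
  · intro i hi
    rw [P.root_reflectionPerm, P.reflection_apply_self]
    rcases hi with ⟨a, u, h⟩ | ⟨a, c, u, v, hac, h⟩
    · refine Or.inl ⟨a, -u, ?_⟩
      rw [h]; push_cast; module
    · refine Or.inr ⟨a, c, -u, -v, hac, ?_⟩
      rw [h]; push_cast; module
  · intro i hi
    obtain ⟨k, hk⟩ := e.surjective ⟨i, hi⟩
    have hk' : ((e k : b.support) : ι) = i := congrArg Subtype.val hk
    rw [← hk']
    rcases H.simple_cases k with ⟨j, hij, hr⟩ | ⟨-, hr⟩
    · refine Or.inr ⟨k, j, 1, -1, by rintro rfl; omega, ?_⟩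
      rw [hr]; push_cast; module
    · refine Or.inl ⟨k, 1, ?_⟩
      rw [hr]; push_cast; module
  · intro i j hi hj
    obtain ⟨k, hk⟩ := e.surjective ⟨j, hj⟩
    have hk' : ((e k : b.support) : ι) = j := congrArg Subtype.val hk
    rw [P.root_reflectionPerm, ← hk']
    exact H.isSignedVector_reflection_simple hinv k hi

theorem exists_root_smul (H : IsSignedBasis b e κ ε s) (hinv : IsWeylInvariantInner P)
    (a : Fin p) : ∃ i, P.root i = (κ : ℝ) • ε a := by
  have key : ∀ (d : ℕ) (a : Fin p), (a : ℕ) + d + 1 = p → ∃ i, P.root i = (κ : ℝ) • ε a := by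
    intro d
    induction d with
    | zero => exact fun a ha => ⟨e a, H.simple_last a (by omega)⟩
    | succ d ih =>
      intro a ha
      have ha' : (a : ℕ) + 1 < p := by omega
      obtain ⟨i, hi⟩ := ih ⟨a + 1, ha'⟩ (by simp; omega)
      refine ⟨P.reflectionPerm (e a) i, ?_⟩
      rw [P.root_reflectionPerm, hi, map_smul,
        H.reflection_of_sub hinv (by simp [Fin.ext_iff]) (H.simple_sub a ⟨a + 1, ha'⟩ rfl),
        Equiv.swap_apply_right]
  exact key (p - 1 - a) a (by omega)

theorem exists_root_sub (H : IsSignedBasis b e κ ε s) (hinv : IsWeylInvariantInner P)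
    {a c : Fin p} (hac : a < c) : ∃ i, P.root i = ε a - ε c := by
  have key : ∀ (d : ℕ) (c : Fin p), (a : ℕ) + d + 1 = c → ∃ i, P.root i = ε a - ε c := by
    intro d
    induction d with
    | zero => exact fun c hc => ⟨e a, H.simple_sub a c (by omega)⟩
    | succ d ih =>
      intro c hc
      have hc' : (c : ℕ) - 1 < p := by omega
      obtain ⟨i, hi⟩ := ih ⟨c - 1, hc'⟩ (by simp; omega)
      have hne : (⟨c - 1, hc'⟩ : Fin p) ≠ c := by
        intro h
        have := congrArg Fin.val h
        simp at this
        omega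
      have hs := H.simple_sub ⟨c - 1, hc'⟩ c (by simp; omega)
      refine ⟨P.reflectionPerm (e ⟨c - 1, hc'⟩) i, ?_⟩
      rw [P.root_reflectionPerm, hi, map_sub, H.reflection_of_sub hinv hne hs,
        H.reflection_of_sub hinv hne hs, Equiv.swap_apply_left, Equiv.swap_apply_of_ne_of_ne]
      · intro h
        have := congrArg Fin.val h
        simp at this
        omega
      · rintro rfl
        omega
  have : (a : ℕ) < c := hac
  exact key (c - a - 1) c (by omega)

theorem exists_root_add (H : IsSignedBasis b e κ ε s) (hinv : IsWeylInvariantInner P)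
    {a c : Fin p} (hac : a < c) : ∃ i, P.root i = ε a + ε c := by
  obtain ⟨i, hi⟩ := H.exists_root_sub hinv hac
  obtain ⟨j, hj⟩ := H.exists_root_smul hinv c
  refine ⟨P.reflectionPerm j i, ?_⟩
  rw [P.root_reflectionPerm, hi, map_sub, H.reflection_of_smul hinv hj,
    H.reflection_of_smul hinv hj, if_neg hac.ne, if_pos rfl, sub_neg_eq_add]

theorem sum_repr_basis (ε : Module.Basis (Fin p) ℝ V) (a k : Fin p) :
    ∑ l with l ≤ k, ε.repr (ε a) l = if a ≤ k then (1 : ℝ) else 0 := by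
  simp [Finsupp.single_apply, Finset.sum_ite_eq]

theorem sum_repr_smul (ε : Module.Basis (Fin p) ℝ V) (κ : ℝ) (a k : Fin p) :
    ∑ l with l ≤ k, ε.repr (κ • ε a) l = if a ≤ k then κ else 0 := by
  simp only [map_smul, Finsupp.smul_apply, smul_eq_mul, ← Finset.mul_sum, sum_repr_basis]
  split_ifs <;> simp

theorem sum_repr_sub (ε : Module.Basis (Fin p) ℝ V) (a c k : Fin p) :
    ∑ l with l ≤ k, ε.repr (ε a - ε c) l =
      (if a ≤ k then (1 : ℝ) else 0) - if c ≤ k then (1 : ℝ) else 0 := by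
  simp only [map_sub, Finsupp.sub_apply, Finset.sum_sub_distrib, sum_repr_basis]

theorem sum_repr_add (ε : Module.Basis (Fin p) ℝ V) (a c k : Fin p) :
    ∑ l with l ≤ k, ε.repr (ε a + ε c) l =
      (if a ≤ k then (1 : ℝ) else 0) + if c ≤ k then (1 : ℝ) else 0 := by
  simp only [map_add, Finsupp.add_apply, Finset.sum_add_distrib, sum_repr_basis]

theorem isPos_of_smul [P.IsRootSystem] (H : IsSignedBasis b e κ ε s) {i : ι} {a : Fin p}
    (hi : P.root i = (κ : ℝ) • ε a) : b.IsPos i := by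
  rw [H.isPos_iff, hi]
  intro k
  rw [sum_repr_smul]
  split_ifs <;> positivity

theorem isPos_of_add [P.IsRootSystem] (H : IsSignedBasis b e κ ε s) {i : ι} {a c : Fin p}
    (hi : P.root i = ε a + ε c) : b.IsPos i := by
  rw [H.isPos_iff, hi]
  intro k
  rw [sum_repr_add]
  split_ifs <;> norm_num

theorem isPos_of_sub [P.IsRootSystem] (H : IsSignedBasis b e κ ε s) {i : ι} {a c : Fin p}
    (hac : a < c) (hi : P.root i = ε a - ε c) : b.IsPos i := by
  rw [H.isPos_iff, hi]
  intro k
  rw [sum_repr_sub]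
  split_ifs with h1 h2 <;> first | exact absurd (hac.le.trans ‹_›) h1 | norm_num

theorem isPos_cases [Finite ι] [P.IsRootSystem] [P.IsCrystallographic] [P.IsReduced]
    (H : IsSignedBasis b e κ ε s) (hinv : IsWeylInvariantInner P) {i : ι} (hi : b.IsPos i) :
    (∃ a, P.root i = (κ : ℝ) • ε a) ∨
      ∃ a c, a < c ∧ (P.root i = ε a - ε c ∨ P.root i = ε a + ε c) := by
  have hpos := (H.isPos_iff i).1 hi
  have hp := H.two_le
  have hκ : (0 : ℝ) < κ := lt_of_le_of_ne (Nat.cast_nonneg _) H.kappa_ne_zero.symm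
  let z : Fin p := ⟨p - 1, by omega⟩
  have hz : ∀ a : Fin p, a ≤ z := fun a => by
    rw [Fin.le_def]; have := a.2; simp only [z]; omega
  rcases H.isSignedVector_root hinv i with ⟨a, u, h⟩ | ⟨a, c, u, v, hac, h⟩
  · left
    refine ⟨a, ?_⟩
    rcases Int.units_eq_one_or u with rfl | rfl
    · rw [h]; push_cast; module
    · have h1 := hpos z
      rw [h, smul_smul, sum_repr_smul, if_pos (hz a)] at h1
      push_cast at h1
      linarith
  · right
    wlog hlt : a < c generalizing a c u v
    · exact this c a v u hac.symm (by rw [h, add_comm]) (lt_of_le_of_ne (not_lt.1 hlt) hac.symm)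
    have hnl : ¬ c ≤ a := not_le.2 hlt
    have h2 := hpos a
    have h1 := hpos z
    rw [h] at h1 h2
    simp only [map_add, map_smul, Finsupp.add_apply, Finsupp.smul_apply, smul_eq_mul,
      Finset.sum_add_distrib, ← Finset.mul_sum, sum_repr_basis, hz, if_true, le_refl, hnl,
      if_false, mul_one, mul_zero, add_zero] at h1 h2
    rcases Int.units_eq_one_or u with rfl | rfl
    · refine ⟨a, c, hlt, ?_⟩
      rcases Int.units_eq_one_or v with rfl | rfl
      · right; rw [h]; push_cast; module
      · left; rw [h]; push_cast; module
    · push_cast at h2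
      linarith

theorem inner_self_smul (H : IsSignedBasis b e κ ε s) (a : Fin p) :
    inner ℝ ((κ : ℝ) • ε a) ((κ : ℝ) • ε a) = κ ^ 2 * s := by
  rw [real_inner_smul_left, real_inner_smul_right, H.inner_eq, if_pos rfl]
  ring

theorem inner_self_sub (H : IsSignedBasis b e κ ε s) {a c : Fin p} (hac : a ≠ c) :
    inner ℝ (ε a - ε c) (ε a - ε c) = 2 * s := by
  simp only [inner_sub_left, inner_sub_right, H.inner_eq, if_true, hac, hac.symm, if_false]
  ring

theorem inner_self_add (H : IsSignedBasis b e κ ε s) {a c : Fin p} (hac : a ≠ c) :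
    inner ℝ (ε a + ε c) (ε a + ε c) = 2 * s := by
  simp only [inner_add_left, inner_add_right, H.inner_eq, if_true, hac, hac.symm, if_false]
  ring

theorem inner_self_root_cases [Finite ι] [P.IsRootSystem] [P.IsCrystallographic] [P.IsReduced]
    (H : IsSignedBasis b e κ ε s) (hinv : IsWeylInvariantInner P) (i : ι) :
    inner ℝ (P.root i) (P.root i) = κ ^ 2 * s ∨ inner ℝ (P.root i) (P.root i) = 2 * s := by
  have hu : ∀ u : ℤˣ, ((u : ℤ) : ℝ) * ((u : ℤ) : ℝ) = 1 := by
    intro u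
    rcases Int.units_eq_one_or u with rfl | rfl <;> norm_num
  rcases H.isSignedVector_root hinv i with ⟨a, u, h⟩ | ⟨a, c, u, v, hac, h⟩
  · left
    rw [h, real_inner_smul_left, real_inner_smul_right, H.inner_self_smul, ← mul_assoc, hu, one_mul]
  · right
    rw [h]
    simp only [inner_add_left, inner_add_right, real_inner_smul_left, real_inner_smul_right,
      H.inner_eq, if_true, hac, hac.symm, if_false]
    linear_combination s * hu u + s * hu v

theorem isShortRoot_iff [Finite ι] [P.IsRootSystem] [P.IsCrystallographic] [P.IsReduced]
    (H : IsSignedBasis b e κ ε s) (hinv : IsWeylInvariantInner P) (i : ι) :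
    IsShortRoot P i ↔ inner ℝ (P.root i) (P.root i) = κ * s := by
  have hs := H.pos
  have hp := H.two_le
  obtain ⟨i₁, h₁⟩ := H.exists_root_smul hinv ⟨0, by omega⟩
  obtain ⟨i₂, h₂⟩ := H.exists_root_sub hinv (a := ⟨0, by omega⟩) (c := ⟨1, by omega⟩)
    (by simp [Fin.lt_def])
  have n₁ := H.inner_self_smul ⟨0, by omega⟩
  have n₂ := H.inner_self_sub (a := ⟨0, by omega⟩) (c := ⟨1, by omega⟩) (by simp [Fin.ext_iff])
  rw [← h₁] at n₁
  rw [← h₂] at n₂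
  unfold IsShortRoot
  simp_rw [norm_le_norm_iff_inner]
  constructor
  · intro h
    have a₁ := h i₁
    have a₂ := h i₂
    rcases H.kappa with rfl | rfl <;>
      rcases H.inner_self_root_cases hinv i with h' | h' <;> push_cast at * <;> nlinarith
  · intro h j
    rcases H.kappa with rfl | rfl <;>
      rcases H.inner_self_root_cases hinv j with h' | h' <;> push_cast at * <;> nlinarith

theorem isLongRoot_iff [Finite ι] [P.IsRootSystem] [P.IsCrystallographic] [P.IsReduced]
    (H : IsSignedBasis b e κ ε s) (hinv : IsWeylInvariantInner P) (i : ι) :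
    IsLongRoot P i ↔ inner ℝ (P.root i) (P.root i) = 2 * κ * s := by
  have hs := H.pos
  have hp := H.two_le
  obtain ⟨i₁, h₁⟩ := H.exists_root_smul hinv ⟨0, by omega⟩
  obtain ⟨i₂, h₂⟩ := H.exists_root_sub hinv (a := ⟨0, by omega⟩) (c := ⟨1, by omega⟩)
    (by simp [Fin.lt_def])
  have n₁ := H.inner_self_smul ⟨0, by omega⟩
  have n₂ := H.inner_self_sub (a := ⟨0, by omega⟩) (c := ⟨1, by omega⟩) (by simp [Fin.ext_iff])
  rw [← h₁] at n₁
  rw [← h₂] at n₂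
  unfold IsLongRoot
  simp_rw [norm_le_norm_iff_inner]
  constructor
  · intro h
    have a₁ := h i₁
    have a₂ := h i₂
    rcases H.kappa with rfl | rfl <;>
      rcases H.inner_self_root_cases hinv i with h' | h' <;> push_cast at * <;> nlinarith
  · intro h j
    rcases H.kappa with rfl | rfl <;>
      rcases H.inner_self_root_cases hinv j with h' | h' <;> push_cast at * <;> nlinarith

end IsSignedBasis

end SignedBasis

/-! ### The Weyl group and its exponents in types `B` and `C` -/

section SignedWeyl

variable {ι V N : Type*} [NormedAddCommGroup V] [InnerProductSpace ℝ V]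
  [AddCommGroup N] [Module ℝ N] {P : RootPairing ι ℝ V N} {p : ℕ}

namespace IsSignedBasis

variable {b : P.Base} {e : Fin p ≃ b.support} {κ : ℕ} {ε : Module.Basis (Fin p) ℝ V} {s : ℝ}

theorem units_mul_self_real (u : ℤˣ) : ((u : ℤ) : ℝ) * ((u : ℤ) : ℝ) = 1 := by
  rcases Int.units_eq_one_or u with rfl | rfl <;> norm_num

theorem exists_perm_sign [Finite ι] [P.IsRootSystem] [P.IsCrystallographic] [P.IsReduced]
    (H : IsSignedBasis b e κ ε s) (hinv : IsWeylInvariantInner P) (w : P.weylGroup) :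
    ∃ (σ : Equiv.Perm (Fin p)) (t : Fin p → ℤˣ),
      ∀ d, w • ε d = ((t d : ℤ) : ℝ) • ε (σ d) := by
  have hs := H.pos
  have h1 : ∀ d, ∃ (a : Fin p) (u : ℤˣ), w • ε d = ((u : ℤ) : ℝ) • ε a := by
    intro d
    obtain ⟨i, hi⟩ := H.exists_root_smul hinv d
    have hw : w • ((κ : ℝ) • ε d) = P.root (P.weylGroupToPerm w i) := by
      rw [← hi, P.weylGroup_apply_root]
    rcases H.isSignedVector_root hinv (P.weylGroupToPerm w i) with
      ⟨a, u, h⟩ | ⟨a, c, u, v, hac, h⟩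
    · refine ⟨a, u, ?_⟩
      rw [h, weylGroup_smul_smul, smul_comm ((u : ℤ) : ℝ) (κ : ℝ) (ε a)] at hw
      exact smul_right_injective V H.kappa_ne_zero hw
    · -- a root of the other length
      exfalso
      have h2 := inner_weylGroup_smul hinv w ((κ : ℝ) • ε d) ((κ : ℝ) • ε d)
      rw [hw, h, H.inner_self_smul] at h2
      simp only [inner_add_left, inner_add_right, real_inner_smul_left, real_inner_smul_right,
        H.inner_eq, if_true, hac, hac.symm, if_false, mul_zero, add_zero, zero_add,
        ← mul_assoc, units_mul_self_real] at h2
      rcases H.kappa with rfl | rfl <;> push_cast at h2 <;> nlinarith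
  choose a u hau using h1
  have hinj : Function.Injective a := by
    intro d d' hdd
    by_contra hne
    have h2 := inner_weylGroup_smul hinv w (ε d) (ε d')
    rw [hau, hau, hdd, real_inner_smul_left, real_inner_smul_right, H.inner_eq, H.inner_eq,
      if_pos rfl, if_neg hne] at h2
    simp [hs.ne'] at h2
  exact ⟨Equiv.ofBijective a (Finite.injective_iff_bijective.1 hinj), u, hau⟩

theorem exists_weyl_swap (H : IsSignedBasis b e κ ε s) (hinv : IsWeylInvariantInner P)
    {a c : Fin p} (hac : a ≠ c) : ∃ w : P.weylGroup, ∀ d, w • ε d = ε (Equiv.swap a c d) := by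
  wlog hlt : a < c generalizing a c
  · obtain ⟨w, hw⟩ := this hac.symm (lt_of_le_of_ne (not_lt.1 hlt) hac.symm)
    exact ⟨w, fun d => by rw [hw, Equiv.swap_comm]⟩
  obtain ⟨i, hi⟩ := H.exists_root_sub hinv hlt
  refine ⟨RootPairing.weylGroup.ofIdx P i, fun d => ?_⟩
  rw [RootPairing.weylGroup.ofIdx_smul, RootPairing.Equiv.reflection_smul]
  exact H.reflection_of_sub hinv hac hi d

theorem exists_weyl_perm (H : IsSignedBasis b e κ ε s) (hinv : IsWeylInvariantInner P)
    (σ : Equiv.Perm (Fin p)) : ∃ w : P.weylGroup, ∀ d, w • ε d = ε (σ d) := by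
  induction σ using Equiv.Perm.swap_induction_on with
  | one => exact ⟨1, fun d => by rw [one_smul]; rfl⟩
  | swap_mul f x y hxy ih =>
    obtain ⟨w, hw⟩ := ih
    obtain ⟨w', hw'⟩ := H.exists_weyl_swap hinv hxy
    exact ⟨w' * w, fun d => by rw [mul_smul, hw, hw']; rfl⟩

theorem exists_weyl_sign (H : IsSignedBasis b e κ ε s) (hinv : IsWeylInvariantInner P)
    (F : Finset (Fin p)) :
    ∃ w : P.weylGroup, ∀ d, w • ε d = if d ∈ F then -ε d else ε d := by
  induction F using Finset.induction_on with
  | empty => exact ⟨1, fun d => by simp⟩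
  | insert a F ha ih =>
    obtain ⟨w, hw⟩ := ih
    obtain ⟨i, hi⟩ := H.exists_root_smul hinv a
    refine ⟨RootPairing.weylGroup.ofIdx P i * w, fun d => ?_⟩
    rw [mul_smul, hw, RootPairing.weylGroup.ofIdx_smul, RootPairing.Equiv.reflection_smul]
    have hr := H.reflection_of_smul hinv hi d
    by_cases hda : d = a
    · subst hda
      rw [if_neg ha, hr, if_pos rfl, if_pos (Finset.mem_insert_self _ _)]
    · rw [if_neg hda] at hr
      simp only [Finset.mem_insert, hda, false_or]
      split_ifs
      · rw [map_neg, hr]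
      · exact hr

/-- The Weyl group is the group of signed permutations of the vectors `ε_a`. -/
theorem card_weylGroup [Finite ι] [P.IsRootSystem] [P.IsCrystallographic] [P.IsReduced]
    (H : IsSignedBasis b e κ ε s) (hinv : IsWeylInvariantInner P) :
    Nat.card P.weylGroup = 2 ^ p * p.factorial := by
  choose σ t hst using H.exists_perm_sign hinv
  have hbij : Function.Bijective fun w : P.weylGroup => (t w, σ w) := by
    constructor
    · intro w w' h
      refine weylGroup_eq_of_smul_basis ε fun d => ?_
      have h1 : t w = t w' := congrArg Prod.fst h
      have h2 : σ w = σ w' := congrArg Prod.snd h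
      rw [hst, hst, h1, h2]
    · rintro ⟨t', σ'⟩
      obtain ⟨w₁, h₁⟩ := H.exists_weyl_perm hinv σ'
      obtain ⟨w₂, h₂⟩ := H.exists_weyl_sign hinv (Finset.univ.filter fun d => t' d = -1)
      have h₃ : ∀ d, (w₁ * w₂) • ε d = ((t' d : ℤ) : ℝ) • ε (σ' d) := by
        intro d
        rw [mul_smul, h₂]
        rcases Int.units_eq_one_or (t' d) with h | h
        · simp [h, h₁]
        · simp [h, smul_neg, h₁]
      have h₄ : ∀ d, t (w₁ * w₂) d = t' d ∧ σ (w₁ * w₂) d = σ' d := by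
        intro d
        have h₅ := hst (w₁ * w₂) d
        rw [h₃] at h₅
        have hσ : σ (w₁ * w₂) d = σ' d := by
          by_contra hne
          have h₆ := congrArg (fun x => inner ℝ x (ε (σ' d))) h₅
          simp only [real_inner_smul_left, H.inner_eq, if_true, hne, if_false] at h₆
          simp [H.pos.ne'] at h₆
        refine ⟨?_, hσ⟩
        rw [hσ] at h₅
        have h₆ := smul_left_injective ℝ (ε.ne_zero (σ' d)) h₅
        exact (Units.ext (by exact_mod_cast h₆)).symm
      exact ⟨w₁ * w₂, Prod.ext (funext fun d => (h₄ d).1) (Equiv.ext fun d => (h₄ d).2)⟩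
  rw [Nat.card_congr (Equiv.ofBijective _ hbij)]
  simp [Nat.card_eq_fintype_card, Fintype.card_perm]

/-- The product of the simple reflections from the `k`-th on fixes `ε d` for `d < k`, and otherwise
sends `ε d` to `ε (d + 1)` and the last vector to `-ε k`. -/
theorem drop_coxeter_apply (H : IsSignedBasis b e κ ε s) (hinv : IsWeylInvariantInner P) :
    ∀ (n k : ℕ), k + n = p → ∀ d : Fin p,
      ((d : ℕ) < k →
        ((List.ofFn fun i : Fin p => P.reflection (e i : ι)).drop k).prod (ε d) = ε d) ∧
      (k ≤ d → ∀ j : Fin p, (d : ℕ) + 1 = j →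
        ((List.ofFn fun i : Fin p => P.reflection (e i : ι)).drop k).prod (ε d) = ε j) ∧
      (k ≤ d → (d : ℕ) + 1 = p → ∀ j : Fin p, (j : ℕ) = k →
        ((List.ofFn fun i : Fin p => P.reflection (e i : ι)).drop k).prod (ε d) = -ε j) := by
  intro n
  induction n with
  | zero =>
    intro k hk d
    have := d.2
    refine ⟨fun _ => ?_, fun h => by omega, fun h => by omega⟩
    rw [List.drop_eq_nil_of_le (by simp; omega)]
    rfl
  | succ n ih =>
    intro k hk d
    have hkp : k < p := by omega
    have hd := d.2
    obtain ⟨i1, i2, i3⟩ := ih (k + 1) (by omega) d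
    rw [List.drop_eq_getElem_cons (by simpa using hkp), List.getElem_ofFn, List.prod_cons]
    simp only [LinearEquiv.mul_apply]
    rcases H.simple_cases ⟨k, hkp⟩ with ⟨k', hk', hr⟩ | ⟨hk', hr⟩
    · have hk'' : (k' : ℕ) = k + 1 := hk'.symm
      have hne : (⟨k, hkp⟩ : Fin p) ≠ k' := by intro h; have := congrArg Fin.val h; simp at this; omega
      have hrefl := H.reflection_of_sub hinv hne hr
      refine ⟨fun h => ?_, fun h j hj => ?_, fun h hdp j hj => ?_⟩
      · rw [i1 (by omega), hrefl, Equiv.swap_apply_of_ne_of_ne]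
        · rintro rfl; simp at h
        · rintro rfl; omega
      · rcases h.eq_or_lt with h | h
        · have hdk : d = ⟨k, hkp⟩ := Fin.ext h.symm
          rw [i1 (by omega), hrefl, hdk, Equiv.swap_apply_left]
          congr 1
          exact Fin.ext (by omega)
        · rw [i2 (by omega) j hj, hrefl, Equiv.swap_apply_of_ne_of_ne]
          · rintro rfl; simp at hj; omega
          · rintro rfl; omega
      · have h' := k'.2
        rw [i3 (by omega) hdp k' hk'', map_neg, hrefl, Equiv.swap_apply_right]
        congr 2
        exact Fin.ext hj.symm
    · have hrefl := H.reflection_of_smul hinv hr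
      simp only at hk'
      refine ⟨fun h => ?_, fun h j hj => ?_, fun h hdp j hj => ?_⟩
      · rw [i1 (by omega), hrefl, if_neg]
        rintro rfl; simp at h
      · have := j.2
        omega
      · have hdk : d = ⟨k, hkp⟩ := Fin.ext (by simp; omega)
        have hjk : j = ⟨k, hkp⟩ := Fin.ext hj
        rw [i1 (by omega), hrefl, if_pos hdk, hdk, hjk]

theorem coxeter_pow_apply_zero (H : IsSignedBasis b e κ ε s) (hinv : IsWeylInvariantInner P) :
    ∀ (k : ℕ) (hk : k < p),
      ((coxeterElement b e) ^ k) (ε ⟨0, by omega⟩) = ε ⟨k, hk⟩ := by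
  intro k
  induction k with
  | zero => intro _; rfl
  | succ k ih =>
    intro hk
    rw [pow_succ', LinearEquiv.mul_apply, ih (by omega)]
    exact (H.drop_coxeter_apply hinv p 0 (by omega) ⟨k, by omega⟩).2.1 (by omega) ⟨k + 1, hk⟩ rfl

theorem coxeter_pow_eq_neg (H : IsSignedBasis b e κ ε s) (hinv : IsWeylInvariantInner P) :
    (coxeterElement b e) ^ p = LinearEquiv.neg ℝ := by
  have hp := H.two_le
  have h0 : ((coxeterElement b e) ^ p) (ε ⟨0, by omega⟩) = -ε ⟨0, by omega⟩ := by
    obtain ⟨n, hn⟩ : ∃ n, p = n + 1 := ⟨p - 1, by omega⟩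
    have h1 := H.coxeter_pow_apply_zero hinv n (by omega)
    have h2 : (coxeterElement b e) ^ p = coxeterElement b e * (coxeterElement b e) ^ n := by
      rw [← pow_succ', ← hn]
    rw [h2, LinearEquiv.mul_apply, h1]
    exact (H.drop_coxeter_apply hinv p 0 (by omega) ⟨n, by omega⟩).2.2 (by omega) hn.symm
      ⟨0, by omega⟩ rfl
  refine LinearEquiv.toLinearMap_injective (ε.ext fun d => ?_)
  have hd := H.coxeter_pow_apply_zero hinv d d.2
  change ((coxeterElement b e) ^ p) (ε d) = -ε d
  rw [← hd, ← LinearEquiv.mul_apply, ← pow_add, add_comm, pow_add, LinearEquiv.mul_apply, h0,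
    map_neg]

theorem orderOf_coxeter (H : IsSignedBasis b e κ ε s) (hinv : IsWeylInvariantInner P) :
    orderOf (coxeterElement b e) = 2 * p := by
  have hp := H.two_le
  rw [orderOf_eq_iff (by omega)]
  constructor
  · rw [mul_comm, pow_mul, H.coxeter_pow_eq_neg hinv]
    ext x
    simp [pow_two]
  · intro m hm hm0 h1
    have h2 := congrArg (fun f : V ≃ₗ[ℝ] V => inner ℝ (f (ε ⟨0, by omega⟩)) (ε ⟨0, by omega⟩)) h1
    change inner ℝ ((coxeterElement b e ^ m) (ε _)) (ε _) = inner ℝ (ε _) (ε _) at h2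
    have hs := H.pos
    rcases Nat.lt_or_ge m p with h | h
    · rw [H.coxeter_pow_apply_zero hinv m h, H.inner_eq, H.inner_eq, if_pos rfl, if_neg] at h2
      · exact hs.ne h2
      · simp [Fin.ext_iff]; omega
    · obtain ⟨r, rfl⟩ : ∃ r, m = p + r := ⟨m - p, by omega⟩
      rw [pow_add, LinearEquiv.mul_apply, H.coxeter_pow_apply_zero hinv r (by omega),
        H.coxeter_pow_eq_neg hinv, LinearEquiv.neg_apply, inner_neg_left, H.inner_eq,
        H.inner_eq, if_pos rfl] at h2
      split_ifs at h2 <;> linarith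

/-- The vector `ε 0` is cyclic for the Coxeter element `c`, and `c ^ p = -1`. -/
theorem charpoly_coxeter [FiniteDimensional ℝ V] (H : IsSignedBasis b e κ ε s)
    (hinv : IsWeylInvariantInner P) :
    (coxeterElement b e : V →ₗ[ℝ] V).charpoly = X ^ p + 1 := by
  have hp := H.two_le
  set f : V →ₗ[ℝ] V := (coxeterElement b e : V →ₗ[ℝ] V) with hf
  have hpow : ∀ (k : ℕ) (x : V), (f ^ k) x = ((coxeterElement b e) ^ k) x := by
    intro k
    induction k with
    | zero => intro x; rfl
    | succ k ih => intro x; rw [pow_succ, pow_succ, Module.End.mul_apply, ih]; rfl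
  have hdeg : f.charpoly.natDegree = p := by
    rw [LinearMap.charpoly_natDegree, Module.finrank_eq_card_basis ε, Fintype.card_fin]
  have hmonic := f.charpoly_monic
  set D : ℝ[X] := X ^ p + 1 - f.charpoly with hD
  have hDdeg : D.degree < p := by
    have h1 : (X ^ p + 1 : ℝ[X]).degree = p := by
      rw [← C_1]; exact degree_X_pow_add_C (by omega) 1
    have h2 : f.charpoly.degree = p := by
      rw [degree_eq_natDegree hmonic.ne_zero, hdeg]
    rw [← h1]
    refine degree_sub_lt_left (h1.trans h2.symm) (fun h => by rw [h] at h1; simp at h1) ?_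
    rw [hmonic.leadingCoeff, ← C_1, leadingCoeff_X_pow_add_C (by omega)]
  have hD0 : aeval f D = 0 := by
    have h3 : f ^ p = -1 := by
      ext x
      rw [hpow, H.coxeter_pow_eq_neg hinv]; rfl
    rw [hD, map_sub, LinearMap.aeval_self_charpoly, map_add, map_pow, aeval_X, map_one, h3]
    simp
  have hDzero : D = 0 := by
    by_contra hne
    have hnat : D.natDegree < p := (natDegree_lt_iff_degree_lt hne).2 hDdeg
    have h4 := congrArg (fun g : V →ₗ[ℝ] V => g (ε ⟨0, by omega⟩)) hD0
    simp only [aeval_eq_sum_range' hnat, LinearMap.sum_apply, LinearMap.smul_apply,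
      LinearMap.zero_apply] at h4
    rw [← Fin.sum_univ_eq_sum_range (fun k => D.coeff k • (f ^ k) (ε ⟨0, by omega⟩)) p] at h4
    have h5 : ∀ k : Fin p, (f ^ (k : ℕ)) (ε ⟨0, by omega⟩) = ε k := fun k => by
      rw [hpow, H.coxeter_pow_apply_zero hinv k k.2]
    simp_rw [h5] at h4
    have h6 := Fintype.linearIndependent_iff.1 ε.linearIndependent _ h4
    refine hne (Polynomial.ext fun n => ?_)
    rcases Nat.lt_or_ge n p with h | h
    · exact h6 ⟨n, h⟩
    · rw [coeff_eq_zero_of_natDegree_lt (by omega), coeff_zero]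
  rw [hD, sub_eq_zero] at hDzero
  exact hDzero.symm

theorem sum_replicate_odd (p : ℕ) :
    ∑ k ∈ Finset.range (2 * p), Multiset.replicate (if Odd k then 1 else 0) k =
      (Multiset.range p).map fun k => 2 * k + 1 := by
  induction p with
  | zero => simp
  | succ p ih =>
    rw [mul_add, mul_one, Finset.sum_range_succ, Finset.sum_range_succ, ih, if_neg (by simp),
      if_pos (by simp), Multiset.range_succ, Multiset.map_cons, Multiset.replicate_zero, add_zero,
      Multiset.replicate_one, add_comm, Multiset.singleton_add]

theorem weylExponents_eq [FiniteDimensional ℝ V] (H : IsSignedBasis b e κ ε s)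
    (hinv : IsWeylInvariantInner P) :
    weylExponents b e = (Multiset.range p).map fun k => 2 * k + 1 := by
  have hp := H.two_le
  rw [weylExponents, H.orderOf_coxeter hinv, H.charpoly_coxeter hinv, ← sum_replicate_odd]
  refine Finset.sum_congr rfl fun k _ => ?_
  congr 1
  have hpol : (X ^ p + 1 : ℝ[X]).map (algebraMap ℝ ℂ) = X ^ p - C (-1) := by simp
  rw [hpol]
  set ζ : ℂ := Complex.exp (2 * Real.pi * Complex.I * k / (2 * p : ℕ)) with hζ
  have hpow : ζ ^ p = (-1) ^ k := by
    rw [hζ, ← Complex.exp_nat_mul]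
    have : (p : ℂ) * (2 * Real.pi * Complex.I * k / (2 * p : ℕ)) = k * (Real.pi * Complex.I) := by
      have : (p : ℂ) ≠ 0 := by exact_mod_cast (by omega : p ≠ 0)
      push_cast
      field_simp
    rw [this, Complex.exp_nat_mul, Complex.exp_pi_mul_I]
  have hsep : (X ^ p - C (-1) : ℂ[X]).Separable :=
    separable_X_pow_sub_C (-1) (by exact_mod_cast (by omega : p ≠ 0)) (by norm_num)
  split_ifs with hk
  · refine le_antisymm (rootMultiplicity_le_one_of_separable hsep _) ?_
    rw [Nat.one_le_iff_ne_zero, ← Nat.pos_iff_ne_zero, rootMultiplicity_pos hsep.ne_zero]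
    simp [IsRoot, hpow, hk.neg_one_pow]
  · refine rootMultiplicity_eq_zero ?_
    rw [Nat.not_odd_iff_even] at hk
    simp [IsRoot, hpow, hk.neg_one_pow]

end IsSignedBasis

end SignedWeyl

/-! ### Characteristic polynomials in types `B` and `C` -/

section SignedCharpoly

variable {ι V N : Type*} [NormedAddCommGroup V] [InnerProductSpace ℝ V]
  [AddCommGroup N] [Module ℝ N] {P : RootPairing ι ℝ V N} {p : ℕ}

/-- The forms `k y_a`. -/
def axisForms (p : ℕ) (k : ℤ) : Finset (Fin p → ℤ) := Finset.univ.image fun a => Pi.single a k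

/-- The forms `y_a - y_c` and `y_a + y_c` for `a < c`. -/
def pairForms (p : ℕ) : Finset (Fin p → ℤ) :=
  ((Finset.univ.filter fun x : Fin p × Fin p => x.1 < x.2).image
      fun x => Pi.single x.1 1 - Pi.single x.2 1) ∪
    (Finset.univ.filter fun x : Fin p × Fin p => x.1 < x.2).image
      fun x => Pi.single x.1 1 + Pi.single x.2 1

theorem exists_mem_axisForms {k : ℤ} {r : (Fin p → ℤ) → Prop} :
    (∃ v ∈ axisForms p k, r v) ↔ ∃ a, r (Pi.single a k) := by
  simp [axisForms]

theorem exists_mem_pairForms {r : (Fin p → ℤ) → Prop} :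
    (∃ v ∈ pairForms p, r v) ↔ ∃ a c, a < c ∧
      (r (Pi.single a 1 - Pi.single c 1) ∨ r (Pi.single a 1 + Pi.single c 1)) := by
  simp only [pairForms, Finset.mem_union, Finset.mem_image, Finset.mem_filter, Finset.mem_univ,
    true_and, Prod.exists]
  constructor
  · rintro ⟨v, ⟨a, c, h, rfl⟩ | ⟨a, c, h, rfl⟩, hr⟩
    · exact ⟨a, c, h, Or.inl hr⟩
    · exact ⟨a, c, h, Or.inr hr⟩
  · rintro ⟨a, c, h, hr | hr⟩
    · exact ⟨_, Or.inl ⟨a, c, h, rfl⟩, hr⟩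
    · exact ⟨_, Or.inr ⟨a, c, h, rfl⟩, hr⟩

theorem forall_mem_axisForms {k : ℤ} {r : (Fin p → ℤ) → Prop} :
    (∀ v ∈ axisForms p k, r v) ↔ ∀ a, r (Pi.single a k) := by
  simp [axisForms]

theorem forall_mem_pairForms {r : (Fin p → ℤ) → Prop} :
    (∀ v ∈ pairForms p, r v) ↔ ∀ a c, a < c →
      r (Pi.single a 1 - Pi.single c 1) ∧ r (Pi.single a 1 + Pi.single c 1) := by
  have h := exists_mem_pairForms (p := p) (r := fun v => ¬ r v)
  rw [← not_iff_not]
  push Not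
  rw [h]
  refine exists_congr fun a => exists_congr fun c => and_congr_right fun _ => ?_
  rw [← not_and_or]
  tauto

theorem intComb_single (β : Fin p → V) (a : Fin p) (k : ℤ) :
    intComb β (Pi.single a k) = (k : ℝ) • β a := by
  rw [intComb, Finset.sum_eq_single a]
  · simp
  · intro c _ h; simp [h]
  · simp

theorem intComb_add (β : Fin p → V) (v w : Fin p → ℤ) :
    intComb β (v + w) = intComb β v + intComb β w := by
  simp [intComb, add_smul, Finset.sum_add_distrib]

theorem intComb_sub (β : Fin p → V) (v w : Fin p → ℤ) :
    intComb β (v - w) = intComb β v - intComb β w := by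
  simp [intComb, sub_smul, Finset.sum_sub_distrib]

theorem evalForm_single {K : Type*} [CommRing K] (y : Fin p → K) (a : Fin p) (k : ℤ) :
    evalForm (Pi.single a k) y = k * y a := by
  rw [evalForm, Finset.sum_eq_single a]
  · simp
  · intro c _ h; simp [h]
  · simp

theorem evalForm_add {K : Type*} [CommRing K] (y : Fin p → K) (v w : Fin p → ℤ) :
    evalForm (v + w) y = evalForm v y + evalForm w y := by
  simp [evalForm, add_mul, Finset.sum_add_distrib]

theorem evalForm_sub {K : Type*} [CommRing K] (y : Fin p → K) (v w : Fin p → ℤ) :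
    evalForm (v - w) y = evalForm v y - evalForm w y := by
  simp [evalForm, sub_mul, Finset.sum_sub_distrib]

namespace IsSignedBasis

variable {b : P.Base} {e : Fin p ≃ b.support} {κ : ℕ} {ε : Module.Basis (Fin p) ℝ V} {s : ℝ}

theorem exists_pair_root_iff (H : IsSignedBasis b e κ ε s) (hinv : IsWeylInvariantInner P) (x : V) :
    (∃ i, (∃ a c, a < c ∧ (P.root i = ε a - ε c ∨ P.root i = ε a + ε c)) ∧ P.root i = x) ↔
      ∃ v ∈ pairForms p, intComb ε v = x := by
  rw [exists_mem_pairForms]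
  simp only [intComb_add, intComb_sub, intComb_single, Int.cast_one, one_smul]
  constructor
  · rintro ⟨i, ⟨a, c, hac, h⟩, rfl⟩
    exact ⟨a, c, hac, h.imp Eq.symm Eq.symm⟩
  · rintro ⟨a, c, hac, rfl | rfl⟩
    · obtain ⟨i, hi⟩ := H.exists_root_sub hinv hac
      exact ⟨i, ⟨a, c, hac, Or.inl hi⟩, hi⟩
    · obtain ⟨i, hi⟩ := H.exists_root_add hinv hac
      exact ⟨i, ⟨a, c, hac, Or.inr hi⟩, hi⟩

section

variable [Finite ι] [P.IsRootSystem] [P.IsCrystallographic] [P.IsReduced]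

theorem isShortPos_iff_axis (H : IsSignedBasis b e 1 ε s) (hinv : IsWeylInvariantInner P) (i : ι) :
    IsShortPos b i ↔ ∃ a, P.root i = ε a := by
  have hs := H.pos
  rw [IsShortPos, H.isShortRoot_iff hinv]
  constructor
  · rintro ⟨hi, hn⟩
    rcases H.isPos_cases hinv hi with ⟨a, h⟩ | ⟨a, c, hac, h | h⟩
    · exact ⟨a, by simpa using h⟩
    · rw [h, H.inner_self_sub hac.ne] at hn; push_cast at hn; linarith
    · rw [h, H.inner_self_add hac.ne] at hn; push_cast at hn; linarith
  · rintro ⟨a, h⟩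
    have h' : P.root i = ((1 : ℕ) : ℝ) • ε a := by simpa using h
    refine ⟨H.isPos_of_smul h', ?_⟩
    rw [h', H.inner_self_smul]; push_cast; ring

theorem isLongPos_iff_pair (H : IsSignedBasis b e 1 ε s) (hinv : IsWeylInvariantInner P) (i : ι) :
    (b.IsPos i ∧ IsLongRoot P i) ↔
      ∃ a c, a < c ∧ (P.root i = ε a - ε c ∨ P.root i = ε a + ε c) := by
  have hs := H.pos
  rw [H.isLongRoot_iff hinv]
  constructor
  · rintro ⟨hi, hn⟩
    rcases H.isPos_cases hinv hi with ⟨a, h⟩ | h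
    · rw [h, H.inner_self_smul] at hn; push_cast at hn; linarith
    · exact h
  · rintro ⟨a, c, hac, h | h⟩
    · refine ⟨H.isPos_of_sub hac h, ?_⟩
      rw [h, H.inner_self_sub hac.ne]; push_cast; ring
    · refine ⟨H.isPos_of_add h, ?_⟩
      rw [h, H.inner_self_add hac.ne]; push_cast; ring

theorem isShortPos_iff_pair (H : IsSignedBasis b e 2 ε s) (hinv : IsWeylInvariantInner P) (i : ι) :
    IsShortPos b i ↔ ∃ a c, a < c ∧ (P.root i = ε a - ε c ∨ P.root i = ε a + ε c) := by
  have hs := H.pos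
  rw [IsShortPos, H.isShortRoot_iff hinv]
  constructor
  · rintro ⟨hi, hn⟩
    rcases H.isPos_cases hinv hi with ⟨a, h⟩ | h
    · rw [h, H.inner_self_smul] at hn; push_cast at hn; linarith
    · exact h
  · rintro ⟨a, c, hac, h | h⟩
    · refine ⟨H.isPos_of_sub hac h, ?_⟩
      rw [h, H.inner_self_sub hac.ne]; push_cast; ring
    · refine ⟨H.isPos_of_add h, ?_⟩
      rw [h, H.inner_self_add hac.ne]; push_cast; ring

theorem isLongPos_iff_axis (H : IsSignedBasis b e 2 ε s) (hinv : IsWeylInvariantInner P) (i : ι) :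
    (b.IsPos i ∧ IsLongRoot P i) ↔ ∃ a, P.root i = (2 : ℝ) • ε a := by
  have hs := H.pos
  rw [H.isLongRoot_iff hinv]
  constructor
  · rintro ⟨hi, hn⟩
    rcases H.isPos_cases hinv hi with ⟨a, h⟩ | ⟨a, c, hac, h | h⟩
    · exact ⟨a, by simpa using h⟩
    · rw [h, H.inner_self_sub hac.ne] at hn; push_cast at hn; linarith
    · rw [h, H.inner_self_add hac.ne] at hn; push_cast at hn; linarith
  · rintro ⟨a, h⟩
    have h' : P.root i = ((2 : ℕ) : ℝ) • ε a := by simpa using h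
    refine ⟨H.isPos_of_smul h', ?_⟩
    rw [h', H.inner_self_smul]; push_cast; ring

theorem isRootModel_one (H : IsSignedBasis b e 1 ε s) (hinv : IsWeylInvariantInner P) :
    IsRootModel b ε (axisForms p 1) (pairForms p) := by
  constructor
  · intro x
    simp only [H.isShortPos_iff_axis hinv, exists_mem_axisForms, intComb_single, Int.cast_one,
      one_smul]
    constructor
    · rintro ⟨i, ⟨a, h⟩, rfl⟩
      exact ⟨a, h.symm⟩
    · rintro ⟨a, rfl⟩
      obtain ⟨i, hi⟩ := H.exists_root_smul hinv a
      rw [Nat.cast_one, one_smul] at hi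
      exact ⟨i, ⟨a, hi⟩, hi⟩
  · intro x
    simp only [H.isLongPos_iff_pair hinv]
    exact H.exists_pair_root_iff hinv x

theorem isRootModel_two (H : IsSignedBasis b e 2 ε s) (hinv : IsWeylInvariantInner P) :
    IsRootModel b ε (pairForms p) (axisForms p 2) := by
  constructor
  · intro x
    simp only [H.isShortPos_iff_pair hinv]
    exact H.exists_pair_root_iff hinv x
  · intro x
    simp only [H.isLongPos_iff_axis hinv, exists_mem_axisForms, intComb_single]
    constructor
    · rintro ⟨i, ⟨a, h⟩, rfl⟩
      exact ⟨a, by rw [h]; norm_num⟩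
    · rintro ⟨a, rfl⟩
      obtain ⟨i, hi⟩ := H.exists_root_smul hinv a
      exact ⟨i, ⟨a, by simpa using hi⟩, by simpa using hi⟩

end

end IsSignedBasis

/-- Two integers that represent the same residue differ by a multiple of the modulus. -/
theorem exists_eq_add_mul_of_cast_eq {q : ℕ} {x y : ℤ} (h : (x : ZMod q) = y) :
    ∃ t : ℤ, x = y + q * t := by
  obtain ⟨t, ht⟩ := (ZMod.intCast_eq_intCast_iff_dvd_sub y x q).1 h.symm
  exact ⟨t, by linarith⟩

theorem abs_valMinAbs_le {M : ℕ} [NeZero (2 * M + 1)] (y : ZMod (2 * M + 1)) :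
    y.valMinAbs.natAbs ≤ M := by
  have := ZMod.natAbs_valMinAbs_le y
  omega

theorem eq_zero_of_abs_lt_of_eq_mul {q x t : ℤ} (hq : |x| < q) (h : x = q * t) : x = 0 :=
  Int.eq_zero_of_abs_lt_dvd ⟨t, h⟩ hq

theorem ne_intCast_iff {M m : ℕ} (hm : m ≤ M) [NeZero (2 * M + 1)] (y : ZMod (2 * M + 1)) :
    (∀ k ∈ Finset.Icc (-(m : ℤ)) m, y ≠ k) ↔ m < y.valMinAbs.natAbs := by
  have hb := abs_valMinAbs_le y
  constructor
  · intro h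
    by_contra hlt
    exact h y.valMinAbs (Finset.mem_Icc.2 ⟨by omega, by omega⟩) (ZMod.coe_valMinAbs y).symm
  · intro h k hk hyk
    rw [Finset.mem_Icc] at hk
    rw [← ZMod.coe_valMinAbs y] at hyk
    obtain ⟨t, ht⟩ := exists_eq_add_mul_of_cast_eq hyk
    have := eq_zero_of_abs_lt_of_eq_mul (x := y.valMinAbs - k) (q := ((2 * M + 1 : ℕ) : ℤ)) (t := t)
      (by rw [abs_lt]; omega) (by linarith)
    omega

/-- Modulo `2 M + 1` with `m ≤ M`, the difference and the sum of two residues both have absolute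
value more than `m` exactly when their absolute values are more than `m` apart: if a sum wraps
around, both absolute values exceed `M - m`, hence are close to each other. -/
theorem spaced_iff {M m : ℕ} [NeZero (2 * M + 1)] (y z : ZMod (2 * M + 1)) :
    (∀ k ∈ Finset.Icc (-(m : ℤ)) m, y - z ≠ k ∧ y + z ≠ k) ↔
      y.valMinAbs.natAbs + m < z.valMinAbs.natAbs ∨
        z.valMinAbs.natAbs + m < y.valMinAbs.natAbs := by
  have hy := abs_valMinAbs_le y
  have hz := abs_valMinAbs_le z
  have hy' := ZMod.coe_valMinAbs y
  have hz' := ZMod.coe_valMinAbs z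
  set u := y.valMinAbs
  set v := z.valMinAbs
  constructor
  · intro h
    by_contra hlt
    by_cases hc : |u - v| ≤ m
    · rw [abs_le] at hc
      refine (h (u - v) (Finset.mem_Icc.2 hc)).1 ?_
      rw [Int.cast_sub, hy', hz']
    · refine (h (u + v) (Finset.mem_Icc.2 ?_)).2 ?_
      · rw [abs_le] at hc
        omega
      · rw [Int.cast_add, hy', hz']
  · intro h k hk
    rw [Finset.mem_Icc] at hk
    have key : ∀ t : ℤ, (2 * M + 1 : ℤ) * t ≤ 3 * M → -(3 * M : ℤ) ≤ (2 * M + 1 : ℤ) * t →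
        t = -1 ∨ t = 0 ∨ t = 1 := by
      intro t h1 h2
      have : t < 2 := by nlinarith
      have : -2 < t := by nlinarith
      omega
    constructor
    · intro hk'
      rw [← hy', ← hz', ← Int.cast_sub] at hk'
      obtain ⟨t, ht⟩ := exists_eq_add_mul_of_cast_eq hk'
      push_cast at ht
      rcases key t (by omega) (by omega) with rfl | rfl | rfl <;> omega
    · intro hk'
      rw [← hy', ← hz', ← Int.cast_add] at hk'
      obtain ⟨t, ht⟩ := exists_eq_add_mul_of_cast_eq hk'
      push_cast at ht
      rcases key t (by omega) (by omega) with rfl | rfl | rfl <;> omega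

theorem avoidCount_axis_pair (m M : ℕ) (hm : m ≤ M) [NeZero (2 * M + 1)] :
    avoidCount (axisForms p 1) (pairForms p) m (2 * M + 1) = 2 ^ p * (M - m).descFactorial p := by
  classical
  rw [← card_injective_placements]
  convert card_filter_natAbs_valMinAbs (p := p) M
    (fun a => (∀ i, m < a i) ∧ ∀ i j, i ≠ j → a i ≠ a j) using 1
  swap
  · congr! 2
    ext a
    simp only [Finset.mem_filter]
  rw [avoidCount]
  congr 1
  ext y
  have h0 := fun i => ne_intCast_iff (m := 0) (Nat.zero_le M) (y i)
  have h1 := fun i => ne_intCast_iff hm (y i)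
  have h2 := fun i j => spaced_iff (m := 0) (y i) (y j)
  simp only [Nat.cast_zero, neg_zero, Finset.Icc_self, Finset.mem_singleton, forall_eq,
    Int.cast_zero, add_zero] at h0 h2
  simp only [Finset.mem_filter, Finset.mem_univ, true_and, forall_mem_axisForms,
    forall_mem_pairForms, evalForm_single, evalForm_add, evalForm_sub, Int.cast_one, one_mul, h1,
    h0]
  constructor
  · rintro ⟨ha, hp⟩
    refine ⟨fun i => lt_of_le_of_lt (Nat.zero_le _) (ha i), ha, fun i j hij h => ?_⟩
    rcases lt_or_gt_of_ne hij with hlt | hlt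
    · have := (h2 i j).1 (hp i j hlt); omega
    · have := (h2 j i).1 (hp j i hlt); omega
  · rintro ⟨-, ha, hp⟩
    refine ⟨ha, fun i j hij => (h2 i j).2 ?_⟩
    have := hp i j hij.ne
    omega

theorem avoidCount_pair_axis (m M : ℕ) (hM : (p - 1) * m ≤ M) [NeZero (2 * M + 1)] :
    avoidCount (pairForms p) (axisForms p 2) m (2 * M + 1) =
      2 ^ p * (M - (p - 1) * m).descFactorial p := by
  classical
  rw [← card_spaced_placements m M hM]
  convert card_filter_natAbs_valMinAbs (p := p) M
    (fun a => ∀ i j, i ≠ j → a i + m < a j ∨ a j + m < a i) using 1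
  swap
  · congr! 2
    ext a
    simp only [Finset.mem_filter]
  rw [avoidCount]
  congr 1
  ext y
  have h2 := fun i j => spaced_iff (m := m) (y i) (y j)
  have hu : IsUnit ((2 : ℤ) : ZMod (2 * M + 1)) := by
    rw [show ((2 : ℤ) : ZMod (2 * M + 1)) = ((2 : ℕ) : ZMod (2 * M + 1)) by norm_cast,
      ZMod.isUnit_iff_coprime]
    simp
  simp only [Finset.mem_filter, Finset.mem_univ, true_and, forall_mem_axisForms,
    forall_mem_pairForms, evalForm_single, evalForm_add, evalForm_sub, Int.cast_one, one_mul,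
    ne_eq, hu.mul_right_eq_zero]
  constructor
  · rintro ⟨hp, ha⟩
    refine ⟨ha, fun i j hij => ?_⟩
    rcases lt_or_gt_of_ne hij with hlt | hlt
    · exact (h2 i j).1 fun k hk => ⟨(hp i j hlt).1 k hk, (hp i j hlt).2 k hk⟩
    · exact ((h2 j i).1 fun k hk => ⟨(hp j i hlt).1 k hk, (hp j i hlt).2 k hk⟩).symm
  · rintro ⟨ha, hp⟩
    refine ⟨fun i j hij => ?_, ha⟩
    have := (h2 i j).2 (hp i j hij.ne)
    exact ⟨fun k hk => (this k hk).1, fun k hk => (this k hk).2⟩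

theorem monic_prod_exponents (E : Multiset ℕ) (c : ℤ) :
    (E.map fun k : ℕ => (X - C c - C (k : ℤ) : ℤ[X])).prod.Monic := by
  refine monic_multiset_prod_of_monic _ _ fun k _ => ?_
  rw [sub_sub, ← C_add]
  exact monic_X_sub_C _

theorem eval_prod_odd_exponents (p r M n : ℕ) (hr : r + p ≤ M) (hn : n = 2 * r) :
    ((((Multiset.range p).map fun k => 2 * k + 1).map fun k : ℕ =>
      (X - C (n : ℤ) - C (k : ℤ) : ℤ[X])).prod).eval ((2 * M + 1 : ℕ) : ℤ) =
      ((2 ^ p * (M - r).descFactorial p : ℕ) : ℤ) := by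
  subst hn
  have h2 : (2 : ℕ) ^ p = ∏ _i ∈ Finset.range p, 2 := by simp
  rw [eval_multiset_prod, Multiset.map_map, Multiset.map_map, Nat.descFactorial_eq_prod_range, h2,
    ← Finset.prod_mul_distrib, Nat.cast_prod]
  change ∏ i ∈ Finset.range p, _ = _
  refine Finset.prod_congr rfl fun i hi => ?_
  have := Finset.mem_range.1 hi
  simp only [Function.comp_apply, eval_sub, eval_X, eval_C]
  omega

theorem exists_odd_coprime (M : ℕ) (hM : M ≠ 0) (B : ℕ) :
    ∃ K, B ≤ K ∧ (2 * K + 1).Coprime M := by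
  refine ⟨M * B, Nat.le_mul_of_pos_left B (Nat.pos_of_ne_zero hM), ?_⟩
  rw [show 2 * (M * B) + 1 = 1 + M * (2 * B) by ring, Nat.coprime_add_mul_left_left]
  exact Nat.coprime_one_left M

theorem charpoly_semiCatalan_of_avoidCount [Fintype ι] [FiniteDimensional ℝ V] {b : P.Base}
    {β : Module.Basis (Fin p) ℝ V} {S L : Finset (Fin p → ℤ)} (h : IsRootModel b β S L) (m r : ℕ)
    (hc : ∀ M, r ≤ M → ∀ [NeZero (2 * M + 1)],
      avoidCount S L m (2 * M + 1) = 2 ^ p * (M - r).descFactorial p) :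
    arrangementCharpoly (semiCatalan b m) = (((Multiset.range p).map fun k => 2 * k + 1).map
      fun k : ℕ => X - C ((2 * r : ℕ) : ℤ) - C (k : ℤ)).prod := by
  refine (charpoly_semiCatalan_eq_of_count h m _ (monic_prod_exponents _ _) 1 1 one_ne_zero
    fun M hM B => ?_).1
  obtain ⟨K, hK, hKM⟩ := exists_odd_coprime M hM (B + r + p)
  refine ⟨2 * K + 1, by omega, hKM, ?_⟩
  intro _
  rw [one_mul, one_mul, hc K (by omega), eval_prod_odd_exponents p r K _ (by omega) rfl]

namespace IsSignedBasis

variable {b : P.Base} {e : Fin p ≃ b.support} {κ : ℕ} {ε : Module.Basis (Fin p) ℝ V} {s : ℝ}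

theorem charpoly_semiCatalan_one [Fintype ι] [FiniteDimensional ℝ V] [P.IsRootSystem]
    [P.IsCrystallographic] [P.IsReduced]
    (H : IsSignedBasis b e 1 ε s) (hinv : IsWeylInvariantInner P) (m : ℕ) :
    arrangementCharpoly (semiCatalan b m) = (((Multiset.range p).map fun k => 2 * k + 1).map
      fun k : ℕ => X - C ((m * 2 : ℕ) : ℤ) - C (k : ℤ)).prod := by
  rw [mul_comm m 2]
  refine charpoly_semiCatalan_of_avoidCount (H.isRootModel_one hinv) m m ?_
  intro M hM _
  exact avoidCount_axis_pair m M hM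

theorem charpoly_semiCatalan_two [Fintype ι] [FiniteDimensional ℝ V] [P.IsRootSystem]
    [P.IsCrystallographic] [P.IsReduced]
    (H : IsSignedBasis b e 2 ε s) (hinv : IsWeylInvariantInner P) (m : ℕ) :
    arrangementCharpoly (semiCatalan b m) = (((Multiset.range p).map fun k => 2 * k + 1).map
      fun k : ℕ => X - C ((m * (2 * (p - 1)) : ℕ) : ℤ) - C (k : ℤ)).prod := by
  rw [show m * (2 * (p - 1)) = 2 * ((p - 1) * m) by ring]
  refine charpoly_semiCatalan_of_avoidCount (H.isRootModel_two hinv) m ((p - 1) * m) ?_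
  intro M hM _
  exact avoidCount_pair_axis m M hM

end IsSignedBasis

end SignedCharpoly

/-! ### Highest roots and short antichains in types `B` and `C` -/

section SignedAntichains

variable {ι V N : Type*} [NormedAddCommGroup V] [InnerProductSpace ℝ V]
  [AddCommGroup N] [Module ℝ N] {P : RootPairing ι ℝ V N} {p : ℕ}

theorem natCoord_eq_repr [P.IsRootSystem] {b : P.Base} {e : Fin p ≃ b.support} {θ : ι}
    {c : Fin p → ℕ} (hc : P.root θ = ∑ i, c i • P.root (e i)) (k : Fin p) :
    (c k : ℝ) = (simpleBasis b e).repr (P.root θ) k := by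
  have : P.root θ = intComb (simpleBasis b e) fun i => (c i : ℤ) := by
    rw [hc, intComb]
    simp [simpleBasis_apply, Nat.cast_smul_eq_nsmul]
  rw [this, basis_repr_intComb, Int.cast_natCast]

theorem shortCoordSum_eq_sum {b : P.Base} {e : Fin p ≃ b.support} {q : Fin p → Prop}
    [DecidablePred q] (h : ∀ k, IsShortRoot P (e k : ι) ↔ q k) (c : Fin p → ℕ) :
    shortCoordSum b e c = ∑ k with q k, c k := by
  rw [shortCoordSum]
  refine Finset.sum_congr ?_ fun _ _ => rfl
  ext k
  simp [h]

open Classical in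
/-- The finite sets of members of `T` in which no two distinct members are related by `R`. -/
noncomputable def antichainFinset {α : Type*} (R : α → α → Prop) (T : Finset α) :
    Finset (Finset α) :=
  T.powerset.filter fun Γ => ∀ x ∈ Γ, ∀ y ∈ Γ, x ≠ y → ¬ R x y

theorem mem_antichainFinset {α : Type*} {R : α → α → Prop} {T Γ : Finset α} :
    Γ ∈ antichainFinset R T ↔ Γ ⊆ T ∧ ∀ x ∈ Γ, ∀ y ∈ Γ, x ≠ y → ¬ R x y := by
  simp only [antichainFinset, Finset.mem_filter, Finset.mem_powerset]

/-- The antichains of members of `S` correspond to the antichains of labels in `T`. -/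
theorem ncard_antichain_eq_card {α : Type*} (T : Finset α) (ρ : α → ι) (S : Set ι)
    (r : ι → ι → Prop) (R : α → α → Prop) (hS : ∀ i, i ∈ S ↔ ∃ x ∈ T, ρ x = i)
    (hinj : ∀ x ∈ T, ∀ y ∈ T, ρ x = ρ y → x = y)
    (hr : ∀ x ∈ T, ∀ y ∈ T, r (ρ x) (ρ y) ↔ R x y) :
    {Γ : Set ι | (∀ i ∈ Γ, i ∈ S) ∧ IsAntichain r Γ}.ncard =
      (antichainFinset R T).card := by
  classical
  have himage : {Γ : Set ι | (∀ i ∈ Γ, i ∈ S) ∧ IsAntichain r Γ} =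
      (fun Γ : Finset α => ρ '' Γ) '' (antichainFinset R T : Set (Finset α)) := by
    ext Γ
    simp only [Set.mem_ofPred_eq, Set.mem_image, Finset.mem_coe, mem_antichainFinset]
    constructor
    · rintro ⟨hΓ, hanti⟩
      refine ⟨T.filter fun x => ρ x ∈ Γ, ⟨Finset.filter_subset _ _, ?_⟩, ?_⟩
      · intro x hx y hy hxy h
        rw [Finset.mem_filter] at hx hy
        refine hanti hx.2 hy.2 (fun h' => hxy (hinj x hx.1 y hy.1 h')) ((hr x hx.1 y hy.1).2 h)
      · ext i
        constructor
        · rintro ⟨x, hx, rfl⟩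
          exact (Finset.mem_filter.1 hx).2
        · intro hi
          obtain ⟨x, hx, rfl⟩ := (hS i).1 (hΓ i hi)
          exact ⟨x, Finset.mem_filter.2 ⟨hx, hi⟩, rfl⟩
    · rintro ⟨Δ, ⟨hΔ, hanti⟩, rfl⟩
      refine ⟨?_, ?_⟩
      · rintro _ ⟨x, hx, rfl⟩
        exact (hS _).2 ⟨x, hΔ hx, rfl⟩
      · rintro _ ⟨x, hx, rfl⟩ _ ⟨y, hy, rfl⟩ hne h
        exact hanti x hx y hy (fun h' => hne (congrArg ρ h')) ((hr x (hΔ hx) y (hΔ hy)).1 h)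
  rw [himage, Set.InjOn.ncard_image, Set.ncard_coe_finset]
  intro Δ hΔ Δ' hΔ' h
  have hΔ := (mem_antichainFinset.1 (Finset.mem_coe.1 hΔ)).1
  have hΔ' := (mem_antichainFinset.1 (Finset.mem_coe.1 hΔ')).1
  ext x
  constructor
  · intro hx
    obtain ⟨y, hy, hxy⟩ : ρ x ∈ ρ '' (Δ' : Set α) := (Set.ext_iff.1 h (ρ x)).1 ⟨x, hx, rfl⟩
    exact hinj y (hΔ' hy) x (hΔ hx) hxy ▸ hy
  · intro hx
    obtain ⟨y, hy, hxy⟩ : ρ x ∈ ρ '' (Δ : Set α) := (Set.ext_iff.1 h (ρ x)).2 ⟨x, hx, rfl⟩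
    exact hinj y (hΔ hy) x (hΔ' hx) hxy ▸ hy

theorem ncard_antichain_eq_cellAntichainCount (T : Finset (ℕ × ℕ)) (ρ : ℕ × ℕ → ι) (S : Set ι)
    (r : ι → ι → Prop) (hS : ∀ i, i ∈ S ↔ ∃ x ∈ T, ρ x = i)
    (hr : ∀ x ∈ T, ∀ y ∈ T, r (ρ x) (ρ y) ↔ y.1 ≤ x.1 ∧ x.2 ≤ y.2) :
    {Γ : Set ι | (∀ i ∈ Γ, i ∈ S) ∧ IsAntichain r Γ}.ncard = cellAntichainCount T := by
  refine (ncard_antichain_eq_card T ρ S r _ hS (fun x hx y hy h => ?_) hr).trans ?_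
  · have h1 := (hr x hx y hy).1 (h ▸ (hr x hx x hx).2 ⟨le_rfl, le_rfl⟩)
    have h2 := (hr y hy x hx).1 (h ▸ (hr x hx x hx).2 ⟨le_rfl, le_rfl⟩)
    exact Prod.ext (le_antisymm h2.1 h1.1) (le_antisymm h1.2 h2.2)
  · rw [cellAntichainCount]
    congr 1
    ext Γ
    simp only [mem_antichainFinset, Finset.mem_filter, Finset.mem_powerset]
    rfl

/-- The antichains of a chain are the empty set and the singletons. -/
theorem ncard_antichain_of_total [Finite ι] (S : Set ι) (r : ι → ι → Prop)
    (hr : ∀ i ∈ S, ∀ j ∈ S, r i j ∨ r j i) :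
    {Γ : Set ι | (∀ i ∈ Γ, i ∈ S) ∧ IsAntichain r Γ}.ncard = S.ncard + 1 := by
  have h : {Γ : Set ι | (∀ i ∈ Γ, i ∈ S) ∧ IsAntichain r Γ} =
      insert ∅ ((fun i => ({i} : Set ι)) '' S) := by
    ext Γ
    simp only [Set.mem_ofPred_eq, Set.mem_insert_iff, Set.mem_image]
    constructor
    · rintro ⟨hΓ, hanti⟩
      rcases Γ.eq_empty_or_nonempty with rfl | ⟨i, hi⟩
      · exact Or.inl rfl
      · refine Or.inr ⟨i, hΓ i hi, (Set.eq_singleton_iff_unique_mem.2 ⟨hi, fun j hj => ?_⟩).symm⟩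
        by_contra hne
        rcases hr i (hΓ i hi) j (hΓ j hj) with h | h
        · exact hanti hi hj (Ne.symm hne) h
        · exact hanti hj hi hne h
    · rintro (rfl | ⟨i, hi, rfl⟩)
      · exact ⟨by simp, Set.subsingleton_empty.isAntichain _⟩
      · exact ⟨by simpa using hi, Set.subsingleton_singleton.isAntichain _⟩
  rw [h, Set.ncard_insert_of_notMem, Set.ncard_image_of_injective _ Set.singleton_injective]
  rintro ⟨i, -, hi⟩
  exact Set.singleton_ne_empty i hi

theorem strictlyPosShortAntichains_eq (b : P.Base) :
    strictlyPosShortAntichains b = {Γ : Set ι |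
      (∀ i ∈ Γ, i ∈ {i | IsShortPos b i ∧ ¬ IsShortSimple b i}) ∧ IsAntichain (RootLE b) Γ} := by
  ext Γ
  simp only [strictlyPosShortAntichains, shortAntichains, Set.mem_ofPred_eq]
  constructor
  · rintro ⟨⟨h1, h2⟩, h3⟩
    exact ⟨fun i hi => ⟨h1 i hi, h3 i hi⟩, h2⟩
  · rintro ⟨h1, h2⟩
    exact ⟨⟨fun i hi => (h1 i hi).1, h2⟩, fun i hi => (h1 i hi).2⟩

namespace IsSignedBasis

variable {b : P.Base} {e : Fin p ≃ b.support} {κ : ℕ} {ε : Module.Basis (Fin p) ℝ V} {s : ℝ}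

theorem eq_of_partialSum_eq [P.IsRootSystem] (H : IsSignedBasis b e κ ε s) {x y : V}
    (h : ∀ k, ∑ l with l ≤ k, ε.repr x l = ∑ l with l ≤ k, ε.repr y l) : x = y := by
  refine (simpleBasis b e).repr.injective (Finsupp.ext fun k => ?_)
  rw [H.simpleBasis_repr, H.simpleBasis_repr, h]

section

variable [Finite ι] [P.IsRootSystem] [P.IsCrystallographic] [P.IsReduced]

/-- The root `ε 0 + ε 1` has the largest partial sums of `ε`-coordinates. -/
theorem isHighestRoot_of_add (H : IsSignedBasis b e 1 ε s) (hinv : IsWeylInvariantInner P)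
    {θ : ι} {a c : Fin p} (ha : (a : ℕ) = 0) (hc : (c : ℕ) = 1)
    (hθ : P.root θ = ε a + ε c) : IsHighestRoot b θ := by
  intro i
  rw [H.rootLE_iff]
  intro k
  rw [hθ, sum_repr_add]
  have hak : a ≤ k := Fin.le_def.2 (by omega)
  rcases H.isSignedVector_root hinv i with ⟨d, u, h⟩ | ⟨d, d', u, v, hd, h⟩
  · rw [h, smul_smul, sum_repr_smul, if_pos hak]
    rcases Int.units_eq_one_or u with rfl | rfl <;> split_ifs <;> norm_num
  · have hd' : ¬ c ≤ k → d ≤ k → d' ≤ k → False := by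
      intro h1 h2 h3
      rw [Fin.le_def] at h1 h2 h3
      exact hd (Fin.ext (by omega))
    rw [h, if_pos hak]
    simp only [map_add, map_smul, Finsupp.add_apply, Finsupp.smul_apply, Finset.sum_add_distrib,
      ← Finset.smul_sum, sum_repr_basis]
    rcases Int.units_eq_one_or u with rfl | rfl <;> rcases Int.units_eq_one_or v with rfl | rfl <;>
      split_ifs with h1 h2 h3 <;> first | exact (hd' ‹_› ‹_› ‹_›).elim | norm_num

theorem isHighestRoot_of_smul (H : IsSignedBasis b e 2 ε s) (hinv : IsWeylInvariantInner P)
    {θ : ι} {a : Fin p} (ha : (a : ℕ) = 0)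
    (hθ : P.root θ = (2 : ℝ) • ε a) : IsHighestRoot b θ := by
  intro i
  rw [H.rootLE_iff]
  intro k
  rw [hθ, sum_repr_smul]
  have hak : a ≤ k := Fin.le_def.2 (by omega)
  rcases H.isSignedVector_root hinv i with ⟨d, u, h⟩ | ⟨d, d', u, v, hd, h⟩
  · rw [h, smul_smul, sum_repr_smul, if_pos hak]
    rcases Int.units_eq_one_or u with rfl | rfl <;> split_ifs <;> norm_num
  · rw [h, if_pos hak]
    simp only [map_add, map_smul, Finsupp.add_apply, Finsupp.smul_apply, Finset.sum_add_distrib,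
      ← Finset.smul_sum, sum_repr_basis]
    rcases Int.units_eq_one_or u with rfl | rfl <;> rcases Int.units_eq_one_or v with rfl | rfl <;>
      split_ifs <;> norm_num

theorem isShortRoot_simple_iff (H : IsSignedBasis b e κ ε s) (hinv : IsWeylInvariantInner P)
    (k : Fin p) : IsShortRoot P (e k : ι) ↔ (κ = 1 ↔ (k : ℕ) + 1 = p) := by
  have hs := H.pos
  rw [H.isShortRoot_iff hinv]
  rcases H.simple_cases k with ⟨j, hj, h⟩ | ⟨hk, h⟩
  · have hne : k ≠ j := by rintro rfl; omega
    have hk : (k : ℕ) + 1 ≠ p := by have := j.2; omega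
    rw [h, H.inner_self_sub hne]
    rcases H.kappa with rfl | rfl
    · simp [hk, hs.ne']
    · simp [hk]
  · rw [h, H.inner_self_smul]
    rcases H.kappa with rfl | rfl
    · simp [hk]
    · simp only [hk, OfNat.ofNat_ne_one, iff_true, iff_false]
      push_cast
      intro h'
      linarith

theorem shortCoordSum_one (H : IsSignedBasis b e 1 ε s) (hinv : IsWeylInvariantInner P)
    {θ : ι} (hθ : IsHighestRoot b θ) {c : Fin p → ℕ}
    (hc : P.root θ = ∑ i, c i • P.root (e i)) : shortCoordSum b e c = 2 := by
  have hp := H.two_le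
  obtain ⟨i, hi⟩ := H.exists_root_add hinv (a := ⟨0, by omega⟩) (c := ⟨1, by omega⟩)
    (Fin.lt_def.2 Nat.zero_lt_one)
  obtain rfl := highestRoot_unique b e hθ (H.isHighestRoot_of_add hinv rfl rfl hi)
  have hlast : c ⟨p - 1, by omega⟩ = 2 := by
    have h := natCoord_eq_repr hc ⟨p - 1, by omega⟩
    rw [H.simpleBasis_repr, hi, sum_repr_add, if_pos (by simp; omega), if_pos (by simp),
      if_pos (by rw [Fin.le_def]; simp; omega)] at h
    norm_num at h
    exact_mod_cast h
  rw [shortCoordSum_eq_sum (q := fun k : Fin p => (k : ℕ) + 1 = p)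
    (fun k => (H.isShortRoot_simple_iff hinv k).trans (by simp)) c,
    Finset.sum_eq_single ⟨p - 1, by omega⟩, hlast]
  · intro k hk hne
    exact absurd (Fin.ext (by have := (Finset.mem_filter.1 hk).2; simp; omega)) hne
  · intro h
    exact absurd (Finset.mem_filter.2 ⟨Finset.mem_univ _, by simp; omega⟩) h

theorem shortCoordSum_two (H : IsSignedBasis b e 2 ε s) (hinv : IsWeylInvariantInner P)
    {θ : ι} (hθ : IsHighestRoot b θ) {c : Fin p → ℕ}
    (hc : P.root θ = ∑ i, c i • P.root (e i)) : shortCoordSum b e c = 2 * (p - 1) := by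
  have hp := H.two_le
  obtain ⟨i, hi⟩ := H.exists_root_smul hinv ⟨0, by omega⟩
  obtain rfl := highestRoot_unique b e hθ (H.isHighestRoot_of_smul hinv rfl (by simpa using hi))
  have hcoord : ∀ k : Fin p, (k : ℕ) + 1 ≠ p → c k = 2 := by
    intro k hk
    have h := natCoord_eq_repr hc k
    rw [H.simpleBasis_repr, hi, sum_repr_smul, if_neg hk,
      if_pos (by rw [Fin.le_def]; simp), one_mul] at h
    exact_mod_cast h
  have hcard : (Finset.univ.filter fun k : Fin p => (k : ℕ) + 1 ≠ p).card = p - 1 := by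
    have h : (Finset.univ.filter fun k : Fin p => (k : ℕ) + 1 ≠ p) =
        Finset.univ.erase ⟨p - 1, by omega⟩ := by
      ext k
      simp only [Finset.mem_filter, Finset.mem_univ, true_and, Finset.mem_erase, and_true, ne_eq,
        Fin.ext_iff]
      omega
    rw [h, Finset.card_erase_of_mem (Finset.mem_univ _), Finset.card_univ, Fintype.card_fin]
  rw [shortCoordSum_eq_sum (q := fun k : Fin p => (k : ℕ) + 1 ≠ p)
    (fun k => (H.isShortRoot_simple_iff hinv k).trans (by simp)) c,
    Finset.sum_const_nat fun k hk => hcoord k (Finset.mem_filter.1 hk).2, hcard, mul_comm]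

theorem ncard_shortAntichains_one (H : IsSignedBasis b e 1 ε s) (hinv : IsWeylInvariantInner P) :
    (shortAntichains b).ncard = p + 1 := by
  have h := ncard_antichain_of_total {i | IsShortPos b i} (RootLE b) (by
    intro i hi j hj
    obtain ⟨a, ha⟩ := (H.isShortPos_iff_axis hinv i).1 hi
    obtain ⟨c, hc⟩ := (H.isShortPos_iff_axis hinv j).1 hj
    simp only [H.rootLE_iff, ha, hc, sum_repr_basis]
    rcases le_total c a with h | h
    · refine Or.inl fun k => ?_
      split_ifs with h1 h2 <;> first | exact absurd (h.trans h1) h2 | norm_num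
    · refine Or.inr fun k => ?_
      split_ifs with h1 h2 <;> first | exact absurd (h.trans h1) h2 | norm_num)
  refine h.trans (congrArg (· + 1) ?_)
  choose r hr using H.exists_root_smul hinv
  have hr' : ∀ a, P.root (r a) = ε a := fun a => by simpa using hr a
  have hset : {i | IsShortPos b i} = Set.range r := by
    ext i
    rw [Set.mem_ofPred_eq, H.isShortPos_iff_axis hinv]
    constructor
    · rintro ⟨a, ha⟩
      exact ⟨a, P.root.injective ((hr' a).trans ha.symm)⟩
    · rintro ⟨a, rfl⟩
      exact ⟨a, hr' a⟩
  have hinj : Function.Injective r := fun a c hac => ε.injective (by rw [← hr', ← hr', hac])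
  rw [hset, ← Set.image_univ, Set.ncard_image_of_injective _ hinj, Set.ncard_univ]
  simp

theorem ncard_strictlyPosShortAntichains_one (H : IsSignedBasis b e 1 ε s)
    (hinv : IsWeylInvariantInner P) : (strictlyPosShortAntichains b).ncard = 1 := by
  have hp := H.two_le
  have hnone : {i | IsShortPos b i ∧ ¬ IsShortSimple b i} = ∅ := by
    refine Set.eq_empty_of_forall_notMem ?_
    rintro i ⟨hi, hsimple⟩
    refine hsimple ⟨hi, ?_⟩
    rintro ⟨j, k, hj, hk, hjk⟩
    obtain ⟨a, ha⟩ := (H.isShortPos_iff_axis hinv i).1 hi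
    obtain ⟨c, hc⟩ := (H.isShortPos_iff_axis hinv j).1 hj
    obtain ⟨d, hd⟩ := (H.isShortPos_iff_axis hinv k).1 hk
    have h := congrArg (fun x => ∑ l with l ≤ (⟨p - 1, by omega⟩ : Fin p), ε.repr x l) hjk
    have hle : ∀ a : Fin p, a ≤ ⟨p - 1, by omega⟩ := fun a => by
      rw [Fin.le_def]; have := a.2; simp; omega
    simp only [ha, hc, hd, sum_repr_add, sum_repr_basis] at h
    rw [if_pos (hle a), if_pos (hle c), if_pos (hle d)] at h
    norm_num at h
  rw [strictlyPosShortAntichains_eq, hnone, ncard_antichain_of_total ∅ _ (by simp)]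
  simp

/-- The partial sums of the signed coordinates of the short root attached to a cell `(i, k)` in
type `C`: it is `ε_i - ε_k` for `k < p` and `ε_i + ε_{2p-1-k}` for `k ≥ p`. -/
def cellPartialSum (p : ℕ) (x : ℕ × ℕ) (t : ℕ) : ℤ :=
  (if x.1 ≤ t then 1 else 0) +
    if x.2 < p then -(if x.2 ≤ t then 1 else 0) else if 2 * p - 1 - x.2 ≤ t then 1 else 0

theorem cellPartialSum_le_iff {x y : ℕ × ℕ} (hx : x ∈ staircase p 0) (hy : y ∈ staircase p 0) :
    (∀ t < p, cellPartialSum p x t ≤ cellPartialSum p y t) ↔ y.1 ≤ x.1 ∧ x.2 ≤ y.2 := by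
  rw [mem_staircase] at hx hy
  obtain ⟨i, k⟩ := x
  obtain ⟨i', k'⟩ := y
  simp only [cellPartialSum] at *
  constructor
  · intro h
    refine ⟨?_, ?_⟩
    · by_contra hlt
      have := h i (by omega)
      split_ifs at this <;> omega
    · by_contra hlt
      by_cases hk' : k' < p
      · have := h (max i k') (by omega)
        split_ifs at this <;> omega
      · have := h (2 * p - 1 - k) (by omega)
        split_ifs at this <;> omega
  · rintro ⟨h1, h2⟩ t ht
    split_ifs <;> omega

theorem isShortPos_iff_cell (H : IsSignedBasis b e 2 ε s) (hinv : IsWeylInvariantInner P) (i : ι) :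
    IsShortPos b i ↔ ∃ x ∈ staircase p 0, ∀ t : Fin p,
      ∑ l with l ≤ t, ε.repr (P.root i) l = cellPartialSum p x t := by
  have hsub : ∀ (a c t : Fin p), ∑ l with l ≤ t, ε.repr (ε a - ε c) l =
      cellPartialSum p (a, c) t := by
    intro a c t
    rw [sum_repr_sub, cellPartialSum]
    simp only [c.2, if_true, Fin.le_def]
    split_ifs <;> norm_num
  have hadd : ∀ (a c t : Fin p), ∑ l with l ≤ t, ε.repr (ε a + ε c) l =
      cellPartialSum p (a, 2 * p - 1 - c) t := by
    intro a c t
    have hc := c.2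
    have h1 : ¬ 2 * p - 1 - (c : ℕ) < p := by omega
    have h2 : 2 * p - 1 - (2 * p - 1 - (c : ℕ)) = c := by omega
    rw [sum_repr_add, cellPartialSum]
    simp only [h1, h2, if_false, Fin.le_def]
    split_ifs <;> norm_num
  rw [H.isShortPos_iff_pair hinv]
  constructor
  · rintro ⟨a, c, hac, h | h⟩
    · exact ⟨(a, c), by rw [mem_staircase]; have := c.2; have := Fin.lt_def.1 hac; simp; omega,
        fun t => by rw [h, hsub]⟩
    · exact ⟨(a, 2 * p - 1 - c), by rw [mem_staircase]; have := c.2; have := Fin.lt_def.1 hac; simp; omega,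
        fun t => by rw [h, hadd]⟩
  · rintro ⟨⟨a, k⟩, hx, h⟩
    rw [mem_staircase] at hx
    simp only at hx
    by_cases hk : k < p
    · refine ⟨⟨a, by omega⟩, ⟨k, hk⟩, Fin.lt_def.2 (by simp; omega),
        Or.inl (H.eq_of_partialSum_eq fun t => ?_)⟩
      rw [h, hsub]
    · refine ⟨⟨a, by omega⟩, ⟨2 * p - 1 - k, by omega⟩, Fin.lt_def.2 (by simp; omega),
        Or.inr (H.eq_of_partialSum_eq fun t => ?_)⟩
      rw [h, hadd]
      simp only
      rw [show 2 * p - 1 - (2 * p - 1 - k) = k by omega]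

theorem cellPartialSum_nonneg {x : ℕ × ℕ} (hx : x ∈ staircase p 0) (t : ℕ) :
    0 ≤ cellPartialSum p x t := by
  rw [mem_staircase] at hx
  rw [cellPartialSum]
  split_ifs <;> omega

theorem cellPartialSum_self {x : ℕ × ℕ} (hx : x ∈ staircase p 0) :
    cellPartialSum p x x.1 = 1 := by
  rw [mem_staircase] at hx
  rw [cellPartialSum]
  split_ifs <;> omega

theorem cellPartialSum_of_notMem {x : ℕ × ℕ} (hx : x ∈ staircase p 0) (hx' : x ∉ staircase p 1)
    {t : ℕ} (ht : t + 2 ≤ p) : cellPartialSum p x t = if t = x.1 then 1 else 0 := by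
  rw [mem_staircase] at hx hx'
  rw [cellPartialSum]
  split_ifs <;> omega

/-- The decomposable cells: those that are the sum of two cells. -/
theorem exists_cellPartialSum_add_iff {x : ℕ × ℕ} (hx : x ∈ staircase p 0) :
    (∃ y ∈ staircase p 0, ∃ z ∈ staircase p 0, ∀ t < p,
      cellPartialSum p x t = cellPartialSum p y t + cellPartialSum p z t) ↔
      x ∈ staircase p 1 := by
  have hrow : ∀ y ∈ staircase p 0, y.1 + 2 ≤ p := fun y hy => by rw [mem_staircase] at hy; omega
  constructor
  · rintro ⟨y, hy, z, hz, h⟩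
    by_contra hx'
    -- both summands start in the row of `x`, where the partial sum of `x` is only one
    have h1 : y.1 = x.1 := by
      have h2 := h y.1 (by have := hrow y hy; omega)
      rw [cellPartialSum_self hy, cellPartialSum_of_notMem hx hx' (hrow y hy)] at h2
      have h3 := cellPartialSum_nonneg hz y.1
      by_contra hne
      rw [if_neg hne] at h2
      omega
    have h2 := h y.1 (by have := hrow y hy; omega)
    have h3 : z.1 = x.1 := by
      have h2 := h z.1 (by have := hrow z hz; omega)
      rw [cellPartialSum_self hz, cellPartialSum_of_notMem hx hx' (hrow z hz)] at h2
      have h3 := cellPartialSum_nonneg hy z.1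
      by_contra hne
      rw [if_neg hne] at h2
      omega
    rw [cellPartialSum_self hy, h1, cellPartialSum_self hx, ← h3, cellPartialSum_self hz] at h2
    omega
  · intro h
    obtain ⟨i, k⟩ := x
    rw [mem_staircase] at h
    simp only [true_and] at h
    by_cases hk : k < p ∨ i + 1 < 2 * p - 1 - k
    · refine ⟨(i, i + 1), mem_staircase.2 (by simp only; omega), (i + 1, k),
        mem_staircase.2 (by simp only; omega), fun t ht => ?_⟩
      simp only [cellPartialSum, show i + 1 < p by omega, if_true]
      split_ifs <;> omega
    · refine ⟨(i, p - 1), mem_staircase.2 (by simp only; omega), (i + 1, p),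
        mem_staircase.2 (by simp only [and_true]; omega), fun t ht => ?_⟩
      simp only [cellPartialSum, show p - 1 < p by omega, lt_irrefl, if_true, if_false,
        show ¬ k < p by omega, show 2 * p - 1 - k = i + 1 by omega,
        show 2 * p - 1 - p = p - 1 by omega]
      split_ifs <;> omega

/-- In type `C` the short positive roots with the root order are the cells of a staircase with the
order of `IsCellAntichain`, and those that are not simple in the short root system are the cells of
a smaller staircase. -/
theorem exists_cell_enumeration (H : IsSignedBasis b e 2 ε s) (hinv : IsWeylInvariantInner P) :
    ∃ ρ : ℕ × ℕ → ι,
      (∀ i, i ∈ {i | IsShortPos b i} ↔ ∃ x ∈ staircase p 0, ρ x = i) ∧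
      (∀ i, i ∈ {i | IsShortPos b i ∧ ¬ IsShortSimple b i} ↔ ∃ x ∈ staircase p 1, ρ x = i) ∧
      ∀ x ∈ staircase p 0, ∀ y ∈ staircase p 0,
        RootLE b (ρ x) (ρ y) ↔ y.1 ≤ x.1 ∧ x.2 ≤ y.2 := by
  classical
  have hp := H.two_le
  have hex : ∀ x : ℕ × ℕ, ∃ i, x ∈ staircase p 0 → ∀ t : Fin p,
      ∑ l with l ≤ t, ε.repr (P.root i) l = cellPartialSum p x t := by
    rintro ⟨a, k⟩
    by_cases hx : (a, k) ∈ staircase p 0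
    · have hx' := hx
      rw [mem_staircase] at hx'
      simp only at hx'
      by_cases hk : k < p
      · obtain ⟨i, hi⟩ := H.exists_root_sub hinv (a := ⟨a, by omega⟩) (c := ⟨k, hk⟩)
          (Fin.lt_def.2 (by simp; omega))
        refine ⟨i, fun _ t => ?_⟩
        rw [hi, sum_repr_sub, cellPartialSum]
        simp only [hk, if_true, Fin.le_def]
        split_ifs <;> norm_num
      · obtain ⟨i, hi⟩ := H.exists_root_add hinv (a := ⟨a, by omega⟩)
          (c := ⟨2 * p - 1 - k, by omega⟩) (Fin.lt_def.2 (by simp; omega))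
        refine ⟨i, fun _ t => ?_⟩
        rw [hi, sum_repr_add, cellPartialSum]
        simp only [hk, if_false, Fin.le_def]
        split_ifs <;> norm_num
    · exact ⟨e ⟨0, by omega⟩, fun h => absurd h hx⟩
  choose ρ hρ using hex
  have hpos : ∀ x ∈ staircase p 0, IsShortPos b (ρ x) := fun x hx =>
    (H.isShortPos_iff_cell hinv _).2 ⟨x, hx, hρ x hx⟩
  have hsurj : ∀ i, IsShortPos b i → ∃ x ∈ staircase p 0, ρ x = i := by
    intro i hi
    obtain ⟨x, hx, h⟩ := (H.isShortPos_iff_cell hinv _).1 hi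
    refine ⟨x, hx, P.root.injective (H.eq_of_partialSum_eq fun t => ?_)⟩
    rw [h, hρ x hx]
  have hsimple : ∀ x ∈ staircase p 0, ¬ IsShortSimple b (ρ x) ↔ x ∈ staircase p 1 := by
    intro x hx
    rw [← exists_cellPartialSum_add_iff hx, IsShortSimple, not_and_not_right]
    constructor
    · intro h
      obtain ⟨j, k, hj, hk, hjk⟩ := h (hpos x hx)
      obtain ⟨y, hy, rfl⟩ := hsurj j hj
      obtain ⟨z, hz, rfl⟩ := hsurj k hk
      refine ⟨y, hy, z, hz, fun t ht => ?_⟩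
      have h' := congrArg (fun v => ∑ l with l ≤ (⟨t, ht⟩ : Fin p), ε.repr v l) hjk
      simp only [map_add, Finsupp.add_apply, Finset.sum_add_distrib, hρ x hx, hρ y hy,
        hρ z hz] at h'
      exact_mod_cast h'
    · rintro ⟨y, hy, z, hz, h⟩ -
      refine ⟨ρ y, ρ z, hpos y hy, hpos z hz, H.eq_of_partialSum_eq fun t => ?_⟩
      simp only [map_add, Finsupp.add_apply, Finset.sum_add_distrib, hρ x hx, hρ y hy,
        hρ z hz, h t t.2]
      push_cast
      rfl
  have hsub : ∀ x ∈ staircase p 1, x ∈ staircase p 0 := by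
    intro x hx
    rw [mem_staircase] at *
    omega
  refine ⟨ρ, fun i => ⟨hsurj i, ?_⟩, fun i => ⟨?_, ?_⟩, fun x hx y hy => ?_⟩
  · rintro ⟨x, hx, rfl⟩
    exact hpos x hx
  · rintro ⟨hi, hns⟩
    obtain ⟨x, hx, rfl⟩ := hsurj i hi
    exact ⟨x, (hsimple x hx).1 hns, rfl⟩
  · rintro ⟨x, hx, rfl⟩
    exact ⟨hpos x (hsub x hx), (hsimple x (hsub x hx)).2 hx⟩
  · rw [H.rootLE_iff, ← cellPartialSum_le_iff hx hy]
    simp only [hρ x hx, hρ y hy, Int.cast_le]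
    exact ⟨fun h t ht => h ⟨t, ht⟩, fun h t => h t t.2⟩

theorem ncard_shortAntichains_two (H : IsSignedBasis b e 2 ε s) (hinv : IsWeylInvariantInner P) :
    (shortAntichains b).ncard = (2 * p - 1).choose (p - 1) ∧
      (strictlyPosShortAntichains b).ncard = (2 * p - 2).choose (p - 2) := by
  have hp := H.two_le
  obtain ⟨ρ, h0, h1, hle⟩ := H.exists_cell_enumeration hinv
  constructor
  · rw [← cellAntichainCount_staircase_zero p (by omega)]
    exact ncard_antichain_eq_cellAntichainCount _ ρ {i | IsShortPos b i} _ h0 hle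
  · rw [← cellAntichainCount_staircase_one p hp, strictlyPosShortAntichains_eq]
    have hsub : ∀ x ∈ staircase p 1, x ∈ staircase p 0 := by
      intro x hx
      rw [mem_staircase] at *
      omega
    exact ncard_antichain_eq_cellAntichainCount _ ρ _ _ h1
      fun x hx y hy => hle x (hsub x hx) y (hsub y hy)

end

end IsSignedBasis

theorem prod_map_odd_exponents (p r : ℕ) (f : ℕ → ℕ) (hf : ∀ k, f (2 * k + 1) = 2 * (r + k)) :
    (((Multiset.range p).map fun k => 2 * k + 1).map f).prod = 2 ^ p * r.ascFactorial p := by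
  have h2 : (2 : ℕ) ^ p = ∏ _i ∈ Finset.range p, 2 := by simp
  rw [Multiset.map_map, Nat.ascFactorial_eq_prod_range, h2, ← Finset.prod_mul_distrib]
  change ∏ i ∈ Finset.range p, _ = _
  exact Finset.prod_congr rfl fun i _ => hf i

end SignedAntichains

/-! ### Products over the exponents in types `B` and `C` -/

section SignedData

variable {ι V N : Type*} [NormedAddCommGroup V] [InnerProductSpace ℝ V]
  [AddCommGroup N] [Module ℝ N] {P : RootPairing ι ℝ V N} {p : ℕ}

/-- The exponents are the members of `E`, and the semi-Catalan characteristic polynomials, the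
order of the Weyl group and the numbers of short antichains are the products over `E` in which the
shift is `g`. -/
structure HasExponentProducts [Fintype ι] [FiniteDimensional ℝ V] (b : P.Base)
    (e : Fin p ≃ b.support) (g : ℕ) (E : Multiset ℕ) : Prop where
  one_le : 1 ≤ g
  weylExponents_eq : weylExponents b e = E
  charpoly_eq : ∀ m : ℕ, arrangementCharpoly (semiCatalan b m) =
    (E.map fun k : ℕ => X - C ((m * g : ℕ) : ℤ) - C (k : ℤ)).prod
  card_weylGroup : Nat.card P.weylGroup = (E.map fun k => k + 1).prod
  ncard_antichains : (shortAntichains b).ncard * (E.map fun k => k + 1).prod =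
    (E.map fun k => g + k + 1).prod
  ncard_strict : (strictlyPosShortAntichains b).ncard * (E.map fun k => k + 1).prod =
    (E.map fun k => g + k - 1).prod

variable [Fintype ι] [FiniteDimensional ℝ V] [P.IsRootSystem] [P.IsCrystallographic] [P.IsReduced]
  {b : P.Base} {e : Fin p ≃ b.support} {ε : Module.Basis (Fin p) ℝ V} {s : ℝ}

theorem IsSignedBasis.hasExponentProducts_one (H : IsSignedBasis b e 1 ε s)
    (hinv : IsWeylInvariantInner P) :
    HasExponentProducts b e 2 ((Multiset.range p).map fun k => 2 * k + 1) where
  one_le := by omega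
  weylExponents_eq := H.weylExponents_eq hinv
  charpoly_eq := H.charpoly_semiCatalan_one hinv
  card_weylGroup := by
    rw [H.card_weylGroup hinv, prod_map_odd_exponents p 1 _ fun k => by ring,
      Nat.one_ascFactorial]
  ncard_antichains := by
    rw [H.ncard_shortAntichains_one hinv, prod_map_odd_exponents p 1 _ fun k => by ring,
      prod_map_odd_exponents p 2 _ fun k => by ring, Nat.one_ascFactorial]
    have h : 1 * (2 : ℕ).ascFactorial p = (1 + p) * (1 : ℕ).ascFactorial p :=
      Nat.succ_ascFactorial 1 p
    rw [Nat.one_ascFactorial, one_mul] at h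
    rw [h]
    ring
  ncard_strict := by
    rw [H.ncard_strictlyPosShortAntichains_one hinv, one_mul,
      prod_map_odd_exponents p 1 _ fun k => by ring, prod_map_odd_exponents p 1 _ fun k => by omega]

theorem IsSignedBasis.hasExponentProducts_two (H : IsSignedBasis b e 2 ε s)
    (hinv : IsWeylInvariantInner P) :
    HasExponentProducts b e (2 * (p - 1)) ((Multiset.range p).map fun k => 2 * k + 1) where
  one_le := by have := H.two_le; omega
  weylExponents_eq := H.weylExponents_eq hinv
  charpoly_eq := H.charpoly_semiCatalan_two hinv
  card_weylGroup := by
    rw [H.card_weylGroup hinv, prod_map_odd_exponents p 1 _ fun k => by ring,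
      Nat.one_ascFactorial]
  ncard_antichains := by
    have hp := H.two_le
    rw [(H.ncard_shortAntichains_two hinv).1, prod_map_odd_exponents p 1 _ fun k => by ring,
      prod_map_odd_exponents p p _ fun k => by omega, Nat.one_ascFactorial]
    obtain ⟨n, rfl⟩ : ∃ n, p = n + 1 := ⟨p - 1, by omega⟩
    rw [Nat.ascFactorial_eq_factorial_mul_choose, ← Nat.choose_symm (k := n + 1) (by omega),
      show n + (n + 1) - (n + 1) = n + 1 - 1 by omega,
      show 2 * (n + 1) - 1 = n + (n + 1) by omega]
    ring
  ncard_strict := by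
    have hp := H.two_le
    rw [(H.ncard_shortAntichains_two hinv).2, prod_map_odd_exponents p 1 _ fun k => by ring,
      prod_map_odd_exponents p (p - 1) _ fun k => by omega, Nat.one_ascFactorial]
    obtain ⟨n, rfl⟩ : ∃ n, p = n + 2 := ⟨p - 2, by omega⟩
    rw [show n + 2 - 1 = n + 1 by omega, Nat.ascFactorial_eq_factorial_mul_choose,
      ← Nat.choose_symm (k := n + 2) (by omega), show n + (n + 2) - (n + 2) = n + 2 - 2 by omega,
      show 2 * (n + 2) - 2 = n + (n + 2) by omega]
    ring

end SignedData

/-! ### Root vectors of type `F₄` -/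

section VectorsF4

/-- The simple coordinates of the short positive roots of type `F₄`. -/
def shortF4 : Finset (Fin 4 → ℤ) :=
  {![0, 0, 0, 1], ![0, 0, 1, 0], ![0, 0, 1, 1], ![0, 1, 1, 0], ![0, 1, 1, 1], ![1, 1, 1, 0],
    ![0, 1, 2, 1], ![1, 1, 1, 1], ![1, 1, 2, 1], ![1, 2, 2, 1], ![1, 2, 3, 1], ![1, 2, 3, 2]}

/-- The simple coordinates of the long positive roots of type `F₄`. -/
def longF4 : Finset (Fin 4 → ℤ) :=
  {![0, 1, 0, 0], ![1, 0, 0, 0], ![1, 1, 0, 0], ![0, 1, 2, 0], ![1, 1, 2, 0], ![0, 1, 2, 2],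
    ![1, 2, 2, 0], ![1, 1, 2, 2], ![1, 2, 2, 2], ![1, 2, 4, 2], ![1, 3, 4, 2], ![2, 3, 4, 2]}

/-- The simple coordinates of the positive roots of type `F₄`. -/
def posF4 : Finset (Fin 4 → ℤ) := shortF4 ∪ longF4

/-- The simple coordinates of the highest root of type `F₄`. -/
def highestF4 : Fin 4 → ℤ := ![2, 3, 4, 2]

/-- The `k`-th simple reflection of type `F₄` in simple coordinates. -/
def reflectF4 (k : Fin 4) (v : Fin 4 → ℤ) : Fin 4 → ℤ :=
  fun i => v i - if i = k then ∑ j, v j * CartanMatrix.F₄ j k else 0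

/-- The invariant form of type `F₄` in simple coordinates, with the value `2` on short roots. -/
def gramF4 (v w : Fin 4 → ℤ) : ℤ :=
  ∑ i, ∑ j, v i * w j * !![4, -2, 0, 0; -2, 4, -2, 0; 0, -2, 2, -1; 0, 0, -1, 2] i j

theorem reflectF4_mem (k : Fin 4) :
    ∀ v ∈ posF4, reflectF4 k v ∈ posF4 ∨ -reflectF4 k v ∈ posF4 := by
  revert k
  decide +kernel

/-- Descent by height: every listed vector is reached from a simple root by simple reflections
within the list. -/
theorem exists_reflectF4_lt : ∀ v ∈ posF4, (∃ k, v = Pi.single k 1) ∨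
    ∃ k, reflectF4 k v ∈ posF4 ∧ ∑ i, reflectF4 k v i < ∑ i, v i := by
  decide +kernel

theorem gramF4_short : ∀ v ∈ shortF4, gramF4 v v = 2 := by decide +kernel

theorem gramF4_long : ∀ v ∈ longF4, gramF4 v v = 4 := by decide +kernel

theorem posF4_nonneg : ∀ v ∈ posF4, ∀ i, 0 ≤ v i := by decide +kernel

theorem posF4_le_highest : ∀ v ∈ posF4, ∀ i, v i ≤ highestF4 i := by decide +kernel

theorem single_mem_posF4 : ∀ k, Pi.single k 1 ∈ posF4 := by decide +kernel

theorem shortF4_le : ∀ v ∈ shortF4, ∀ i, v i ≤ ![1, 2, 3, 2] i := by decide +kernel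

theorem one_le_sum_posF4 : ∀ v ∈ posF4, 1 ≤ v 0 + v 1 + v 2 + v 3 := by decide +kernel

/-- Each short positive root involves a short simple root, so on the alcove, where short simple
roots take values above `m`, it takes a value above `m`. -/
theorem one_le_sum_shortF4 : ∀ v ∈ shortF4, 1 ≤ v 2 + v 3 := by decide +kernel

theorem eq_highestF4_of_sum : ∀ v ∈ posF4, 11 ≤ ∑ i, v i → v = highestF4 := by decide +kernel

theorem eq_single_of_sum_le_one : ∀ v ∈ posF4, ∑ i, v i ≤ 1 → ∃ k, v = Pi.single k 1 := by
  decide +kernel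

theorem gramF4_apply (v w : Fin 4 → ℤ) : gramF4 v w =
    4 * v 0 * w 0 + 4 * v 1 * w 1 + 2 * v 2 * w 2 + 2 * v 3 * w 3 - 2 * (v 0 * w 1 + v 1 * w 0) -
      2 * (v 1 * w 2 + v 2 * w 1) - (v 2 * w 3 + v 3 * w 2) := by
  simp only [gramF4, Fin.sum_univ_four, Matrix.of_apply, Matrix.cons_val]
  ring

/-- No relabelling of the diagram preserves the lengths and the highest root. -/
theorem eq_of_single_highestF4 : ∀ a b c d : Fin 4,
    ((∀ i, 2 * (Pi.single a 1 : Fin 4 → ℤ) i + 3 * (Pi.single b 1 : Fin 4 → ℤ) i +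
        4 * (Pi.single c 1 : Fin 4 → ℤ) i + 2 * (Pi.single d 1 : Fin 4 → ℤ) i = highestF4 i) ∧
      gramF4 (Pi.single a 1) (Pi.single a 1) = 4 ∧ gramF4 (Pi.single d 1) (Pi.single d 1) = 2) →
    a = 0 ∧ b = 1 ∧ c = 2 ∧ d = 3 := by
  decide +kernel

/-- The members of `shortF4` that are sums of two members. -/
def decomposableF4 : Finset (Fin 4 → ℤ) :=
  shortF4.filter fun x => ∃ y ∈ shortF4, ∃ z ∈ shortF4, x = y + z

/-- The antichains for `R` of members of a list. -/
def antichainsOfList {α : Type*} [DecidableEq α] (R : α → α → Prop) [DecidableRel R] :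
    List α → Finset (Finset α)
  | [] => {∅}
  | x :: l => antichainsOfList R l ∪
      ((antichainsOfList R l).filter fun Γ => ∀ y ∈ Γ, ¬ R x y ∧ ¬ R y x).image (insert x)

theorem mem_antichainsOfList {α : Type*} [DecidableEq α] (R : α → α → Prop) [DecidableRel R]
    (l : List α) (hl : l.Nodup) (Γ : Finset α) : Γ ∈ antichainsOfList R l ↔
      Γ ⊆ l.toFinset ∧ ∀ x ∈ Γ, ∀ y ∈ Γ, x ≠ y → ¬ R x y := by
  induction l generalizing Γ with
  | nil =>
    simp only [antichainsOfList, Finset.mem_singleton, List.toFinset_nil, Finset.subset_empty]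
    constructor
    · rintro rfl
      simp
    · exact fun h => h.1
  | cons a l ih =>
    obtain ⟨hal, hl⟩ := List.nodup_cons.1 hl
    simp only [antichainsOfList, Finset.mem_union, Finset.mem_image, Finset.mem_filter, ih hl,
      List.toFinset_cons]
    constructor
    · rintro (⟨h1, h2⟩ | ⟨Δ, ⟨⟨h1, h2⟩, h3⟩, rfl⟩)
      · exact ⟨h1.trans (Finset.subset_insert _ _), h2⟩
      · refine ⟨Finset.insert_subset_insert _ h1, fun x hx y hy hxy => ?_⟩
        rcases Finset.mem_insert.1 hx with rfl | hx <;> rcases Finset.mem_insert.1 hy with rfl | hy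
        · exact absurd rfl hxy
        · exact (h3 y (by assumption)).1
        · exact (h3 x (by assumption)).2
        · exact h2 x hx y hy hxy
    · rintro ⟨h1, h2⟩
      by_cases ha : a ∈ Γ
      · refine Or.inr ⟨Γ.erase a, ⟨⟨?_, ?_⟩, ?_⟩, Finset.insert_erase ha⟩
        · intro x hx
          exact (Finset.mem_insert.1 (h1 (Finset.mem_of_mem_erase hx))).resolve_left
            (Finset.ne_of_mem_erase hx)
        · exact fun x hx y hy => h2 x (Finset.mem_of_mem_erase hx) y (Finset.mem_of_mem_erase hy)
        · exact fun y hy => ⟨h2 a ha y (Finset.mem_of_mem_erase hy) (Finset.ne_of_mem_erase hy).symm,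
            h2 y (Finset.mem_of_mem_erase hy) a ha (Finset.ne_of_mem_erase hy)⟩
      · refine Or.inl ⟨fun x hx => (Finset.mem_insert.1 (h1 hx)).resolve_left ?_, h2⟩
        rintro rfl
        exact ha hx

theorem card_antichainFinset_of_list {α : Type*} [DecidableEq α] (R : α → α → Prop)
    [DecidableRel R] (T : Finset α) (l : List α) (hl : l.Nodup) (hT : l.toFinset = T) :
    (antichainFinset R T).card = (antichainsOfList R l).card := by
  congr 1
  ext Γ
  rw [mem_antichainFinset, mem_antichainsOfList R l hl, hT]

theorem card_antichains_shortF4 :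
    (antichainFinset (fun x y : Fin 4 → ℤ => ∀ k, x k ≤ y k) shortF4).card = 21 := by
  rw [card_antichainFinset_of_list (fun x y : Fin 4 → ℤ => ∀ k, x k ≤ y k) shortF4
    [![0, 0, 0, 1], ![0, 0, 1, 0], ![0, 0, 1, 1], ![0, 1, 1, 0], ![0, 1, 1, 1], ![1, 1, 1, 0],
    ![0, 1, 2, 1], ![1, 1, 1, 1], ![1, 1, 2, 1], ![1, 2, 2, 1], ![1, 2, 3, 1], ![1, 2, 3, 2]]
    (by decide +kernel) (by decide +kernel)]
  decide +kernel

theorem card_antichains_decomposableF4 :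
    (antichainFinset (fun x y : Fin 4 → ℤ => ∀ k, x k ≤ y k) decomposableF4).card = 10 := by
  rw [card_antichainFinset_of_list (fun x y : Fin 4 → ℤ => ∀ k, x k ≤ y k) decomposableF4
    [![0, 0, 1, 1], ![0, 1, 1, 1], ![0, 1, 2, 1], ![1, 1, 1, 1], ![1, 1, 2, 1], ![1, 2, 2, 1],
    ![1, 2, 3, 1], ![1, 2, 3, 2]]
    (by decide +kernel) (by decide +kernel)]
  decide +kernel

end VectorsF4

/-! ### Lattice points in the alcove of type `F₄` -/

section AlcoveF4

/-- The number of `(i, j)` with `i + j ≤ a`. -/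
def triangleCount (a : ℕ) : ℕ := ∑ i ∈ Finset.range (a + 1), (a - i + 1)

/-- The number of `(i, j, k)` with `2 i + j + k ≤ a`. -/
def wedgeCount (a : ℕ) : ℕ := ∑ i ∈ Finset.range (a / 2 + 1), triangleCount (a - 2 * i)

/-- The solutions of `3 n₁ + 4 n₂ + 2 n₀ + 2 n₃ ≤ r`, as tuples `(n₁, n₂, n₀, n₃)`. -/
def alcoveTuples (r : ℕ) : Finset (Σ _ : ℕ, Σ _ : ℕ, Σ _ : ℕ, ℕ) :=
  (Finset.range (r / 3 + 1)).sigma fun i => (Finset.range ((r - 3 * i) / 2 / 2 + 1)).sigma fun j =>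
    (Finset.range ((r - 3 * i) / 2 - 2 * j + 1)).sigma fun k =>
      Finset.range ((r - 3 * i) / 2 - 2 * j - k + 1)

theorem mem_alcoveTuples {r : ℕ} {x : Σ _ : ℕ, Σ _ : ℕ, Σ _ : ℕ, ℕ} : x ∈ alcoveTuples r ↔
    3 * x.1 + 4 * x.2.1 + 2 * x.2.2.1 + 2 * x.2.2.2 ≤ r := by
  simp only [alcoveTuples, Finset.mem_sigma, Finset.mem_range]
  omega

theorem triangleCount_succ (a : ℕ) : triangleCount (a + 1) = triangleCount a + (a + 2) := by
  rw [triangleCount, Finset.sum_range_succ', triangleCount]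
  simp

theorem two_mul_triangleCount (a : ℕ) : 2 * triangleCount a = (a + 1) * (a + 2) := by
  induction a with
  | zero => rfl
  | succ a ih => rw [triangleCount_succ, mul_add, ih]; ring

theorem wedgeCount_add_two (a : ℕ) :
    wedgeCount (a + 2) = wedgeCount a + triangleCount (a + 2) := by
  rw [wedgeCount, show (a + 2) / 2 + 1 = a / 2 + 1 + 1 by omega, Finset.sum_range_succ', wedgeCount]
  congr 1
  exact Finset.sum_congr rfl fun i _ => by congr 1; omega

/-- `wedgeCount` is a quasi-polynomial of period `2`, but the sum of two consecutive values is a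
polynomial. -/
theorem six_mul_wedgeCount_add (a : ℕ) :
    6 * (wedgeCount (a + 1) + wedgeCount a) = (a + 2) * (a + 3) * (a + 4) := by
  induction a with
  | zero => rfl
  | succ a ih =>
    rw [wedgeCount_add_two]
    have h := two_mul_triangleCount (a + 2)
    nlinarith

theorem card_alcoveTuples (r : ℕ) : (alcoveTuples r).card =
    ∑ i ∈ Finset.range (r / 3 + 1), wedgeCount ((r - 3 * i) / 2) := by
  simp only [alcoveTuples, Finset.card_sigma, Finset.card_range]
  rfl

/-- The tuples with first entry `0` or `1` are split off; the other ones are shifted by `2`. -/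
theorem card_alcoveTuples_add_six (r : ℕ) : (alcoveTuples (r + 6)).card =
    (alcoveTuples r).card + wedgeCount ((r + 3) / 2) + wedgeCount ((r + 6) / 2) := by
  rw [card_alcoveTuples, card_alcoveTuples, show (r + 6) / 3 + 1 = r / 3 + 1 + 1 + 1 by omega,
    Finset.sum_range_succ', Finset.sum_range_succ']
  congr 2
  exact Finset.sum_congr rfl fun i _ => by congr 1; omega

theorem eight_mul_card_alcoveTuples (w : ℕ) : 8 * (alcoveTuples (6 * w + 1)).card =
    (w + 1) * (w + 2) * (3 * w + 1) * (3 * w + 4) := by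
  induction w with
  | zero => rfl
  | succ w ih =>
    rw [show 6 * (w + 1) + 1 = 6 * w + 1 + 6 by ring, card_alcoveTuples_add_six,
      show (6 * w + 1 + 3) / 2 = 3 * w + 2 by omega,
      show (6 * w + 1 + 6) / 2 = 3 * w + 2 + 1 by omega]
    have h := six_mul_wedgeCount_add (3 * w + 2)
    nlinarith

end AlcoveF4

/-! ### Roots and antichains of type `F₄` -/

section RootsF4

variable {ι V N : Type*} [NormedAddCommGroup V] [InnerProductSpace ℝ V]
  [AddCommGroup N] [Module ℝ N] {P : RootPairing ι ℝ V N} [P.IsRootSystem]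

/-- The numbered base `e` has type `F₄` and `s` is the squared length of the short roots. -/
structure IsBaseF4 (b : P.Base) (e : Fin 4 ≃ b.support) (s : ℝ) : Prop where
  pos : 0 < s
  inner_eq : ∀ v w, inner ℝ (intComb (simpleBasis b e) v) (intComb (simpleBasis b e) w) =
    s / 2 * gramF4 v w
  reflection_eq : ∀ k v, P.reflection (e k) (intComb (simpleBasis b e) v) =
    intComb (simpleBasis b e) (reflectF4 k v)

theorem exists_isBaseF4 [P.IsCrystallographic] (hinv : IsWeylInvariantInner P) (b : P.Base)
    (e : Fin 4 ≃ b.support) (hA : numberedCartanMatrix b e = CartanMatrix.F₄) :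
    ∃ s, IsBaseF4 b e s := by
  set G : Fin 4 → Fin 4 → ℝ := fun i j => inner ℝ (P.root (e i)) (P.root (e j)) with hG
  have hsymm : ∀ i j, G i j = G j i := fun i j => real_inner_comm _ _
  have hAG : ∀ i j, (CartanMatrix.F₄ i j : ℝ) * G j j = 2 * G i j :=
    fun i j => hA ▸ cartan_mul_inner_self hinv b e i j
  refine ⟨G 3 3, inner_root_self_pos _, fun v w => ?_, fun k v => ?_⟩
  · have h01 := hAG 0 1
    have h10 := hAG 1 0
    have h02 := hAG 0 2
    have h03 := hAG 0 3
    have h13 := hAG 1 3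
    have h12 := hAG 1 2
    have h21 := hAG 2 1
    have h23 := hAG 2 3
    have h32 := hAG 3 2
    simp only [CartanMatrix.F₄, Matrix.of_apply, Matrix.cons_val] at h01 h10 h02 h03 h13 h12 h21 h23 h32
    push_cast at h01 h10 h02 h03 h13 h12 h21 h23 h32
    have s10 := hsymm 1 0
    have s20 := hsymm 2 0
    have s30 := hsymm 3 0
    have s21 := hsymm 2 1
    have s31 := hsymm 3 1
    have s32 := hsymm 3 2
    have e23 : G 2 3 = -(G 3 3 / 2) := by linarith
    have e22 : G 2 2 = G 3 3 := by linarith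
    have e12 : G 1 2 = -G 3 3 := by linarith
    have e11 : G 1 1 = 2 * G 3 3 := by linarith
    have e01 : G 0 1 = -G 3 3 := by linarith
    have e00 : G 0 0 = 2 * G 3 3 := by linarith
    have e02 : G 0 2 = 0 := by linarith
    have e03 : G 0 3 = 0 := by linarith
    have e13 : G 1 3 = 0 := by linarith
    have hexp : inner ℝ (intComb (simpleBasis b e) v) (intComb (simpleBasis b e) w) =
        ∑ i, ∑ j, (v i : ℝ) * w j * G i j := by
      simp only [intComb, sum_inner, inner_sum, real_inner_smul_left, real_inner_smul_right,
        simpleBasis_apply, hG]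
      rw [Finset.sum_comm]
      exact Finset.sum_congr rfl fun i _ => Finset.sum_congr rfl fun j _ => by ring
    rw [hexp, gramF4_apply]
    simp only [Fin.sum_univ_four, s10, s20, s30, s21, s31, s32, e23, e22, e12, e11, e01, e00, e02,
      e03, e13]
    push_cast
    ring
  · have hpair : ∀ j, P.coroot' (e k) (P.root (e j)) = (CartanMatrix.F₄ j k : ℝ) := by
      intro j
      rw [← hA]
      exact (b.algebraMap_cartanMatrixIn_apply ℤ (e j) (e k)).symm
    have hcoroot : P.coroot' (e k) (intComb (simpleBasis b e) v) =
        ((∑ j, v j * CartanMatrix.F₄ j k : ℤ) : ℝ) := by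
      simp only [intComb, map_sum, map_smul, simpleBasis_apply, hpair, smul_eq_mul]
      push_cast
      rfl
    rw [P.reflection_apply, hcoroot, ← simpleBasis_apply, ← intComb_single, ← intComb_sub]
    congr 1
    ext i
    simp [reflectF4, Pi.single_apply]

namespace IsBaseF4

variable {b : P.Base} {e : Fin 4 ≃ b.support} {s : ℝ}

theorem exists_vector [Finite ι] [P.IsCrystallographic] [P.IsReduced] (H : IsBaseF4 b e s) (i : ι) :
    ∃ v, (v ∈ posF4 ∨ -v ∈ posF4) ∧ P.root i = intComb (simpleBasis b e) v := by
  have hneg : ∀ v : Fin 4 → ℤ, intComb (simpleBasis b e) (-v) = -intComb (simpleBasis b e) v := by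
    intro v
    simp [intComb]
  refine b.induction_reflect i ?_ ?_ ?_
    (p := fun i => ∃ v, (v ∈ posF4 ∨ -v ∈ posF4) ∧ P.root i = intComb (simpleBasis b e) v)
  · rintro i ⟨v, hv, hi⟩
    refine ⟨-v, by rw [neg_neg]; exact hv.symm, ?_⟩
    rw [P.root_reflectionPerm, P.reflection_apply_self, hi, hneg]
  · intro i hi
    refine ⟨Pi.single (e.symm ⟨i, hi⟩) 1, Or.inl (single_mem_posF4 _), ?_⟩
    rw [intComb_single, simpleBasis_apply]
    simp
  · rintro i j ⟨v, hv, hi⟩ hj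
    have hr := H.reflection_eq (e.symm ⟨j, hj⟩) v
    rw [e.apply_symm_apply] at hr
    refine ⟨reflectF4 (e.symm ⟨j, hj⟩) v, ?_, by rw [P.root_reflectionPerm, hi, hr]⟩
    rcases hv with hv | hv
    · exact reflectF4_mem _ v hv
    · have h := reflectF4_mem (e.symm ⟨j, hj⟩) (-v) hv
      have hn : reflectF4 (e.symm ⟨j, hj⟩) (-v) = -reflectF4 (e.symm ⟨j, hj⟩) v := by
        ext i
        simp only [reflectF4, Pi.neg_apply, neg_mul, Finset.sum_neg_distrib]
        split_ifs <;> ring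
      rw [hn, neg_neg] at h
      exact h.symm

theorem exists_root (H : IsBaseF4 b e s) :
    ∀ v ∈ posF4, ∃ i, P.root i = intComb (simpleBasis b e) v := by
  have key : ∀ (n : ℕ) (v : Fin 4 → ℤ), v ∈ posF4 → ∑ i, v i < n →
      ∃ i, P.root i = intComb (simpleBasis b e) v := by
    intro n
    induction n with
    | zero =>
      intro v hv hn
      have := Finset.sum_nonneg fun i (_ : i ∈ Finset.univ) => posF4_nonneg v hv i
      push_cast at hn
      omega
    | succ n ih =>
      intro v hv hn
      rcases exists_reflectF4_lt v hv with ⟨k, rfl⟩ | ⟨k, hk, hlt⟩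
      · exact ⟨e k, by rw [intComb_single, simpleBasis_apply]; simp⟩
      · obtain ⟨i, hi⟩ := ih _ hk (by push_cast at hn; omega)
        refine ⟨P.reflectionPerm (e k) i, ?_⟩
        rw [P.root_reflectionPerm, hi, ← H.reflection_eq, ← P.reflection_inv]
        exact (P.reflection (e k)).symm_apply_apply _
  intro v hv
  refine key ((∑ i, v i).toNat + 1) v hv ?_
  push_cast
  omega

theorem isPos_of_vector {i : ι} {v : Fin 4 → ℤ} (hv : v ∈ posF4)
    (hi : P.root i = intComb (simpleBasis b e) v) : b.IsPos i := by
  rw [isPos_iff_repr_nonneg b e, hi]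
  intro k
  rw [basis_repr_intComb]
  exact_mod_cast posF4_nonneg v hv k

theorem inner_self_eq (H : IsBaseF4 b e s) {i : ι} {v : Fin 4 → ℤ}
    (hi : P.root i = intComb (simpleBasis b e) v) :
    inner ℝ (P.root i) (P.root i) = s / 2 * gramF4 v v := by
  rw [hi, H.inner_eq]

theorem gramF4_neg (v : Fin 4 → ℤ) : gramF4 (-v) (-v) = gramF4 v v := by
  rw [gramF4_apply, gramF4_apply]
  simp only [Pi.neg_apply]
  ring

theorem rootLE_iff {i j : ι} {v w : Fin 4 → ℤ}
    (hi : P.root i = intComb (simpleBasis b e) v) (hj : P.root j = intComb (simpleBasis b e) w) :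
    RootLE b i j ↔ ∀ k, v k ≤ w k := by
  rw [rootLE_iff_repr_le b e, hi, hj]
  simp only [basis_repr_intComb, Int.cast_le]

section

variable [Finite ι] [P.IsCrystallographic] [P.IsReduced]

theorem exists_vector_of_isPos (H : IsBaseF4 b e s) {i : ι} (hi : b.IsPos i) :
    ∃ v ∈ posF4, P.root i = intComb (simpleBasis b e) v := by
  obtain ⟨v, hv | hv, h⟩ := H.exists_vector i
  · exact ⟨v, hv, h⟩
  · exfalso
    rw [isPos_iff_repr_nonneg b e, h] at hi
    have h0 : ∀ k, 0 ≤ v k := fun k => by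
      have := hi k
      rw [basis_repr_intComb] at this
      exact_mod_cast this
    have h1 := one_le_sum_posF4 (-v) hv
    have h2 := fun k => posF4_nonneg (-v) hv k
    simp only [Pi.neg_apply] at h1 h2
    have := h0 0
    have := h0 1
    have := h0 2
    have := h0 3
    omega

theorem inner_self_cases (H : IsBaseF4 b e s) (i : ι) :
    inner ℝ (P.root i) (P.root i) = s ∨ inner ℝ (P.root i) (P.root i) = 2 * s := by
  have key : ∀ v ∈ posF4, gramF4 v v = 2 ∨ gramF4 v v = 4 := by
    intro v hv
    rcases Finset.mem_union.1 hv with hv | hv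
    · exact Or.inl (gramF4_short v hv)
    · exact Or.inr (gramF4_long v hv)
  obtain ⟨v, hv, h⟩ := H.exists_vector i
  rw [H.inner_self_eq h]
  have : gramF4 v v = 2 ∨ gramF4 v v = 4 := by
    rcases hv with hv | hv
    · exact key v hv
    · rw [← gramF4_neg]
      exact key _ hv
  rcases this with h | h <;> rw [h]
  · exact Or.inl (by push_cast; ring)
  · exact Or.inr (by push_cast; ring)

theorem isShortRoot_iff (H : IsBaseF4 b e s) (i : ι) :
    IsShortRoot P i ↔ inner ℝ (P.root i) (P.root i) = s := by
  have hs := H.pos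
  obtain ⟨j, hj⟩ := H.exists_root ![0, 0, 0, 1] (by decide)
  have hj' := H.inner_self_eq hj
  rw [gramF4_short _ (by decide)] at hj'
  push_cast at hj'
  simp only [IsShortRoot, norm_le_norm_iff_inner]
  constructor
  · intro h
    have := h j
    rcases H.inner_self_cases i with h' | h' <;> linarith
  · intro h k
    rcases H.inner_self_cases k with h' | h' <;> linarith

theorem isLongRoot_iff (H : IsBaseF4 b e s) (i : ι) :
    IsLongRoot P i ↔ inner ℝ (P.root i) (P.root i) = 2 * s := by
  have hs := H.pos
  obtain ⟨j, hj⟩ := H.exists_root ![1, 0, 0, 0] (by decide)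
  have hj' := H.inner_self_eq hj
  rw [gramF4_long _ (by decide)] at hj'
  push_cast at hj'
  simp only [IsLongRoot, norm_le_norm_iff_inner]
  constructor
  · intro h
    have := h j
    rcases H.inner_self_cases i with h' | h' <;> linarith
  · intro h k
    rcases H.inner_self_cases k with h' | h' <;> linarith

theorem isShortPos_iff (H : IsBaseF4 b e s) (i : ι) :
    IsShortPos b i ↔ ∃ v ∈ shortF4, P.root i = intComb (simpleBasis b e) v := by
  have hs := H.pos
  rw [IsShortPos, H.isShortRoot_iff]
  constructor
  · rintro ⟨hi, hn⟩
    obtain ⟨v, hv, h⟩ := H.exists_vector_of_isPos hi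
    refine ⟨v, (Finset.mem_union.1 hv).resolve_right fun hl => ?_, h⟩
    rw [H.inner_self_eq h, gramF4_long v hl] at hn
    push_cast at hn
    linarith
  · rintro ⟨v, hv, h⟩
    refine ⟨isPos_of_vector (Finset.mem_union_left _ hv) h, ?_⟩
    rw [H.inner_self_eq h, gramF4_short v hv]
    push_cast
    ring

theorem isLongPos_iff (H : IsBaseF4 b e s) (i : ι) :
    (b.IsPos i ∧ IsLongRoot P i) ↔ ∃ v ∈ longF4, P.root i = intComb (simpleBasis b e) v := by
  have hs := H.pos
  rw [H.isLongRoot_iff]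
  constructor
  · rintro ⟨hi, hn⟩
    obtain ⟨v, hv, h⟩ := H.exists_vector_of_isPos hi
    refine ⟨v, (Finset.mem_union.1 hv).resolve_left fun hl => ?_, h⟩
    rw [H.inner_self_eq h, gramF4_short v hl] at hn
    push_cast at hn
    linarith
  · rintro ⟨v, hv, h⟩
    refine ⟨isPos_of_vector (Finset.mem_union_right _ hv) h, ?_⟩
    rw [H.inner_self_eq h, gramF4_long v hv]
    push_cast
    ring

theorem isRootModel (H : IsBaseF4 b e s) : IsRootModel b (simpleBasis b e) shortF4 longF4 := by
  constructor
  · intro x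
    simp only [H.isShortPos_iff]
    constructor
    · rintro ⟨i, ⟨v, hv, h⟩, rfl⟩
      exact ⟨v, hv, h.symm⟩
    · rintro ⟨v, hv, rfl⟩
      obtain ⟨i, hi⟩ := H.exists_root v (Finset.mem_union_left _ hv)
      exact ⟨i, ⟨v, hv, hi⟩, hi⟩
  · intro x
    simp only [H.isLongPos_iff]
    constructor
    · rintro ⟨i, ⟨v, hv, h⟩, rfl⟩
      exact ⟨v, hv, h.symm⟩
    · rintro ⟨v, hv, rfl⟩
      obtain ⟨i, hi⟩ := H.exists_root v (Finset.mem_union_right _ hv)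
      exact ⟨i, ⟨v, hv, hi⟩, hi⟩

theorem isHighestRoot (H : IsBaseF4 b e s) {θ : ι}
    (hθ : P.root θ = intComb (simpleBasis b e) highestF4) : IsHighestRoot b θ := by
  intro i
  obtain ⟨v, hv, h⟩ := H.exists_vector i
  rw [rootLE_iff h hθ]
  intro k
  rcases hv with hv | hv
  · exact posF4_le_highest v hv k
  · have h1 := posF4_nonneg (-v) hv k
    have h2 := posF4_nonneg highestF4 (by decide) k
    rw [Pi.neg_apply] at h1
    omega

theorem shortCoordSum_eq (H : IsBaseF4 b e s) {θ : ι} (hθ : IsHighestRoot b θ) {c : Fin 4 → ℕ}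
    (hc : P.root θ = ∑ i, c i • P.root (e i)) : shortCoordSum b e c = 6 := by
  have hs := H.pos
  obtain ⟨i, hi⟩ := H.exists_root highestF4 (by decide)
  obtain rfl := highestRoot_unique b e hθ (H.isHighestRoot hi)
  have hck : ∀ k, (c k : ℤ) = highestF4 k := by
    intro k
    have h := natCoord_eq_repr hc k
    rw [hi, basis_repr_intComb] at h
    exact_mod_cast h
  have hshort : ∀ k, IsShortRoot P (e k : ι) ↔ k = 2 ∨ k = 3 := by
    intro k
    have hk : P.root (e k) = intComb (simpleBasis b e) (Pi.single k 1) := by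
      rw [intComb_single, simpleBasis_apply]
      simp
    have hg : gramF4 (Pi.single k 1) (Pi.single k 1) = if k = 2 ∨ k = 3 then 2 else 4 := by
      clear hk
      revert k
      decide +kernel
    rw [H.isShortRoot_iff, H.inner_self_eq hk, hg]
    split_ifs with h
    · simp only [h, iff_true]
      push_cast
      ring
    · simp only [h, iff_false]
      push_cast
      intro h'
      linarith
  rw [shortCoordSum_eq_sum hshort, show (Finset.univ.filter fun k : Fin 4 => k = 2 ∨ k = 3) = {2, 3}
    by decide, Finset.sum_pair (by decide)]
  have h2 := hck 2
  have h3 := hck 3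
  simp only [highestF4, Matrix.cons_val] at h2 h3
  omega

theorem ncard_antichains (H : IsBaseF4 b e s) :
    (shortAntichains b).ncard = 21 ∧ (strictlyPosShortAntichains b).ncard = 10 := by
  classical
  have hex : ∀ v : Fin 4 → ℤ, ∃ i, v ∈ posF4 → P.root i = intComb (simpleBasis b e) v := by
    intro v
    by_cases hv : v ∈ posF4
    · obtain ⟨i, hi⟩ := H.exists_root v hv
      exact ⟨i, fun _ => hi⟩
    · exact ⟨e 0, fun h => absurd h hv⟩
  choose ρ hρ' using hex
  have hρ : ∀ v ∈ shortF4, P.root (ρ v) = intComb (simpleBasis b e) v := fun v hv =>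
    hρ' v (Finset.mem_union_left _ hv)
  have hshort : ∀ i, IsShortPos b i ↔ ∃ v ∈ shortF4, ρ v = i := by
    intro i
    rw [H.isShortPos_iff]
    constructor
    · rintro ⟨v, hv, h⟩
      exact ⟨v, hv, P.root.injective ((hρ v hv).trans h.symm)⟩
    · rintro ⟨v, hv, rfl⟩
      exact ⟨v, hv, hρ v hv⟩
  have hinj : ∀ v ∈ shortF4, ∀ w ∈ shortF4, ρ v = ρ w → v = w := by
    intro v hv w hw h
    exact intComb_injective (simpleBasis b e) (by rw [← hρ v hv, ← hρ w hw, h])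
  have hle : ∀ v ∈ shortF4, ∀ w ∈ shortF4, RootLE b (ρ v) (ρ w) ↔ ∀ k, v k ≤ w k :=
    fun v hv w hw => rootLE_iff (hρ v hv) (hρ w hw)
  have hsub : ∀ v ∈ decomposableF4, v ∈ shortF4 := fun v hv => (Finset.mem_filter.1 hv).1
  have hstrict : ∀ i, i ∈ {i | IsShortPos b i ∧ ¬ IsShortSimple b i} ↔
      ∃ v ∈ decomposableF4, ρ v = i := by
    intro i
    simp only [Set.mem_ofPred_eq, IsShortSimple, not_and_not_right]
    constructor
    · rintro ⟨hi, h⟩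
      obtain ⟨j, k, hj, hk, hjk⟩ := h hi
      obtain ⟨v, hv, rfl⟩ := (hshort i).1 hi
      obtain ⟨w, hw, rfl⟩ := (hshort j).1 hj
      obtain ⟨x, hx, rfl⟩ := (hshort k).1 hk
      refine ⟨v, Finset.mem_filter.2 ⟨hv, w, hw, x, hx, ?_⟩, rfl⟩
      rw [hρ v hv, hρ w hw, hρ x hx, ← intComb_add] at hjk
      exact intComb_injective _ hjk
    · rintro ⟨v, hv, rfl⟩
      obtain ⟨hv, w, hw, x, hx, rfl⟩ := Finset.mem_filter.1 hv
      refine ⟨(hshort _).2 ⟨_, hv, rfl⟩, fun _ => ⟨ρ w, ρ x, (hshort _).2 ⟨w, hw, rfl⟩,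
        (hshort _).2 ⟨x, hx, rfl⟩, ?_⟩⟩
      rw [hρ _ hv, hρ w hw, hρ x hx, intComb_add]
  constructor
  · rw [← card_antichains_shortF4]
    exact ncard_antichain_eq_card shortF4 ρ {i | IsShortPos b i} _ _ hshort hinj hle
  · rw [strictlyPosShortAntichains_eq, ← card_antichains_decomposableF4]
    exact ncard_antichain_eq_card decomposableF4 ρ _ _ _ hstrict
      (fun v hv w hw => hinj v (hsub v hv) w (hsub w hw))
      (fun v hv w hw => hle v (hsub v hv) w (hsub w hw))

end

end IsBaseF4

end RootsF4

/-! ### The Weyl group in simple coordinates -/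

section WeylCoordinates

variable {ι V N : Type*} [NormedAddCommGroup V] [InnerProductSpace ℝ V]
  [AddCommGroup N] [Module ℝ N] {P : RootPairing ι ℝ V N} [P.IsRootSystem] {p : ℕ}
  (b : P.Base) (e : Fin p ≃ b.support)

theorem exists_weylCoords (w : P.weylGroup) (k : Fin p) :
    ∃ f, w • P.root (e k) = intComb (simpleBasis b e) f := by
  rw [P.weylGroup_apply_root]
  obtain ⟨f, hf, -⟩ := exists_int_coords b e (P.weylGroupToPerm w (e k))
  exact ⟨f, hf⟩

/-- The simple coordinates of the image under `w` of the `k`-th simple root. -/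
noncomputable def weylCoords (w : P.weylGroup) (k : Fin p) : Fin p → ℤ :=
  (exists_weylCoords b e w k).choose

theorem smul_simple (w : P.weylGroup) (k : Fin p) :
    w • P.root (e k) = intComb (simpleBasis b e) (weylCoords b e w k) :=
  (exists_weylCoords b e w k).choose_spec

/-- The action of the Weyl group on the root lattice in simple coordinates. -/
noncomputable def weylAct (w : P.weylGroup) (v : Fin p → ℤ) : Fin p → ℤ :=
  fun j => ∑ k, v k * weylCoords b e w k j

theorem smul_intComb (w : P.weylGroup) (v : Fin p → ℤ) :
    w • intComb (simpleBasis b e) v = intComb (simpleBasis b e) (weylAct b e w v) := by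
  have h : w • intComb (simpleBasis b e) v =
      ∑ k, (v k : ℝ) • intComb (simpleBasis b e) (weylCoords b e w k) := by
    rw [intComb, Finset.smul_sum]
    refine Finset.sum_congr rfl fun k _ => ?_
    rw [weylGroup_smul_smul, simpleBasis_apply, smul_simple]
  rw [h]
  simp only [intComb, weylAct, Finset.smul_sum, smul_smul]
  rw [Finset.sum_comm]
  refine Finset.sum_congr rfl fun j _ => ?_
  rw [← Finset.sum_smul]
  push_cast
  rfl

theorem weylAct_eq_of_smul {w : P.weylGroup} {v v' : Fin p → ℤ}
    (h : w • intComb (simpleBasis b e) v = intComb (simpleBasis b e) v') :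
    weylAct b e w v = v' :=
  intComb_injective (simpleBasis b e) (by rw [← smul_intComb, h])

theorem weylAct_single (w : P.weylGroup) (k : Fin p) :
    weylAct b e w (Pi.single k 1) = weylCoords b e w k := by
  refine weylAct_eq_of_smul b e ?_
  rw [intComb_single, Int.cast_one, one_smul, simpleBasis_apply, smul_simple]

theorem weylAct_mul (w u : P.weylGroup) (v : Fin p → ℤ) :
    weylAct b e (w * u) v = weylAct b e w (weylAct b e u v) := by
  refine weylAct_eq_of_smul b e ?_
  rw [mul_smul, smul_intComb, smul_intComb]

theorem weylAct_one (v : Fin p → ℤ) : weylAct b e 1 v = v :=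
  weylAct_eq_of_smul b e (one_smul _ _)

theorem finite_weylGroup [Finite ι] (b : P.Base) (e : Fin p ≃ b.support) : Finite P.weylGroup := by
  refine Finite.of_injective P.weylGroupToPerm fun w w' h => ?_
  refine weylGroup_eq_of_smul_basis (simpleBasis b e) fun k => ?_
  rw [simpleBasis_apply, P.weylGroup_apply_root, P.weylGroup_apply_root, h]

variable {K : Type*} [CommRing K]

/-- The contragredient right action: the coordinates of `x ↦ y (w x)`, for `y` a linear form on
the root lattice given by its values on the simple roots. -/
noncomputable def weylPull (w : P.weylGroup) (y : Fin p → K) : Fin p → K :=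
  fun k => evalForm (weylCoords b e w k) y

theorem evalForm_weylAct (w : P.weylGroup) (v : Fin p → ℤ) (y : Fin p → K) :
    evalForm (weylAct b e w v) y = evalForm v (weylPull b e w y) := by
  simp only [evalForm, weylAct, weylPull, Finset.mul_sum, Int.cast_sum, Finset.sum_mul]
  rw [Finset.sum_comm]
  refine Finset.sum_congr rfl fun k _ => Finset.sum_congr rfl fun j _ => ?_
  push_cast
  ring

theorem weylPull_weylPull (w u : P.weylGroup) (y : Fin p → K) :
    weylPull b e u (weylPull b e w y) = weylPull b e (w * u) y := by
  ext k
  rw [weylPull, ← evalForm_weylAct, ← weylAct_single, ← weylAct_mul, weylAct_single, weylPull]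

theorem weylPull_one (y : Fin p → K) : weylPull b e 1 y = y := by
  ext k
  rw [weylPull, ← weylAct_single, weylAct_one, evalForm_single]
  simp

theorem evalForm_intCast (v y : Fin p → ℤ) :
    evalForm v (fun k => (y k : K)) = ((evalForm v y : ℤ) : K) := by
  simp [evalForm]

theorem weylPull_intCast (w : P.weylGroup) (y : Fin p → ℤ) :
    weylPull b e w (fun k => (y k : K)) = fun k => ((weylPull b e w y k : ℤ) : K) := by
  ext k
  rw [weylPull, evalForm_intCast]
  rfl

end WeylCoordinates

/-! ### Weyl translates of the alcove of type `F₄` -/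

section WeylF4

theorem evalForm_four {K : Type*} [CommRing K] (v : Fin 4 → ℤ) (y : Fin 4 → K) :
    evalForm v y = v 0 * y 0 + v 1 * y 1 + v 2 * y 2 + v 3 * y 3 := by
  rw [evalForm, Fin.sum_univ_four]

theorem evalForm_neg {K : Type*} [CommRing K] {p : ℕ} (v : Fin p → ℤ) (y : Fin p → K) :
    evalForm (-v) y = -evalForm v y := by
  simp [evalForm]

/-- The points modulo `q` off the `m`-semi-Catalan arrangement of type `F₄`. -/
def IsAvoidingF4 (m : ℕ) {q : ℕ} (z : Fin 4 → ZMod q) : Prop :=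
  (∀ v ∈ shortF4, ∀ k ∈ Finset.Icc (-(m : ℤ)) m, evalForm v z ≠ k) ∧
    ∀ v ∈ longF4, evalForm v z ≠ 0

/-- The integral points of the fundamental alcove, dilated by `q`, with values more than `m` on
the short simple roots. -/
structure InAlcoveF4 (m q : ℕ) (y : Fin 4 → ℤ) : Prop where
  zero : 1 ≤ y 0
  one : 1 ≤ y 1
  two : m + 1 ≤ y 2
  three : m + 1 ≤ y 3
  highest : 2 * y 0 + 3 * y 1 + 4 * y 2 + 2 * y 3 + 1 ≤ q

theorem InAlcoveF4.one_le {m q : ℕ} {y : Fin 4 → ℤ} (h : InAlcoveF4 m q y) (k : Fin 4) :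
    1 ≤ y k := by
  obtain ⟨h0, h1, h2, h3, -⟩ := h
  fin_cases k <;> simp only [Fin.reduceFinMk, Fin.zero_eta, Fin.mk_one] <;> omega

theorem InAlcoveF4.bounds_pos {m q : ℕ} {y : Fin 4 → ℤ} (h : InAlcoveF4 m q y) :
    ∀ v ∈ posF4, 1 ≤ evalForm v y ∧ evalForm v y < q := by
  intro v hv
  have hn := posF4_nonneg v hv
  have hle := posF4_le_highest v hv
  have h1 := one_le_sum_posF4 v hv
  have h5 := h.highest
  have a := fun k => mul_nonneg (hn k) (sub_nonneg.2 (h.one_le k))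
  have c := fun k => mul_nonneg (sub_nonneg.2 (hle k)) (zero_le_one.trans (h.one_le k))
  have a0 := a 0
  have a1 := a 1
  have a2 := a 2
  have a3 := a 3
  have c0 := c 0
  have c1 := c 1
  have c2 := c 2
  have c3 := c 3
  simp only [highestF4, Matrix.cons_val] at c0 c1 c2 c3
  rw [evalForm_four]
  simp only [Int.cast_id]
  constructor <;> linarith

theorem InAlcoveF4.bounds_short {m q : ℕ} {y : Fin 4 → ℤ} (h : InAlcoveF4 m q y) :
    ∀ v ∈ shortF4, m + 1 ≤ evalForm v y ∧ evalForm v y + m + 1 ≤ q := by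
  intro v hv
  have hn := posF4_nonneg v (Finset.mem_union_left _ hv)
  have hle := shortF4_le v hv
  have h1 := one_le_sum_shortF4 v hv
  have h5 := h.highest
  have h2 := h.two
  have g0 := h.one_le 0
  have g1 := h.one_le 1
  have a0 := mul_nonneg (hn 0) (zero_le_one.trans (h.one_le 0))
  have a1 := mul_nonneg (hn 1) (zero_le_one.trans (h.one_le 1))
  have a2 := mul_nonneg (hn 2) (sub_nonneg.2 h.two)
  have a3 := mul_nonneg (hn 3) (sub_nonneg.2 h.three)
  have c := fun k => mul_nonneg (sub_nonneg.2 (hle k)) (zero_le_one.trans (h.one_le k))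
  have c0 := c 0
  have c1 := c 1
  have c2 := c 2
  have c3 := c 3
  simp only [Matrix.cons_val] at c0 c1 c2 c3
  have hm : (0 : ℤ) ≤ (v 2 + v 3 - 1) * m := mul_nonneg (by omega) (by omega)
  rw [evalForm_four]
  simp only [Int.cast_id]
  constructor <;> linarith

/-- The squared length, on forms given by their values on the simple roots, that makes the long
coroots have squared length `2`. -/
def energyF4 (y : Fin 4 → ℤ) : ℤ :=
  y 2 ^ 2 + (y 1 + y 2) ^ 2 + (y 0 + y 1 + y 2) ^ 2 + (y 0 + 2 * y 1 + 3 * y 2 + 2 * y 3) ^ 2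

/-- The squared distance from `y` to the point of the dilated alcove on which every simple root has
the value `q / 12`, scaled by `12`. -/
def distanceF4 (q : ℕ) (y : Fin 4 → ℤ) : ℤ := energyF4 fun k => 12 * y k - q

theorem distanceF4_nonneg (q : ℕ) (y : Fin 4 → ℤ) : 0 ≤ distanceF4 q y := by
  rw [distanceF4, energyF4]
  positivity

/-- A simple reflection lowers the distance of a point on the negative side. -/
theorem distanceF4_reflect_lt (q : ℕ) (hq : 0 < q) (y : Fin 4 → ℤ) (k : Fin 4) (hk : y k < 0) :
    distanceF4 q (fun j => y j - CartanMatrix.F₄ j k * y k) < distanceF4 q y := by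
  have hq' : (0 : ℤ) < q := by exact_mod_cast hq
  have hneg := mul_neg_of_pos_of_neg hq' hk
  have key : ∃ c : ℤ, 0 < c ∧ distanceF4 q (fun j => y j - CartanMatrix.F₄ j k * y k) =
      distanceF4 q y + c * (q * y k) := by
    fin_cases k
    · exact ⟨24, by norm_num, by
        simp [distanceF4, energyF4, CartanMatrix.F₄]; ring⟩
    · exact ⟨24, by norm_num, by
        simp [distanceF4, energyF4, CartanMatrix.F₄]; ring⟩
    · exact ⟨48, by norm_num, by
        simp [distanceF4, energyF4, CartanMatrix.F₄]; ring⟩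
    · exact ⟨48, by norm_num, by
        simp [distanceF4, energyF4, CartanMatrix.F₄]; ring⟩
  obtain ⟨c, hc, h⟩ := key
  rw [h]
  have := mul_neg_of_pos_of_neg hc hneg
  omega

/-- The affine reflection lowers the distance of a point beyond the wall of the highest root. -/
theorem distanceF4_affine_lt (q : ℕ) (hq : 0 < q) (y : Fin 4 → ℤ)
    (hy : (q : ℤ) < evalForm highestF4 y) :
    distanceF4 q (fun j => y j - if j = 0 then evalForm highestF4 y - q else 0) <
      distanceF4 q y := by
  have hq' : (0 : ℤ) < q := by exact_mod_cast hq
  have hpos := mul_pos hq' (sub_pos.2 hy)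
  have key : distanceF4 q (fun j => y j - if j = 0 then evalForm highestF4 y - q else 0) =
      distanceF4 q y - 24 * (q * (evalForm highestF4 y - q)) := by
    rw [evalForm_four]
    simp [distanceF4, energyF4, highestF4]
    ring
  rw [key]
  omega

variable {ι V N : Type*} [NormedAddCommGroup V] [InnerProductSpace ℝ V]
  [AddCommGroup N] [Module ℝ N] {P : RootPairing ι ℝ V N} [P.IsRootSystem]

namespace IsBaseF4

variable {b : P.Base} {e : Fin 4 ≃ b.support} {s : ℝ}

theorem gramF4_weylAct (H : IsBaseF4 b e s) (hinv : IsWeylInvariantInner P) (w : P.weylGroup)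
    (v : Fin 4 → ℤ) : gramF4 (weylAct b e w v) (weylAct b e w v) = gramF4 v v := by
  have hs := H.pos
  have h := inner_weylGroup_smul hinv w (intComb (simpleBasis b e) v) (intComb (simpleBasis b e) v)
  rw [smul_intComb, H.inner_eq, H.inner_eq] at h
  have h' := mul_left_cancel₀ (by positivity) h
  exact_mod_cast h'

theorem weylPull_simple {K : Type*} [CommRing K] (H : IsBaseF4 b e s) (k : Fin 4) (y : Fin 4 → K) :
    weylPull b e (RootPairing.weylGroup.ofIdx P (e k)) y =
      fun j => y j - (CartanMatrix.F₄ j k : K) * y k := by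
  have hact : ∀ v, weylAct b e (RootPairing.weylGroup.ofIdx P (e k)) v = reflectF4 k v := by
    intro v
    refine weylAct_eq_of_smul b e ?_
    rw [RootPairing.weylGroup.ofIdx_smul, RootPairing.Equiv.reflection_smul, H.reflection_eq]
  ext j
  have hv : reflectF4 k (Pi.single j 1) = Pi.single j 1 - Pi.single k (CartanMatrix.F₄ j k) := by
    ext i
    simp [reflectF4, Pi.single_apply]
  rw [weylPull, ← weylAct_single, hact, hv, evalForm_sub, evalForm_single, evalForm_single]
  simp

theorem weylPull_highest {K : Type*} [CommRing K] (H : IsBaseF4 b e s)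
    (hinv : IsWeylInvariantInner P) {θ : ι}
    (hθ : P.root θ = intComb (simpleBasis b e) highestF4) (y : Fin 4 → K) :
    weylPull b e (RootPairing.weylGroup.ofIdx P θ) y =
      fun j => y j - if j = 0 then evalForm highestF4 y else 0 := by
  have hs := H.pos
  have hact : ∀ v, weylAct b e (RootPairing.weylGroup.ofIdx P θ) v =
      v - fun j => v 0 * highestF4 j := by
    intro v
    refine weylAct_eq_of_smul b e ?_
    have h1 : gramF4 v highestF4 = 2 * v 0 := by
      rw [gramF4_apply]
      simp only [highestF4, Matrix.cons_val]
      ring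
    have h2 : gramF4 highestF4 highestF4 = 4 := gramF4_long _ (by decide)
    rw [RootPairing.weylGroup.ofIdx_smul, RootPairing.Equiv.reflection_smul,
      reflection_eq_of_inner hinv, hθ, H.inner_eq, H.inner_eq, h1, h2, intComb_sub]
    have h3 : 2 * (s / 2 * ((2 * v 0 : ℤ) : ℝ)) / (s / 2 * ((4 : ℤ) : ℝ)) = v 0 := by
      push_cast
      field_simp
      ring
    rw [h3]
    congr 1
    simp only [intComb, Finset.smul_sum, smul_smul]
    push_cast
    rfl
  ext j
  rw [weylPull, ← weylAct_single, hact, evalForm_sub, evalForm_single]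
  by_cases hj : j = 0
  · subst hj
    simp [evalForm]
  · simp [hj, evalForm]

variable [Finite ι] [P.IsCrystallographic] [P.IsReduced]

theorem weylAct_mem (H : IsBaseF4 b e s) (w : P.weylGroup) {v : Fin 4 → ℤ} (hv : v ∈ posF4) :
    weylAct b e w v ∈ posF4 ∨ -weylAct b e w v ∈ posF4 := by
  obtain ⟨i, hi⟩ := H.exists_root v hv
  obtain ⟨v', hv', h⟩ := H.exists_vector (P.weylGroupToPerm w i)
  rw [← P.weylGroup_apply_root, hi] at h
  rw [weylAct_eq_of_smul b e h]
  exact hv'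

theorem weylAct_mem_short (H : IsBaseF4 b e s) (hinv : IsWeylInvariantInner P) (w : P.weylGroup)
    {v : Fin 4 → ℤ} (hv : v ∈ shortF4) :
    weylAct b e w v ∈ shortF4 ∨ -weylAct b e w v ∈ shortF4 := by
  have hg := (H.gramF4_weylAct hinv w v).trans (gramF4_short v hv)
  have key : ∀ u ∈ posF4, gramF4 u u = 2 → u ∈ shortF4 := by
    intro u hu h
    refine (Finset.mem_union.1 hu).resolve_right fun hl => ?_
    rw [gramF4_long u hl] at h
    omega
  rcases H.weylAct_mem w (Finset.mem_union_left _ hv) with h | h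
  · exact Or.inl (key _ h hg)
  · exact Or.inr (key _ h (by rw [gramF4_neg, hg]))

theorem ne_zero_of_isAvoiding {m q : ℕ} {z : Fin 4 → ZMod q} (hz : IsAvoidingF4 m z)
    {v : Fin 4 → ℤ} (hv : v ∈ posF4) : evalForm v z ≠ 0 := by
  rcases Finset.mem_union.1 hv with hv | hv
  · simpa using hz.1 v hv 0 (Finset.mem_Icc.2 ⟨by omega, by omega⟩)
  · exact hz.2 v hv

theorem isAvoiding_weylPull (H : IsBaseF4 b e s) (hinv : IsWeylInvariantInner P) {m q : ℕ}
    {z : Fin 4 → ZMod q} (hz : IsAvoidingF4 m z) (w : P.weylGroup) :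
    IsAvoidingF4 m (weylPull b e w z) := by
  constructor
  · intro v hv k hk h
    rw [← evalForm_weylAct] at h
    rw [Finset.mem_Icc] at hk
    rcases H.weylAct_mem_short hinv w hv with h' | h'
    · exact hz.1 _ h' k (Finset.mem_Icc.2 hk) h
    · refine hz.1 _ h' (-k) (Finset.mem_Icc.2 ⟨by omega, by omega⟩) ?_
      rw [evalForm_neg, h, Int.cast_neg]
  · intro v hv h
    rw [← evalForm_weylAct] at h
    rcases H.weylAct_mem w (Finset.mem_union_right _ hv) with h' | h'
    · exact ne_zero_of_isAvoiding hz h' h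
    · exact ne_zero_of_isAvoiding hz h' (by rw [evalForm_neg, h, neg_zero])

theorem isAvoiding_of_inAlcove {m q : ℕ} {y : Fin 4 → ℤ} (hy : InAlcoveF4 m q y) :
    IsAvoidingF4 m fun k => (y k : ZMod q) := by
  constructor
  · intro v hv k hk h
    have hb := hy.bounds_short v hv
    rw [Finset.mem_Icc] at hk
    rw [evalForm_intCast] at h
    obtain ⟨t, ht⟩ := exists_eq_add_mul_of_cast_eq h
    have := eq_zero_of_abs_lt_of_eq_mul (x := evalForm v y - k) (q := (q : ℤ)) (t := t)
      (by rw [abs_lt]; omega) (by linarith)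
    omega
  · intro v hv h
    have hb := hy.bounds_pos v (Finset.mem_union_right _ hv)
    rw [evalForm_intCast, ← Int.cast_zero] at h
    obtain ⟨t, ht⟩ := exists_eq_add_mul_of_cast_eq h
    have := eq_zero_of_abs_lt_of_eq_mul (x := evalForm v y) (q := (q : ℤ)) (t := t)
      (by rw [abs_lt]; omega) (by linarith)
    omega

/-- Every avoiding point is a Weyl translate of a point of the alcove: the point closest to the
centre of the alcove, among the lifts of all translates, lies in the alcove. -/
theorem exists_inAlcove (H : IsBaseF4 b e s) (hinv : IsWeylInvariantInner P) {m q : ℕ} (hq : 0 < q)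
    {z : Fin 4 → ZMod q} (hz : IsAvoidingF4 m z) :
    ∃ (w : P.weylGroup) (y : Fin 4 → ℤ), InAlcoveF4 m q y ∧
      weylPull b e w (fun k => (y k : ZMod q)) = z := by
  have : NeZero q := ⟨hq.ne'⟩
  set S : Set (Fin 4 → ℤ) :=
    {y | ∃ w : P.weylGroup, (fun k => (y k : ZMod q)) = weylPull b e w z} with hS
  have hne : S.Nonempty := by
    refine ⟨fun k => (z k).valMinAbs, 1, ?_⟩
    rw [weylPull_one]
    ext k
    exact ZMod.coe_valMinAbs _
  obtain ⟨y, ⟨w, hw⟩, hmin⟩ :=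
    WellFounded.has_min (measure fun y => (distanceF4 q y).toNat).wf S hne
  have hmin' : ∀ y' ∈ S, distanceF4 q y ≤ distanceF4 q y' := by
    intro y' hy'
    have h : ¬ (distanceF4 q y').toNat < (distanceF4 q y).toNat := hmin y' hy'
    have := distanceF4_nonneg q y'
    omega
  have hav := H.isAvoiding_weylPull hinv hz w
  rw [← hw] at hav
  have hval : ∀ v ∈ posF4, ∀ t : ℤ, evalForm v y ≠ q * t := by
    intro v hv t h
    refine ne_zero_of_isAvoiding hav hv ?_
    rw [evalForm_intCast, h]
    simp
  -- Were `y k` negative, the simple reflection would bring the point closer to the centre.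
  have hsimple : ∀ k, 1 ≤ y k := by
    intro k
    have h0 : y k ≠ 0 := by
      have := hval _ (single_mem_posF4 k) 0
      rw [evalForm_single] at this
      simpa using this
    by_contra hlt
    refine absurd (distanceF4_reflect_lt q hq y k (by omega)) (not_lt.2 (hmin' _ ?_))
    refine ⟨w * RootPairing.weylGroup.ofIdx P (e k), ?_⟩
    rw [← weylPull_weylPull, ← hw, H.weylPull_simple]
    ext j
    push_cast
    rfl
  -- Likewise for the affine reflection in the wall `θ = q`, which modulo `q` is the reflection in
  -- the highest root.
  have hhigh : evalForm highestF4 y < q := by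
    have h0 : evalForm highestF4 y ≠ q := by simpa using hval highestF4 (by decide) 1
    by_contra hlt
    refine absurd (distanceF4_affine_lt q hq y (by omega)) (not_lt.2 (hmin' _ ?_))
    obtain ⟨θ, hθ⟩ := H.exists_root highestF4 (by decide)
    refine ⟨w * RootPairing.weylGroup.ofIdx P θ, ?_⟩
    rw [← weylPull_weylPull, ← hw, H.weylPull_highest hinv hθ]
    ext j
    rw [evalForm_intCast]
    by_cases hj : j = 0 <;> simp [hj]
  have hshort : ∀ k : Fin 4, Pi.single k 1 ∈ shortF4 → m + 1 ≤ y k := by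
    intro k hk
    have h1 := hsimple k
    by_contra hlt
    refine hav.1 _ hk (y k) (Finset.mem_Icc.2 ⟨by omega, by omega⟩) ?_
    rw [evalForm_single, Int.cast_one, one_mul]
  refine ⟨w⁻¹, y, ⟨hsimple 0, hsimple 1, hshort 2 (by decide), hshort 3 (by decide), ?_⟩, ?_⟩
  · rw [evalForm_four] at hhigh
    simp only [highestF4, Matrix.cons_val] at hhigh
    push_cast at hhigh
    omega
  · rw [hw, weylPull_weylPull, mul_inv_cancel, weylPull_one]

/-- Two points of the alcove that are Weyl translates of each other modulo `q` are related by the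
identity: the numbers of multiples of `q` by which the values on the positive roots differ are `0`
or `1` and additive, hence zero since the highest root involves each simple root at least twice;
so the Weyl group element preserves the positive roots, and it fixes the simple roots because it
preserves lengths and the highest root. -/
theorem eq_one_of_inAlcove (H : IsBaseF4 b e s) (hinv : IsWeylInvariantInner P) {m q : ℕ}
    {y y' : Fin 4 → ℤ} (hy : InAlcoveF4 m q y) (hy' : InAlcoveF4 m q y') (u : P.weylGroup)
    (h : (fun k => (y' k : ZMod q)) = weylPull b e u fun k => (y k : ZMod q)) : u = 1 := by
  have hex : ∀ k, ∃ t : ℤ, y' k = weylPull b e u y k + q * t := by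
    intro k
    refine exists_eq_add_mul_of_cast_eq ?_
    rw [weylPull_intCast] at h
    exact congrFun h k
  choose n hn using hex
  have hq : (0 : ℤ) < q := by
    have := hy.highest
    have := hy.one_le 0
    have := hy.one_le 1
    have := hy.one_le 2
    have := hy.one_le 3
    omega
  have hlin : ∀ v, evalForm v y' = evalForm (weylAct b e u v) y + q * evalForm v n := by
    intro v
    rw [evalForm_weylAct]
    simp only [evalForm, hn, Finset.mul_sum, ← Finset.sum_add_distrib]
    exact Finset.sum_congr rfl fun k _ => by push_cast; ring
  -- On the alcove positive roots take values strictly between `0` and `q`.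
  have h01 : ∀ v ∈ posF4, 0 ≤ evalForm v n ∧ evalForm v n ≤ 1 ∧
      (evalForm v n = 0 → weylAct b e u v ∈ posF4) := by
    intro v hv
    have b1 := hy'.bounds_pos v hv
    have hl := hlin v
    rcases H.weylAct_mem u hv with hpos | hneg
    · have b2 := hy.bounds_pos _ hpos
      have := eq_zero_of_abs_lt_of_eq_mul
        (x := evalForm v y' - evalForm (weylAct b e u v) y) (q := (q : ℤ)) (t := evalForm v n)
        (by rw [abs_lt]; omega) (by linarith)
      have h0 : evalForm v n = 0 := by
        have h' : (q : ℤ) * evalForm v n = 0 := by omega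
        exact (mul_eq_zero.1 h').resolve_left hq.ne'
      rw [h0]
      exact ⟨le_rfl, zero_le_one, fun _ => hpos⟩
    · have b2 := hy.bounds_pos _ hneg
      rw [evalForm_neg] at b2
      have h2 : (q : ℤ) * evalForm v n < q * 2 := by omega
      have h3 : (q : ℤ) * 0 < q * evalForm v n := by omega
      have h4 := lt_of_mul_lt_mul_left h2 hq.le
      have h5 := lt_of_mul_lt_mul_left h3 hq.le
      exact ⟨by omega, by omega, fun h0 => by omega⟩
  have hn0 : ∀ k, n k = 0 := by
    have hk : ∀ k, 0 ≤ n k := by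
      intro k
      have := (h01 _ (single_mem_posF4 k)).1
      rw [evalForm_single] at this
      simpa using this
    have hθ := (h01 highestF4 (by decide)).2.1
    rw [evalForm_four] at hθ
    simp only [highestF4, Matrix.cons_val] at hθ
    push_cast at hθ
    have k0 := hk 0
    have k1 := hk 1
    have k2 := hk 2
    have k3 := hk 3
    intro k
    fin_cases k <;> simp only [Fin.reduceFinMk, Fin.zero_eta, Fin.mk_one] <;> omega
  have hpos : ∀ v ∈ posF4, weylAct b e u v ∈ posF4 := by
    intro v hv
    refine (h01 v hv).2.2 ?_
    simp [evalForm, hn0]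
  have hcoords : ∀ k, weylCoords b e u k ∈ posF4 := fun k => by
    rw [← weylAct_single]
    exact hpos _ (single_mem_posF4 k)
  have hθ := hpos highestF4 (by decide)
  have hθi : ∀ i, weylAct b e u highestF4 i = 2 * weylCoords b e u 0 i +
      3 * weylCoords b e u 1 i + 4 * weylCoords b e u 2 i + 2 * weylCoords b e u 3 i := by
    intro i
    simp [weylAct, Fin.sum_univ_four, highestF4]
  have hsum := fun k => one_le_sum_posF4 _ (hcoords k)
  have hs0 := hsum 0
  have hs1 := hsum 1
  have hs2 := hsum 2
  have hs3 := hsum 3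
  have hu := posF4_le_highest _ hθ
  have hu0 := hu 0
  have hu1 := hu 1
  have hu2 := hu 2
  have hu3 := hu 3
  rw [hθi] at hu0 hu1 hu2 hu3
  simp only [highestF4, Matrix.cons_val] at hu0 hu1 hu2 hu3
  -- The height of the image of the highest root is at most `11 = 2 + 3 + 4 + 2`, so the images of
  -- the simple roots all have height one.
  have hsingle : ∀ k, ∃ a, weylCoords b e u k = Pi.single a 1 := by
    intro k
    refine eq_single_of_sum_le_one _ (hcoords k) ?_
    rw [Fin.sum_univ_four]
    fin_cases k <;> simp only [Fin.reduceFinMk, Fin.zero_eta, Fin.mk_one] <;> omega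
  have hhigh : weylAct b e u highestF4 = highestF4 := by
    refine eq_highestF4_of_sum _ hθ ?_
    rw [Fin.sum_univ_four, hθi, hθi, hθi, hθi]
    omega
  choose π hπ using hsingle
  have hgram : ∀ k, gramF4 (Pi.single (π k) 1) (Pi.single (π k) 1) =
      gramF4 (Pi.single k 1) (Pi.single k 1) := by
    intro k
    rw [← hπ, ← weylAct_single, H.gramF4_weylAct hinv]
  have hfix := eq_of_single_highestF4 (π 0) (π 1) (π 2) (π 3)
    ⟨fun i => by rw [← hπ, ← hπ, ← hπ, ← hπ, ← hθi, hhigh],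
      (hgram 0).trans (by decide +kernel), (hgram 3).trans (by decide +kernel)⟩
  have hπ' : ∀ k, π k = k := by
    obtain ⟨f0, f1, f2, f3⟩ := hfix
    intro k
    fin_cases k
    exacts [f0, f1, f2, f3]
  refine weylGroup_eq_of_smul_basis (simpleBasis b e) fun k => ?_
  rw [simpleBasis_apply, smul_simple, hπ, hπ', intComb_single, simpleBasis_apply, one_smul,
    Int.cast_one, one_smul]

theorem avoidCount_eq (H : IsBaseF4 b e s) (hinv : IsWeylInvariantInner P) (m r : ℕ)
    [NeZero (r + 6 * m + 12)] : avoidCount shortF4 longF4 m (r + 6 * m + 12) =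
      Nat.card P.weylGroup * (alcoveTuples r).card := by
  classical
  have := finite_weylGroup b e
  have := Fintype.ofFinite P.weylGroup
  set q := r + 6 * m + 12 with hq
  -- The coordinates are at least `1` on long and `m + 1` on short simple roots; the tuple records
  -- the excess, and the bound `θ ≤ q - 1` becomes the inequality that defines `alcoveTuples`.
  let pt : (Σ _ : ℕ, Σ _ : ℕ, Σ _ : ℕ, ℕ) → Fin 4 → ℤ := fun x =>
    ![(x.2.2.1 : ℤ) + 1, (x.1 : ℤ) + 1, (x.2.1 : ℤ) + m + 1, (x.2.2.2 : ℤ) + m + 1]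
  have hpt : ∀ x ∈ alcoveTuples r, InAlcoveF4 m q (pt x) := by
    intro x hx
    rw [mem_alcoveTuples] at hx
    constructor <;> simp only [pt, Matrix.cons_val] <;> omega
  rw [Nat.card_eq_fintype_card, ← Finset.card_univ, ← Finset.card_product, avoidCount]
  symm
  refine Finset.card_bij (fun x _ => weylPull b e x.1 fun k => (pt x.2 k : ZMod q)) ?_ ?_ ?_
  · rintro ⟨w, x⟩ hx
    have h := H.isAvoiding_weylPull hinv
      (isAvoiding_of_inAlcove (hpt x (Finset.mem_product.1 hx).2)) w
    exact Finset.mem_filter.2 ⟨Finset.mem_univ _, h⟩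
  · rintro ⟨w, x⟩ hx ⟨w', x'⟩ hx' h
    have hx := hpt x (Finset.mem_product.1 hx).2
    have hx' := hpt x' (Finset.mem_product.1 hx').2
    have h1 := congrArg (weylPull b e w'⁻¹) h
    simp only [weylPull_weylPull, mul_inv_cancel, weylPull_one] at h1
    have h2 := H.eq_one_of_inAlcove hinv hx hx' (w * w'⁻¹) h1.symm
    rw [h2, weylPull_one] at h1
    have h3 : ∀ k, pt x k = pt x' k := by
      intro k
      obtain ⟨t, ht⟩ := exists_eq_add_mul_of_cast_eq (congrFun h1 k)
      have b1 := hx.bounds_pos _ (single_mem_posF4 k)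
      have b2 := hx'.bounds_pos _ (single_mem_posF4 k)
      rw [evalForm_single] at b1 b2
      simp only [Int.cast_one, one_mul] at b1 b2
      have := eq_zero_of_abs_lt_of_eq_mul (x := pt x k - pt x' k) (q := (q : ℤ)) (t := t)
        (by rw [abs_lt]; omega) (by linarith)
      omega
    have h4 := h3 0
    have h5 := h3 1
    have h6 := h3 2
    have h7 := h3 3
    simp only [pt, Matrix.cons_val] at h4 h5 h6 h7
    obtain ⟨x1, x2, x3, x4⟩ := x
    obtain ⟨x1', x2', x3', x4'⟩ := x'
    simp only at h4 h5 h6 h7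
    obtain rfl : x1 = x1' := by omega
    obtain rfl : x2 = x2' := by omega
    obtain rfl : x3 = x3' := by omega
    obtain rfl : x4 = x4' := by omega
    rw [mul_inv_eq_one.1 h2]
  · intro z hz
    obtain ⟨w, y, hy, hw⟩ := H.exists_inAlcove hinv (m := m) (by omega) (Finset.mem_filter.1 hz).2
    obtain ⟨h0, h1, h2, h3, h4⟩ := hy
    refine ⟨(w, ⟨(y 1 - 1).toNat, (y 2 - m - 1).toNat, (y 0 - 1).toNat, (y 3 - m - 1).toNat⟩),
      Finset.mem_product.2 ⟨Finset.mem_univ _, mem_alcoveTuples.2 ?_⟩, ?_⟩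
    · simp only
      omega
    · rw [← hw]
      congr 1
      ext k
      congr 1
      fin_cases k <;> simp only [pt, Fin.reduceFinMk, Fin.zero_eta, Fin.mk_one, Matrix.cons_val] <;>
        omega

end IsBaseF4

end WeylF4

/-! ### Exponents and characteristic polynomials in type `F₄` -/

section ConclusionF4

variable {ι V N : Type*} [NormedAddCommGroup V] [InnerProductSpace ℝ V]
  [AddCommGroup N] [Module ℝ N] {P : RootPairing ι ℝ V N} [P.IsRootSystem]

/-- The Coxeter element of type `F₄` in simple coordinates. -/
def coxeterF4 (v : Fin 4 → ℤ) : Fin 4 → ℤ :=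
  reflectF4 0 (reflectF4 1 (reflectF4 2 (reflectF4 3 v)))

namespace IsBaseF4

variable {b : P.Base} {e : Fin 4 ≃ b.support} {s : ℝ}

theorem coxeterElement_apply (H : IsBaseF4 b e s) (v : Fin 4 → ℤ) :
    coxeterElement b e (intComb (simpleBasis b e) v) =
      intComb (simpleBasis b e) (coxeterF4 v) := by
  simp only [coxeterElement, List.ofFn_succ, List.ofFn_zero, List.prod_cons, List.prod_nil,
    mul_one, LinearEquiv.mul_apply, Fin.succ_zero_eq_one, Fin.succ_one_eq_two,
    show (2 : Fin 3).succ = 3 from rfl, coxeterF4]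
  rw [← H.reflection_eq, ← H.reflection_eq, ← H.reflection_eq, ← H.reflection_eq]

theorem coxeterElement_pow_apply (H : IsBaseF4 b e s) (n : ℕ) (v : Fin 4 → ℤ) :
    (coxeterElement b e ^ n) (intComb (simpleBasis b e) v) =
      intComb (simpleBasis b e) (coxeterF4^[n] v) := by
  induction n generalizing v with
  | zero => rfl
  | succ n ih =>
    rw [pow_succ, LinearEquiv.mul_apply, H.coxeterElement_apply, ih, Function.iterate_succ_apply]

theorem simpleBasis_eq_intComb (k : Fin 4) :
    simpleBasis b e k = intComb (simpleBasis b e) (Pi.single k 1) := by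
  rw [intComb_single, Int.cast_one, one_smul]

theorem orderOf_coxeter (H : IsBaseF4 b e s) : orderOf (coxeterElement b e) = 12 := by
  have hne : ∀ n, coxeterF4^[n] (Pi.single 0 1) ≠ Pi.single 0 1 → coxeterElement b e ^ n ≠ 1 := by
    intro n hn h
    refine hn (intComb_injective (simpleBasis b e) ?_)
    rw [← H.coxeterElement_pow_apply, h]
    rfl
  refine orderOf_eq_of_pow_and_pow_div_prime (by norm_num) ?_ ?_
  · refine LinearEquiv.toLinearMap_injective ((simpleBasis b e).ext fun k => ?_)
    have h : coxeterF4^[12] (Pi.single k 1) = Pi.single k 1 := by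
      revert k
      decide +kernel
    rw [LinearEquiv.coe_coe, LinearEquiv.coe_coe, simpleBasis_eq_intComb,
      H.coxeterElement_pow_apply, h]
    rfl
  · intro q hq hdvd
    have hq' : q = 2 ∨ q = 3 := by
      have h1 : q ∣ 2 ^ 2 * 3 := by simpa using hdvd
      rcases (Nat.Prime.dvd_mul hq).1 h1 with h | h
      · exact Or.inl ((Nat.prime_dvd_prime_iff_eq hq Nat.prime_two).1 (hq.dvd_of_dvd_pow h))
      · exact Or.inr ((Nat.prime_dvd_prime_iff_eq hq Nat.prime_three).1 h)
    rcases hq' with rfl | rfl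
    · exact hne 6 (by decide +kernel)
    · exact hne 4 (by decide +kernel)

theorem charpoly_coxeter [FiniteDimensional ℝ V] (H : IsBaseF4 b e s) :
    (coxeterElement b e : V →ₗ[ℝ] V).charpoly = X ^ 4 - X ^ 2 + 1 := by
  have hM : LinearMap.toMatrix (simpleBasis b e) (simpleBasis b e)
      (coxeterElement b e : V →ₗ[ℝ] V) =
      (Matrix.of fun i j => coxeterF4 (Pi.single j 1) i).map (Int.cast : ℤ → ℝ) := by
    ext i j
    rw [LinearMap.toMatrix_apply, LinearEquiv.coe_coe, simpleBasis_eq_intComb,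
      H.coxeterElement_apply, basis_repr_intComb]
    rfl
  have hZ : (Matrix.of fun i j => coxeterF4 (Pi.single j 1) i) =
      !![0, 1, 0, -1; 1, 1, 0, -1; 0, 2, 0, -1; 0, 0, 1, -1] := by
    decide +kernel
  have hdet : (!![0, 1, 0, -1; 1, 1, 0, -1; 0, 2, 0, -1; 0, 0, 1, -1] :
      Matrix (Fin 4) (Fin 4) ℤ).charpoly = X ^ 4 - X ^ 2 + 1 := by
    simp [Matrix.charpoly, Matrix.det_succ_row_zero, Fin.sum_univ_succ, Matrix.charmatrix_apply,
      Fin.succAbove, Matrix.diagonal_apply]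
    ring
  have hc : (Int.cast : ℤ → ℝ) = Int.castRingHom ℝ := rfl
  rw [← LinearMap.charpoly_toMatrix _ (simpleBasis b e), hM, hZ, hc,
    Matrix.charpoly_map, hdet]
  simp

theorem weylExponents_eq [FiniteDimensional ℝ V] (H : IsBaseF4 b e s) :
    weylExponents b e = {1, 5, 7, 11} := by
  have hcyc : (X ^ 4 - X ^ 2 + 1 : ℝ[X]).map (algebraMap ℝ ℂ) = cyclotomic 12 ℂ := by
    have h := cyclotomic_expand_eq_cyclotomic Nat.prime_two (show 2 ∣ 6 by norm_num) ℂ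
    rw [cyclotomic_six] at h
    norm_num at h
    rw [← h]
    simp [← pow_mul]
  rw [weylExponents, H.orderOf_coxeter, H.charpoly_coxeter, hcyc]
  have hmult : ∀ k : ℕ, (cyclotomic 12 ℂ).rootMultiplicity
      (Complex.exp (2 * Real.pi * Complex.I * k / (12 : ℕ))) = if k.Coprime 12 then 1 else 0 := by
    intro k
    have hprim := Complex.isPrimitiveRoot_exp 12 (by norm_num)
    have hexp : Complex.exp (2 * Real.pi * Complex.I * k / (12 : ℕ)) =
        Complex.exp (2 * Real.pi * Complex.I / (12 : ℕ)) ^ k := by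
      rw [← Complex.exp_nat_mul]
      congr 1
      ring
    have : NeZero ((12 : ℕ) : ℂ) := ⟨by norm_num⟩
    rw [hexp]
    split_ifs with hk
    · refine le_antisymm (rootMultiplicity_le_one_of_separable
        (separable_cyclotomic 12 ℂ) _) ?_
      rw [Nat.one_le_iff_ne_zero, ← Nat.pos_iff_ne_zero,
        rootMultiplicity_pos (cyclotomic_ne_zero 12 ℂ), isRoot_cyclotomic_iff]
      exact hprim.pow_of_coprime k hk
    · refine rootMultiplicity_eq_zero ?_
      rw [isRoot_cyclotomic_iff, hprim.pow_iff_coprime (by norm_num)]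
      exact hk
  simp only [hmult]
  decide +kernel

section

variable [Fintype ι] [FiniteDimensional ℝ V] [P.IsCrystallographic] [P.IsReduced]

theorem charpoly_semiCatalan_and_card (H : IsBaseF4 b e s) (hinv : IsWeylInvariantInner P) (m : ℕ) :
    arrangementCharpoly (semiCatalan b m) = ((({1, 5, 7, 11} : Multiset ℕ)).map
      fun k : ℕ => X - C ((m * 6 : ℕ) : ℤ) - C (k : ℤ)).prod ∧
    (1152 : ℤ) = (Nat.card P.weylGroup : ℤ) := by
  refine charpoly_semiCatalan_eq_of_count H.isRootModel m _ (monic_prod_exponents _ _) _ 1152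
    (by norm_num) fun M hM B => ?_
  -- `q = 6 (m + w + 2) + 1`, so that `q - 6 m - 12 = 6 w + 1`
  obtain ⟨w, hw⟩ : ∃ w, m + w + 2 = M * (B + m + 2) :=
    ⟨M * (B + m + 2) - (m + 2), by
      have := Nat.le_mul_of_pos_left (B + m + 2) (Nat.pos_of_ne_zero hM)
      omega⟩
  have hq : 6 * w + 1 + 6 * m + 12 = 1 + M * (6 * (B + m + 2)) := by
    have : M * (6 * (B + m + 2)) = 6 * (M * (B + m + 2)) := by ring
    omega
  refine ⟨6 * w + 1 + 6 * m + 12, ?_, ?_, ?_⟩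
  · have := Nat.le_mul_of_pos_left (B + m + 2) (Nat.pos_of_ne_zero hM)
    omega
  · rw [hq, Nat.coprime_add_mul_left_left]
    exact Nat.coprime_one_left M
  · intro _
    rw [H.avoidCount_eq hinv m (6 * w + 1)]
    have h := eight_mul_card_alcoveTuples w
    have h' : (8 : ℤ) * ((alcoveTuples (6 * w + 1)).card : ℤ) =
        (w + 1) * (w + 2) * (3 * w + 1) * (3 * w + 4) := by exact_mod_cast h
    simp only [Multiset.insert_eq_cons, Multiset.map_cons, Multiset.map_singleton,
      Multiset.prod_cons, Multiset.prod_singleton, eval_mul, eval_sub, eval_X, eval_C]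
    push_cast
    linear_combination (144 * (Nat.card P.weylGroup : ℤ)) * h'

theorem hasExponentProducts (H : IsBaseF4 b e s) (hinv : IsWeylInvariantInner P) :
    HasExponentProducts b e 6 {1, 5, 7, 11} where
  one_le := by norm_num
  weylExponents_eq := H.weylExponents_eq
  charpoly_eq m := (H.charpoly_semiCatalan_and_card hinv m).1
  card_weylGroup := by
    have h := (H.charpoly_semiCatalan_and_card hinv 0).2
    have h' : Nat.card P.weylGroup = 1152 := by exact_mod_cast h.symm
    rw [h']
    rfl
  ncard_antichains := by
    rw [H.ncard_antichains.1]
    rfl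
  ncard_strict := by
    rw [H.ncard_antichains.2]
    rfl

end

end IsBaseF4

end ConclusionF4
theorem mainTheorem4 {ι V N : Type*} [Fintype ι] [NormedAddCommGroup V] [InnerProductSpace ℝ V]
    [FiniteDimensional ℝ V] [AddCommGroup N] [Module ℝ N]
    (P : RootPairing ι ℝ V N) [P.IsRootSystem] [P.IsCrystallographic] [P.IsReduced]
    (hinv : IsWeylInvariantInner P)
    (b : P.Base) {p : ℕ} (e : Fin p ≃ b.support)
    (htype : IsCartanBCF (numberedCartanMatrix b e))
    (θ : ι) (hθ : IsHighestRoot b θ)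
    (c : Fin p → ℕ) (hc : P.root θ = ∑ i, c i • P.root (e i))
    (g : ℕ) (hg : g = shortCoordSum b e c) :
    (∀ m : ℕ,
      arrangementCharpoly (semiCatalan b m) =
          (arrangementCharpoly (semiCatalan b 0)).comp (X - C ((m * g : ℕ) : ℤ)) ∧
      arrangementCharpoly (semiCatalan b m) =
          ((weylExponents b e).map fun k : ℕ => X - C ((m * g : ℕ) : ℤ) - C (k : ℤ)).prod) ∧
    arrangementCharpoly (semiCatalan b 1) =
        ((weylExponents b e).map fun k : ℕ => X - C (g : ℤ) - C (k : ℤ)).prod ∧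
    (((shortAntichains b).ncard : ℚ) =
        (|(arrangementCharpoly (semiCatalan b 1)).eval (-1)| : ℤ) / (Nat.card P.weylGroup : ℚ) ∧
      ((shortAntichains b).ncard : ℚ) =
        ((weylExponents b e).map fun k : ℕ => ((g : ℚ) + k + 1) / (k + 1)).prod) ∧
    (((strictlyPosShortAntichains b).ncard : ℚ) =
        (|(arrangementCharpoly (semiCatalan b 1)).eval 1| : ℤ) / (Nat.card P.weylGroup : ℚ) ∧
      ((strictlyPosShortAntichains b).ncard : ℚ) =
        ((weylExponents b e).map fun k : ℕ => ((g : ℚ) + k - 1) / (k + 1)).prod) := by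
  suffices h : ∃ E, HasExponentProducts b e g E by
    obtain ⟨E, h⟩ := h
    exact semiCatalan_conclusions_of_exponents b e g h.one_le E h.weylExponents_eq h.charpoly_eq
      h.card_weylGroup h.ncard_antichains h.ncard_strict
  rcases htype with ⟨hp, hA⟩ | ⟨hp, hA⟩ | ⟨h4, hA⟩
  · obtain ⟨ε, s, H⟩ := exists_isSignedBasis hinv b e hp 1 (Or.inl ⟨rfl, hA⟩)
    rw [hg, H.shortCoordSum_one hinv hθ hc]
    exact ⟨_, H.hasExponentProducts_one hinv⟩
  · obtain ⟨ε, s, H⟩ := exists_isSignedBasis hinv b e hp 2 (Or.inr ⟨rfl, hA⟩)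
    rw [hg, H.shortCoordSum_two hinv hθ hc]
    exact ⟨_, H.hasExponentProducts_two hinv⟩
  · subst h4
    obtain ⟨s, H⟩ := exists_isBaseF4 hinv b e hA
    rw [hg, H.shortCoordSum_eq hθ hc]
    exact ⟨_, H.hasExponentProducts hinv⟩
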